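/- Every hypertree is $k$-cordial for $k \in \{2,3\}$. Here a hypergraph is a pair $H=(V,E)$ with $V$ a finite set and $E$ a set of subsets of $V$ (called edges), each of cardinality at least $2$. The incidence graph of $H$ is the bipartite graph with vertex set $V \sqcup E$ in which $v \in V$ is adjacent to $e \in E$ if and only if $v \in e$. A hypertree is a hypergraph whose incidence graph is connected and has no cycles, that is, is a tree (in particular $V \neq \emptyset$). A vertex labeling $f : V \to \mathbb{Z}_k$ induces the edge labeling $f(e) = \sum_{v \in e} f(v) \in \mathbb{Z}_k$ for $e \in E$. The labeling $f$ is called $k$-cordial if for all $a, b \in \mathbb{Z}_k$ the number of vertices with label $a$ differs by at most $1$ from the number of vertices with label $b$, and the number of edges with label $a$ differs by at most $1$ from the number of edges with label $b$. A hypergraph is called $k$-cordial if it admits a $k$-cordial labeling. -/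

import Mathlib

namespace Hypergraph

/-- The incidence graph of a hypergraph `H`: its vertices are the vertices and the edges of `H`,
and a vertex `v` is joined to an edge `e` exactly when `v ∈ e`. -/
def incidenceGraph {α : Type*} (H : Hypergraph α) :
    SimpleGraph (H.vertexSet ⊕ H.edgeSet) where
  Adj x y := match x, y with
    | Sum.inl v, Sum.inr e => (v : α) ∈ (e : Set α)
    | Sum.inr e, Sum.inl v => (v : α) ∈ (e : Set α)
    | _, _ => False
  symm := ⟨by rintro (v | e) (w | f) h <;> exact h⟩
  loopless := ⟨by rintro (v | e) h <;> exact h⟩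

/-- A hypergraph is a hypertree if it is connected and has no cycles, where connectedness and
cycles are understood in its incidence graph. -/
def IsHypertree {α : Type*} (H : Hypergraph α) : Prop :=
  H.incidenceGraph.Connected ∧ H.incidenceGraph.IsAcyclic

/-- The label that a vertex labeling `f` induces on an edge `e`: the sum in `ZMod k` of the labels
of the vertices in `e`. -/
noncomputable def edgeLabel {α : Type*} (H : Hypergraph α) {k : ℕ} (f : H.vertexSet → ZMod k)
    (e : H.edgeSet) : ZMod k :=
  ∑ᶠ (v : H.vertexSet) (_ : (v : α) ∈ (e : Set α)), f v

/-- The number of vertices with label `a`. -/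
noncomputable def vertexCount {α : Type*} (H : Hypergraph α) {k : ℕ} (f : H.vertexSet → ZMod k)
    (a : ZMod k) : ℕ :=
  {v : H.vertexSet | f v = a}.ncard

/-- The number of edges with induced label `a`. -/
noncomputable def edgeCount {α : Type*} (H : Hypergraph α) {k : ℕ} (f : H.vertexSet → ZMod k)
    (a : ZMod k) : ℕ :=
  {e : H.edgeSet | H.edgeLabel f e = a}.ncard

/-- A vertex labeling of a (finite) hypergraph is `k`-cordial if the numbers of vertices with any
two given labels differ by at most `1`, and likewise for the numbers of edges. -/
def IsCordialLabeling {α : Type*} (H : Hypergraph α) {k : ℕ} (f : H.vertexSet → ZMod k) : Prop :=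
  ∀ a b : ZMod k,
    |(H.vertexCount f a : ℤ) - (H.vertexCount f b : ℤ)| ≤ 1 ∧
    |(H.edgeCount f a : ℤ) - (H.edgeCount f b : ℤ)| ≤ 1

/-- A (finite) hypergraph is `k`-cordial if it admits a `k`-cordial labeling. -/
def IsCordial {α : Type*} (H : Hypergraph α) (k : ℕ) : Prop :=
  ∃ f : H.vertexSet → ZMod k, H.IsCordialLabeling f

end Hypergraph

/-! ### Finite search: operations, sets of reachable count changes, decision procedures -/

namespace HypertreeCordial

/-! Root the incidence tree at a vertex. Every edge then consists of a parent vertex and a nonempty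
set of children, and every vertex except the root is a child of exactly one edge. The induction runs
over subtrees containing the root and proves more than cordiality (`Achieves`). Suppose `k` divides
the number of edges. If `k` does not divide the number of vertices, all edge counts can be made
equal while the exceptional vertex label is prescribed. If `k` divides the number of vertices, all
vertex counts can be made equal while the edge counts are, as prescribed, either equal or off by one
edge too few with label 0 and one too many with a given nonzero label. This freedom in the smaller
tree is what lets an extension reach its target.

A reduction deletes a few edges near the leaves, a multiple of `k` of them, together with their
children; it may also detach vertices from edges that stay, or plan to relabel a vertex. Whether a
labelling extends back depends only on the labels of a few boundary vertices and edges, the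
registers. So a reduction is justified by a finite statement: for every target profile there is one
profile of the smaller tree from which every choice of register labels admits an extension. For `k =
3` the old labelling may also be negated. `check` decides this statement, and `testBit_run_sound`
and `Built.achieves` turn a successful check into labellings.

Only finitely many sizes have to be checked, because private vertices of one edge can be removed in
blocks: labels 0, 1, 2 modulo 3, or 0, 0, 1, 1 modulo 2, are balanced and sum to zero
(`Profile.of_removePrivate`). In a tree without such blocks, take a lowest edge `y` that has edges
below it; all of those are leaves. A case distinction on how they are distributed over the children
of `y` finds a reduction (`Irreducible.achieves_two`, `Irreducible.bottom_cases`,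
`Irreducible.achieves_of_pair`, `Irreducible.achieves_of_mixed`). When the edges at `y` alone do not
suffice, either a leaf elsewhere is deleted along with them, or the lack of such leaves forces the
rest of the tree to be the chain of ancestors of `y`, and the edge above `y` is deleted too. The
trees too small for this have a number of edges not divisible by `k`.

If `k` does not divide the number of edges, deleting one or two edges leads to the divisible case,
and putting them back only has to preserve balance (`Irreducible.balanced`). -/

/-- An operation on a labelled rooted hypertree. `edge i s q` hangs a new edge with `s + q` children
at the `i`-th listed vertex, listing the first `s` children; `vert j` adds a private vertex to the
`j`-th listed edge; `flip i js` changes the label of the `i`-th listed vertex, which lies on the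
listed edges `js` and on no other old edge. -/
inductive Op
  | edge (i s q : ℕ)
  | vert (j : ℕ)
  | flip (i : ℕ) (js : List ℕ)

def tuples (k : ℕ) : ℕ → List (List ℕ)
  | 0 => [[]]
  | n + 1 => (List.range k).flatMap fun x => (tuples k n).map (x :: ·)

/-- Label 0 has no digit, since its count follows from the total. -/
def vcode (x : ℕ) : ℕ := if x = 1 then 1 else if x = 2 then 16 else 0
def ecode (x : ℕ) : ℕ := if x = 1 then 256 else if x = 2 then 4096 else 0

/-- The possible numbers of unlisted children with labels 1 and 2. Only these numbers matter for
such children; modulo 2 the second one is 0. -/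
def comps (k d : ℕ) : List (ℕ × ℕ) :=
  (List.range (d + 1)).flatMap fun i =>
    (List.range (if k = 3 then d + 1 - i else 1)).map fun j => (i, j)

/-- A natural number stands for the set of positions of its one bits, so that a shift translates the
set and a disjunction is a union. -/
def shiftUnion (L : List ℕ) (M : ℕ) : ℕ := L.foldr (fun c a => (M <<< c) ||| a) 0
def bigUnion (L : List ℕ) : ℕ := L.foldr (fun c a => c ||| a) 0

def setAll (k : ℕ) (ls : List ℕ) (js : List ℕ) (t : ℕ) : List ℕ :=
  js.foldr (fun j l => l.set j ((l.getD j 0 + t) % k)) ls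

/-- The bitmap of all count increments that the operations can achieve, starting from the labels
`vs` of the listed vertices and `ls` of the listed edges. An increment is coded in base 16: two
digits for the vertices labelled 1 and 2, then two digits for the edges labelled 1 and 2. -/
def run (k : ℕ) : List Op → List ℕ → List ℕ → ℕ
  | [], _, _ => 1
  | .edge i s q :: ops, vs, ls =>
    bigUnion ((tuples k s).map fun ts =>
      shiftUnion ((comps k q).map fun c => (ts.map vcode).sum + c.1 + 16 * c.2 +
        ecode ((vs.getD i 0 + ts.sum + c.1 + 2 * c.2) % k)) (run k ops (vs ++ ts) ls))
  | .vert j :: ops, vs, ls =>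
    bigUnion ((List.range k).map fun t =>
      run k ops (vs ++ [t]) (ls.set j ((ls.getD j 0 + t) % k)) <<<
        (vcode t + (4352 - ecode (ls.getD j 0)) + ecode ((ls.getD j 0 + t) % k)))
  | .flip i js :: ops, vs, ls =>
    bigUnion ((List.range k).map fun t =>
      run k ops (vs.set i t) (setAll k ls js (t + (k - vs.getD i 0))) <<<
        ((17 - vcode (vs.getD i 0)) + vcode t + (js.map fun j => (4352 - ecode (ls.getD j 0)) +
          ecode ((ls.getD j 0 + (t + (k - vs.getD i 0))) % k)).sum))

def Op.newV : Op → ℕ | .edge _ s q => s + q | .vert _ => 1 | .flip _ _ => 0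
def Op.newE : Op → ℕ | .edge _ _ _ => 1 | .vert _ => 0 | .flip _ _ => 0
-- Changing an existing label can lower a count. Adding 1 to both digits for every changed vertex or
-- edge keeps the encoded increments nonnegative, and `target` adds the same offsets.
def Op.offV : Op → ℕ | .edge _ _ _ => 0 | .vert _ => 0 | .flip _ _ => 1
def Op.offE : Op → ℕ | .edge _ _ _ => 0 | .vert _ => 1 | .flip _ js => js.length

def Op.maxV : Op → ℕ | .edge _ s q => s + q | .vert _ => 1 | .flip _ _ => 2
def Op.maxE : Op → ℕ | .edge _ _ _ => 1 | .vert _ => 2 | .flip _ js => 2 * js.length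

/-- Codes of the balanced distributions with remainder `r`, relative to the quotient: for remainder
1 the label in excess is 0, 1 or 2, for remainder 2 the missing label is 0, 1 or 2. -/
def vbal (k r : ℕ) : List ℕ :=
  if r = 0 then [0] else if k = 2 then [0, 1] else if r = 1 then [0, 1, 16] else [17, 16, 1]
-- The profiles of the induction hypothesis. For `r = 0` the codes 256 and 4096 mean one edge too
-- many with label 1 or 2 and one too few with label 0.
def allowed (k r : ℕ) : List ℕ :=
  if r = 0 then (if k = 2 then [0, 256] else [0, 256, 4096]) else vbal k r
-- The effect on codes of negating all labels modulo 3.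
def swap (c : ℕ) : ℕ := (c % 16) * 16 + (c / 16 % 16) + (c / 256 % 16) * 4096 + (c / 4096) * 256

def ext (k : ℕ) (ops : List Op) (nv : ℕ) (st : List ℕ) (tgt t₁ : ℕ) : Bool :=
  Nat.ble t₁ tgt && Nat.beq ((run k ops (st.take nv) (st.drop nv) >>> (tgt - t₁)) % 2) 1

def consistent (k nv : ℕ) (known : List (ℕ × List ℕ)) (st : List ℕ) : Bool :=
  known.all fun p => Nat.beq ((st.drop nv).getD p.1 0) ((p.2.map fun i => st.getD i 0).sum % k)

/-- `opsBounded` guarantees that no digit of the base-16 codes overflows. -/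
def opsBounded (k : ℕ) (ops : List Op) : Bool :=
  Nat.ble (ops.map Op.maxV).sum 14 && Nat.ble (ops.map Op.maxE).sum 14 &&
  Nat.ble ((ops.map Op.newV).sum / k + 1 + (ops.map Op.offV).sum) 14 &&
  Nat.ble ((ops.map Op.newE).sum / k + (ops.map Op.offE).sum) 14

/-- The code that an extension by `ops` has to reach, for vertex residues `r₀` (before), `r` (after). -/
def target (k : ℕ) (ops : List Op) (r₀ r : ℕ) : ℕ :=
  ((ops.map Op.newV).sum + r₀ - r) / k * (1 + 16 * (k - 2)) + (ops.map Op.offV).sum * 17 +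
    ((ops.map Op.newE).sum / k * (256 + 4096 * (k - 2)) + (ops.map Op.offE).sum * 4352)

def prevResidue (k : ℕ) (ops : List Op) (r : ℕ) : ℕ :=
  (r + k * (ops.map Op.newV).sum - (ops.map Op.newV).sum) % k

/-- Every admissible profile after the operations is reachable, for all labels of the listed vertices
and edges, from one admissible profile before them. -/
def check (k : ℕ) (ops : List Op) (nv ne : ℕ) (known : List (ℕ × List ℕ)) : Bool :=
  opsBounded k ops && Nat.beq ((ops.map Op.newE).sum % k) 0 && (List.range k).all fun r =>
    let r₀ := prevResidue k ops r
    (allowed k r).all fun t => (allowed k r₀).any fun t₁ =>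
      ((tuples k (nv + ne)).filter (consistent k nv known)).all fun st =>
        let tgt := t + target k ops r₀ r
        ext k ops nv st tgt t₁ ||
          (Nat.beq k 3 && ext k ops nv (st.map fun x => (k - x) % k) tgt (swap t₁))

/-- Like `check`, when only the balance of vertices and of edges is required after the operations. -/
def checkFinal (k : ℕ) (ops : List Op) (nv : ℕ) : Bool :=
  opsBounded k ops && (List.range k).all fun r =>
    let r₀ := prevResidue k ops r
    (allowed k r₀).any fun t₁ => (tuples k nv).all fun st =>
      (vbal k r).any fun t => (vbal k ((ops.map Op.newE).sum % k)).any fun b =>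
        ext k ops nv st (t + 256 * b + target k ops r₀ r) t₁

end HypertreeCordial

/-! ### Kernel evaluation of the reductions -/

namespace HypertreeCordial
open Op
-- In all these evaluations the parameters are numbers of unlisted children. Removal of blocks
-- bounds them by 3 for a leaf edge and by 2 for an edge with a child carrying further edges; modulo
-- 2 the bounds are 4 and 3.
theorem check_threeLeaves : ∀ d ∈ [1,2,3], ∀ e ∈ [1,2,3], ∀ f ∈ [1,2,3],
    check 3 [edge 0 0 d, edge 0 0 e, edge 0 0 f] 1 0 [] = true := by
  decide +kernel

theorem check_cherry : ∀ d ∈ [0,1,2], ∀ e ∈ [1,2,3], ∀ f ∈ [1,2,3],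
    check 3 [edge 0 1 d, edge 1 0 e, edge 1 0 f] 1 0 [] = true := by
  decide +kernel

theorem check_twoSingles : ∀ d ∈ [0,1,2], ∀ e ∈ [1,2,3], ∀ f ∈ [1,2,3],
    check 3 [edge 0 2 d, edge 1 0 e, edge 2 0 f] 1 0 [] = true := by
  decide +kernel

theorem check_threeSingles : ∀ d ∈ [1,2,3], ∀ e ∈ [1,2,3], ∀ f ∈ [1,2,3],
    check 3 [vert 0, vert 0, flip 0 [0], edge 0 0 d, edge 1 0 e, edge 2 0 f] 1 1 [] = true := by
  decide +kernel

theorem check_doubleSingle : ∀ d ∈ [1,2,3], ∀ e ∈ [1,2,3], ∀ f ∈ [1,2,3], (d = 1 → e = 1 → f ≠ 1) →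
    check 3 [vert 0, flip 0 [0], edge 0 0 d, edge 0 0 e, edge 1 0 f] 1 1 [] = true := by
  decide +kernel

theorem check_detachDoubleSingle :
    check 3 [vert 0, vert 0, edge 0 0 1, edge 0 0 1, edge 1 0 1] 0 1 [] = true := by
  decide +kernel

theorem check_detachDouble : ∀ d ∈ [1,2,3], ∀ e ∈ [1,2,3], ∀ f ∈ [1,2,3], (d = 1 → e ≠ 1) →
    check 3 [vert 0, edge 1 0 d, edge 1 0 e, edge 0 0 f] 1 1 [] = true := by
  decide +kernel

theorem check_detachTwoDoubles :
    check 3 [vert 0, vert 0, edge 1 0 1, edge 1 0 1, edge 2 0 1, edge 2 0 1, edge 0 0 1,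
      edge 0 0 1] 1 1 [] = true := by
  decide +kernel

theorem check_twoDoublesLeaf : ∀ q ∈ [0,1,2], ∀ d ∈ [1,2,3],
    check 3 [edge 0 2 q, edge 2 0 1, edge 2 0 1, edge 3 0 1, edge 3 0 1,
      edge 1 0 d] 2 0 [] = true := by
  decide +kernel

theorem check_twoDoublesChain : ∀ q ∈ [0,1,2], ∀ d ∈ [0,1,2],
    check 3 [edge 0 1 d, edge 1 2 q, edge 2 0 1, edge 2 0 1, edge 3 0 1,
      edge 3 0 1] 1 0 [] = true := by
  decide +kernel

theorem check_mixedTwoLeaves : ∀ q ∈ [1,2,3], ∀ d ∈ [1,2,3],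
    check 3 [edge 0 2 0, edge 3 0 1, edge 3 0 1, edge 4 0 1, edge 1 0 q,
      edge 2 0 d] 3 0 [] = true := by
  decide +kernel

/-- The last argument records that edge register 1 consists of exactly the vertex registers 0 and 1,
so its label is determined by theirs. -/
theorem check_mixedSole :
    check 3 [vert 1, flip 0 [0,1], flip 1 [1], edge 1 0 1, edge 1 0 1,
      edge 2 0 1] 2 2 [(1,[0,1])] = true := by
  decide +kernel

theorem check_mixedPair : ∀ q ∈ [0,1,2], ∀ d ∈ [1,2,3],
    check 3 [edge 0 2 0, edge 1 0 1, edge 1 0 1, edge 2 0 1, edge 0 1 q,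
      edge 3 0 d] 1 0 [] = true := by
  decide +kernel

theorem check_mixedChain : ∀ q ∈ [0,1,2], ∀ d ∈ [1,2,3],
    check 3 [edge 0 1 q, edge 1 2 0, edge 2 0 1, edge 2 0 1, edge 3 0 1,
      edge 1 0 d] 1 0 [] = true := by
  decide +kernel

/-- The excluded sizes are `d = 0` with `e`, `f` equal to 1 and 2 in some order. They are the reason
for the additional pair configurations below. -/
theorem check_pairLeaf : ∀ d ∈ [0,1,2], ∀ e ∈ [1,2,3], ∀ f ∈ [1,2,3], (d = 0 → e ≠ f → e = 3 ∨ f = 3) →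
    check 3 [edge 0 1 d, edge 2 0 e, edge 1 0 f] 2 0 [] = true := by
  decide +kernel

theorem check_pairLeafAtRoot : ∀ e ∈ [1,2,3], ∀ f ∈ [1,2,3],
    check 3 [edge 0 1 0, edge 1 0 e, edge 0 0 f] 1 0 [] = true := by
  decide +kernel

theorem check_pairPair : ∀ e ∈ [1,2,3], ∀ f ∈ [1,2,3],
    check 3 [flip 1 [0], edge 0 1 0, edge 2 0 e, edge 1 0 f] 2 1 [(0,[0,1])] = true := by
  decide +kernel

theorem check_detachPair : ∀ e ∈ [1,2,3], ∀ f ∈ [1,2,3], e ≠ f →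
    check 3 [vert 0, edge 1 1 0, edge 2 0 e, edge 0 0 f] 1 1 [] = true := by
  decide +kernel

theorem check_pairChain : ∀ q ∈ [0,1,2], ∀ d ∈ [0,1,2], ∀ e ∈ [1,2,3],
    check 3 [edge 0 1 q, edge 1 1 d, edge 2 0 e] 1 0 [] = true := by
  decide +kernel

theorem check_finalLeaf : ∀ d ∈ [1,2,3],
    checkFinal 3 [edge 0 0 d] 1 = true := by
  decide +kernel

theorem check_finalTwoLeaves : ∀ d ∈ [1,2,3], ∀ e ∈ [1,2,3],
    checkFinal 3 [edge 0 0 d, edge 1 0 e] 2 = true := by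
  decide +kernel

theorem check_finalPair : ∀ d ∈ [0,1,2], ∀ e ∈ [1,2,3],
    checkFinal 3 [edge 0 1 d, edge 1 0 e] 1 = true := by
  decide +kernel

theorem check_two_twoLeaves : ∀ d ∈ [1,2,3,4], ∀ e ∈ [1,2,3,4],
    check 2 [edge 0 0 d, edge 0 0 e] 1 0 [] = true := by
  decide +kernel

theorem check_two_pair : ∀ d ∈ [0,1,2,3], ∀ e ∈ [1,2,3,4],
    check 2 [edge 0 1 d, edge 1 0 e] 1 0 [] = true := by
  decide +kernel

theorem check_two_detachSingles : ∀ d ∈ [1,2,3,4], ∀ e ∈ [1,2,3,4],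
    check 2 [vert 0, vert 0, edge 0 0 d, edge 1 0 e] 0 1 [] = true := by
  decide +kernel

theorem check_two_twoSinglesLeaf : ∀ d ∈ [1,2,3,4], ∀ e ∈ [1,2,3,4], ∀ f ∈ [1,2,3,4],
    check 2 [edge 0 2 0, edge 2 0 d, edge 3 0 e, edge 1 0 f] 2 0 [] = true := by
  decide +kernel

theorem check_two_twoSinglesChain : ∀ d ∈ [1,2,3,4], ∀ e ∈ [1,2,3,4], ∀ f ∈ [0,1,2,3],
    check 2 [edge 0 1 f, edge 1 2 0, edge 2 0 d, edge 3 0 e] 1 0 [] = true := by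
  decide +kernel

theorem check_two_finalLeaf : ∀ d ∈ [1,2,3,4],
    checkFinal 2 [edge 0 0 d] 1 = true := by
  decide +kernel

end HypertreeCordial

/-! ### Rooted hypertrees, their subtrees, and the effect of adding a leaf edge -/

namespace HypertreeCordial

set_option linter.unusedSectionVars false

/-- A rooted hypertree: `par e` is the vertex of the edge `e` closest to the root, and `up v` is the
edge joining `v` to its parent. -/
structure Rooting (V E : Type*) where
  root : V
  par : E → V
  up : V → Option E
  depth : E → ℕ
  up_eq_none : ∀ v, up v = none ↔ v = root
  depth_root : ∀ e, up (par e) = none → depth e = 0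
  depth_eq : ∀ e e', up (par e) = some e' → depth e = depth e' + 1

-- The rooting stays fixed throughout the induction; only the sets of present vertices and edges
-- vary.
@[ext] structure State (V E : Type*) where
  W : Finset V
  X : Finset E

variable {V E : Type*} [DecidableEq V] [DecidableEq E] (T : Rooting V E)

def ch (S : State V E) (e : E) : Finset V := S.W.filter fun v => T.up v = some e

def lab (k : ℕ) (S : State V E) (f : V → ℕ) (e : E) : ℕ := (f (T.par e) + ∑ v ∈ ch T S e, f v) % k

def ind (i x : ℕ) : ℕ := if x = i then 1 else 0

def cntV (i : ℕ) (S : State V E) (f : V → ℕ) : ℕ := ∑ v ∈ S.W, ind i (f v)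

def cntE (k i : ℕ) (S : State V E) (f : V → ℕ) : ℕ := ∑ e ∈ S.X, ind i (lab T k S f e)

/-- The present part is a subtree containing the root. The last field replaces the condition that
edges have at least two vertices. -/
structure Closed (S : State V E) : Prop where
  root_mem : T.root ∈ S.W
  par_mem : ∀ e ∈ S.X, T.par e ∈ S.W
  up_mem : ∀ v ∈ S.W, ∀ e, T.up v = some e → e ∈ S.X
  ch_nonempty : ∀ e ∈ S.X, (ch T S e).Nonempty

def Leaf (S : State V E) (z : E) : Prop := z ∈ S.X ∧ ∀ e ∈ S.X, T.up (T.par e) ≠ some z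

def removeLeaf (S : State V E) (z : E) : State V E := ⟨S.W \ ch T S z, S.X.erase z⟩

def removeVertex (S : State V E) (v : V) : State V E := ⟨S.W.erase v, S.X⟩

def Private (S : State V E) (v : V) : Prop := v ∈ S.W ∧ ∀ e ∈ S.X, T.par e ≠ v

variable {T} {S S₀ S₁ : State V E}

theorem mem_ch {e : E} {v : V} : v ∈ ch T S e ↔ v ∈ S.W ∧ T.up v = some e := by simp [ch]

theorem ch_subset (e : E) : ch T S e ⊆ S.W := Finset.filter_subset _ _

theorem ch_removeLeaf {z e : E} (h : e ≠ z) : ch T (removeLeaf T S z) e = ch T S e := by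
  ext v
  simp only [mem_ch, removeLeaf, Finset.mem_sdiff]
  constructor
  · rintro ⟨⟨h1, h2⟩, h3⟩; exact ⟨h1, h3⟩
  · rintro ⟨h1, h3⟩
    refine ⟨⟨h1, fun h2 => h ?_⟩, h3⟩
    rw [h2.2] at h3; exact (Option.some.inj h3).symm

theorem Leaf.par_notMem {z e : E} (h : Leaf T S z) (he : e ∈ S.X) : T.par e ∉ ch T S z :=
  fun hm => h.2 e he (mem_ch.1 hm).2

theorem Closed.removeLeaf {z : E} (hS : Closed T S) (hz : Leaf T S z) :
    Closed T (removeLeaf T S z) := by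
  refine ⟨?_, ?_, ?_, ?_⟩
  · simp only [HypertreeCordial.removeLeaf, Finset.mem_sdiff]
    refine ⟨hS.root_mem, fun h => ?_⟩
    have := (mem_ch.1 h).2
    rw [(T.up_eq_none T.root).2 rfl] at this
    cases this
  · intro e he
    have he' := Finset.mem_of_mem_erase he
    exact Finset.mem_sdiff.2 ⟨hS.par_mem e he', hz.par_notMem he'⟩
  · intro v hv e he
    obtain ⟨h1, h2⟩ := Finset.mem_sdiff.1 hv
    refine Finset.mem_erase.2 ⟨?_, hS.up_mem v h1 e he⟩
    rintro rfl
    exact h2 (mem_ch.2 ⟨h1, he⟩)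
  · intro e he
    rw [ch_removeLeaf (Finset.ne_of_mem_erase he)]
    exact hS.ch_nonempty e (Finset.mem_of_mem_erase he)

theorem ch_removeVertex {v : V} {e : E} : ch T (removeVertex S v) e = (ch T S e).erase v := by
  ext w; simp only [mem_ch, removeVertex, Finset.mem_erase]; tauto

theorem Closed.removeVertex {v w : V} {e : E} (hS : Closed T S) (hv : Private T S v)
    (he : T.up v = some e) (hw : w ∈ ch T S e) (hne : w ≠ v) : Closed T (removeVertex S v) := by
  refine ⟨?_, ?_, ?_, ?_⟩
  · refine Finset.mem_erase.2 ⟨?_, hS.root_mem⟩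
    rintro rfl
    rw [(T.up_eq_none T.root).2 rfl] at he
    cases he
  · intro e' he'
    exact Finset.mem_erase.2 ⟨hv.2 e' he', hS.par_mem e' he'⟩
  · intro u hu
    exact hS.up_mem u (Finset.mem_of_mem_erase hu)
  · intro e' he'
    rw [ch_removeVertex]
    by_cases h : e' = e
    · subst h; exact ⟨w, Finset.mem_erase.2 ⟨hne, hw⟩⟩
    · obtain ⟨u, hu⟩ := hS.ch_nonempty e' he'
      refine ⟨u, Finset.mem_erase.2 ⟨?_, hu⟩⟩
      rintro rfl
      rw [(mem_ch.1 hu).2] at he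
      exact h (Option.some.inj he)

variable (T) in
/-- `Built T S₀ vs es ops S`: the state `S` arises from `S₀` by the operations `ops`, where the
registers initially refer to the vertices `vs` and the edges `es`. -/
inductive Built : State V E → List V → List E → List Op → State V E → Prop
  | nil (S vs es) : Built S vs es [] S
  | edge {S₁ S : State V E} {vs ws : List V} {es : List E} {ops : List Op} {i q : ℕ} {z : E}
      (h : Built S₁ (vs ++ ws) es ops S) (hz : Leaf T S₁ z) (hi : vs[i]? = some (T.par z))
      (hnd : ws.Nodup) (hws : ∀ w ∈ ws, w ∈ ch T S₁ z) (hq : (ch T S₁ z).card = ws.length + q) :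
      Built (removeLeaf T S₁ z) vs es (.edge i ws.length q :: ops) S
  | vert {S₁ S : State V E} {vs : List V} {es : List E} {ops : List Op} {j : ℕ} {v w : V} {e : E}
      (h : Built S₁ (vs ++ [v]) es ops S) (hv : Private T S₁ v) (he : T.up v = some e)
      (hw : w ∈ ch T S₁ e) (hne : w ≠ v) (hj : es[j]? = some e) :
      Built (removeVertex S₁ v) vs es (.vert j :: ops) S
  | flip {S₁ S : State V E} {vs : List V} {es : List E} {ops : List Op} {i : ℕ} {js : List ℕ}
      {v : V} (h : Built S₁ vs es ops S) (hvn : vs.Nodup) (hi : vs[i]? = some v) (hjs : js.Nodup)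
      (hes : ∀ j ∈ js, j < es.length)
      (hv : ∀ e ∈ S₁.X, (T.par e = v ∨ T.up v = some e) ↔ ∃ j ∈ js, es[j]? = some e) :
      Built S₁ vs es (.flip i js :: ops) S

theorem Built.closed {vs es ops} (h : Built T S₀ vs es ops S) (hS : Closed T S) : Closed T S₀ := by
  induction h with
  | nil => exact hS
  | edge h hz _ _ _ _ ih => exact (ih hS).removeLeaf hz
  | vert h hv he hw hne _ ih => exact (ih hS).removeVertex hv he hw hne
  | flip h _ _ _ _ _ ih => exact ih hS

theorem Built.card {vs es ops} (h : Built T S₀ vs es ops S) :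
    S.W.card = S₀.W.card + (ops.map Op.newV).sum ∧ S.X.card = S₀.X.card + (ops.map Op.newE).sum := by
  induction h with
  | nil => simp
  | @edge S₁ S vs ws es ops i q z h hz hi hnd hws hq ih =>
    have h1 := Finset.card_sdiff_add_card_eq_card (ch_subset (T := T) (S := S₁) z)
    have h2 := Finset.card_erase_add_one hz.1
    simp only [removeLeaf, List.map_cons, List.sum_cons, Op.newV, Op.newE]
    omega
  | vert h hv he hw hne _ ih =>
    have h2 := Finset.card_erase_add_one hv.1
    simp only [removeVertex, List.map_cons, List.sum_cons, Op.newV, Op.newE]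
    omega
  | flip h _ _ _ _ _ ih => simpa [Op.newV, Op.newE] using ih

/-- The labelling `f` of `S` extends or modifies `f₀` on `S₀` with count increments encoded by `c`,
up to the offsets `oV`, `oE`; no digit exceeds `xV`, `xE`. -/
def Shift (T : Rooting V E) (k oV oE xV xE : ℕ) (S₀ : State V E) (f₀ : V → ℕ) (S : State V E)
    (f : V → ℕ) (c : ℕ) : Prop :=
  ∃ n₁ n₂ m₁ m₂, c = n₁ + 16 * n₂ + 256 * m₁ + 4096 * m₂ ∧ n₁ ≤ xV ∧ n₂ ≤ xV ∧ m₁ ≤ xE ∧ m₂ ≤ xE ∧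
    cntV 1 S f + oV = cntV 1 S₀ f₀ + n₁ ∧ cntV 2 S f + oV = cntV 2 S₀ f₀ + n₂ ∧
    cntE T k 1 S f + oE = cntE T k 1 S₀ f₀ + m₁ ∧ cntE T k 2 S f + oE = cntE T k 2 S₀ f₀ + m₂

theorem Shift.trans {k oV oE xV xE oV' oE' xV' xE' c c' : ℕ} {f₀ f₁ f : V → ℕ}
    (h : Shift T k oV oE xV xE S₀ f₀ S₁ f₁ c) (h' : Shift T k oV' oE' xV' xE' S₁ f₁ S f c') :
    Shift T k (oV + oV') (oE + oE') (xV + xV') (xE + xE') S₀ f₀ S f (c' + c) := by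
  obtain ⟨n₁, n₂, m₁, m₂, hc, h1, h2, h3, h4, h5, h6, h7, h8⟩ := h
  obtain ⟨n₁', n₂', m₁', m₂', hc', h1', h2', h3', h4', h5', h6', h7', h8'⟩ := h'
  exact ⟨n₁ + n₁', n₂ + n₂', m₁ + m₁', m₂ + m₂', by omega, by omega, by omega, by omega, by omega,
    by omega, by omega, by omega, by omega⟩

theorem vcode_eq (x : ℕ) : vcode x = ind 1 x + 16 * ind 2 x := by
  unfold vcode ind; split_ifs <;> omega

theorem ecode_eq (x : ℕ) : ecode x = 256 * ind 1 x + 4096 * ind 2 x := by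
  unfold ecode ind; split_ifs <;> omega

theorem ind_le (i x : ℕ) : ind i x ≤ 1 := by unfold ind; split_ifs <;> omega

theorem ind_add_le (x : ℕ) : ind 1 x + ind 2 x ≤ 1 := by unfold ind; split_ifs <;> omega

theorem lab_congr {k : ℕ} {f g : V → ℕ} {e : E} (hS : Closed T S) (he : e ∈ S.X)
    (h : ∀ v ∈ S.W, f v = g v) : lab T k S f e = lab T k S g e := by
  unfold lab
  rw [h _ (hS.par_mem e he), Finset.sum_congr rfl fun v hv => h v (ch_subset e hv)]

theorem lab_lt {k : ℕ} (hk : 0 < k) (S : State V E) (f : V → ℕ) (e : E) : lab T k S f e < k :=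
  Nat.mod_lt _ hk

/-- Labels for the children of a new leaf edge, with prescribed labels on `ws`. -/
theorem exists_labels {k q a b : ℕ} (hk : 2 ≤ k) {C : Finset V} {ws : List V} (hnd : ws.Nodup)
    (hws : ∀ w ∈ ws, w ∈ C) (hq : C.card = ws.length + q) {ts : List ℕ}
    (hlen : ts.length = ws.length) (hts : ∀ t ∈ ts, t < k) (hab : a + b ≤ q) (hb : b = 0 ∨ k = 3)
    {f₀ : V → ℕ} (hf₀ : ∀ v, f₀ v < k) :
    ∃ f : V → ℕ, (∀ v, f v < k) ∧ (∀ v ∉ C, f v = f₀ v) ∧ ws.map f = ts ∧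
      ∑ v ∈ C, ind 1 (f v) = (ts.map (ind 1)).sum + a ∧
      ∑ v ∈ C, ind 2 (f v) = (ts.map (ind 2)).sum + b ∧
      ∑ v ∈ C, f v = ts.sum + a + 2 * b := by
  have hsub : ws.toFinset ⊆ C := fun w hw => hws w (List.mem_toFinset.1 hw)
  have hcard : (C \ ws.toFinset).card = q := by
    have := Finset.card_sdiff_add_card_eq_card hsub
    rw [List.toFinset_card_of_nodup hnd] at this
    omega
  obtain ⟨A, hA, hAc⟩ := Finset.exists_subset_card_eq (s := C \ ws.toFinset) (n := a) (by omega)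
  obtain ⟨B, hB, hBc⟩ := Finset.exists_subset_card_eq (s := (C \ ws.toFinset) \ A) (n := b) (by
    have := Finset.card_sdiff_add_card_eq_card hA
    omega)
  let f : V → ℕ := fun v => if v ∈ ws then ts.getD (ws.idxOf v) 0 else if v ∈ A then 1 else
    if v ∈ B then 2 else if v ∈ C then 0 else f₀ v
  have hmap : ws.map f = ts := by
    apply List.ext_getElem
    · simp [hlen]
    · intro n h1 h2
      have h3 : n < ws.length := by omega
      simp [f, List.getElem_mem, hnd.idxOf_getElem n h3, h2]
  -- One computation gives all three sums, with `g` equal to `ind 1`, `ind 2` and `id`. Since `g 0 =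
  -- 0`, the children outside `ws`, `A` and `B` contribute nothing.
  have key : ∀ g : ℕ → ℕ, g 0 = 0 → ∑ v ∈ C, g (f v) = (ts.map g).sum + (a * g 1 + b * g 2) := by
    intro g hg
    rw [← Finset.sum_sdiff hsub, add_comm]
    congr 1
    · rw [List.sum_toFinset _ hnd, ← hmap, List.map_map]; rfl
    · rw [← Finset.sum_sdiff hA, ← Finset.sum_sdiff hB, add_comm]
      congr 1
      · rw [← hAc, ← smul_eq_mul, ← Finset.sum_const]
        refine Finset.sum_congr rfl fun v hv => ?_
        have h1 := Finset.mem_sdiff.1 (hA hv)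
        have h2 : v ∉ ws := by simpa using h1.2
        simp [f, h2, hv]
      · rw [Finset.sum_eq_zero, zero_add]
        · rw [← hBc, ← smul_eq_mul, ← Finset.sum_const]
          refine Finset.sum_congr rfl fun v hv => ?_
          have h0 := Finset.mem_sdiff.1 (hB hv)
          have h1 := Finset.mem_sdiff.1 h0.1
          have h2 : v ∉ ws := by simpa using h1.2
          simp [f, h2, hv, h0.2]
        · intro v hv
          simp only [Finset.mem_sdiff, List.mem_toFinset] at hv
          obtain ⟨⟨⟨hC, hw⟩, hvA⟩, hvB⟩ := hv
          simp [f, hC, hw, hvA, hvB, hg]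
  refine ⟨f, ?_, ?_, hmap, ?_, ?_, ?_⟩
  · intro v
    simp only [f]
    split_ifs with h1 h2 h3 h4
    · have : ws.idxOf v < ts.length := by rw [hlen]; exact List.idxOf_lt_length_iff.2 h1
      rw [List.getD_eq_getElem _ _ this]
      exact hts _ (List.getElem_mem _)
    · omega
    · rcases hb with hb | hb
      · subst hb; rw [Finset.card_eq_zero] at hBc; subst hBc; simp at h3
      · omega
    · omega
    · exact hf₀ v
  · intro v hv
    have h1 : v ∉ ws := fun h => hv (hws v h)
    have h2 : v ∉ A := fun h => hv (Finset.mem_sdiff.1 (hA h)).1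
    have h3 : v ∉ B := fun h => hv (Finset.mem_sdiff.1 (Finset.mem_sdiff.1 (hB h)).1).1
    simp [f, h1, h2, h3, hv]
  · rw [key (ind 1) rfl]; simp [ind]
  · rw [key (ind 2) rfl]; simp [ind]
  · have := key id rfl
    simp only [id, List.map_id_fun] at this
    rw [this]; omega

/-- No child of a leaf edge lies on another present edge, so the old edges keep their labels and
exactly one new edge label is counted. -/
theorem shift_edge {k q a b : ℕ} (hk : 2 ≤ k) (hS : Closed T S₁) {z : E} (hz : Leaf T S₁ z)
    {ws : List V} (hnd : ws.Nodup)
    (hws : ∀ w ∈ ws, w ∈ ch T S₁ z) (hq : (ch T S₁ z).card = ws.length + q) {ts : List ℕ}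
    (hlen : ts.length = ws.length) (hts : ∀ t ∈ ts, t < k) (hab : a + b ≤ q) (hb : b = 0 ∨ k = 3)
    {f₀ : V → ℕ} (hf₀ : ∀ v, f₀ v < k) :
    ∃ f : V → ℕ, (∀ v, f v < k) ∧ (∀ v ∉ ch T S₁ z, f v = f₀ v) ∧ ws.map f = ts ∧
      (∀ e ∈ S₁.X, e ≠ z → lab T k S₁ f e = lab T k (removeLeaf T S₁ z) f₀ e) ∧
      Shift T k 0 0 (ws.length + q) 1 (removeLeaf T S₁ z) f₀ S₁ f
        ((ts.map vcode).sum + a + 16 * b + ecode ((f₀ (T.par z) + ts.sum + a + 2 * b) % k)) := by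
  obtain ⟨f, hf, hff, hmap, h1, h2, h3⟩ := exists_labels hk hnd hws hq hlen hts hab hb hf₀
  have hlab : ∀ e ∈ S₁.X, e ≠ z → lab T k S₁ f e = lab T k (removeLeaf T S₁ z) f₀ e := by
    intro e he hne
    have h : e ∈ (removeLeaf T S₁ z).X := Finset.mem_erase.2 ⟨hne, he⟩
    rw [← lab_congr (hS.removeLeaf hz) h (f := f) fun v hv => hff v (Finset.mem_sdiff.1 hv).2]
    simp only [lab, ch_removeLeaf hne]
  have hzl : lab T k S₁ f z = (f₀ (T.par z) + ts.sum + a + 2 * b) % k := by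
    rw [lab, h3, hff _ (hz.par_notMem hz.1)]
    congr 1; ring
  have hV : ∀ i, cntV i S₁ f = cntV i (removeLeaf T S₁ z) f₀ + ∑ v ∈ ch T S₁ z, ind i (f v) := by
    intro i
    rw [cntV, ← Finset.sum_sdiff (ch_subset z), cntV]
    congr 1
    refine Finset.sum_congr rfl fun v hv => ?_
    rw [hff v (Finset.mem_sdiff.1 hv).2]
  have hE : ∀ i, cntE T k i S₁ f = cntE T k i (removeLeaf T S₁ z) f₀ +
      ind i ((f₀ (T.par z) + ts.sum + a + 2 * b) % k) := by
    intro i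
    rw [cntE, ← Finset.sum_erase_add _ _ hz.1, hzl, cntE]
    congr 1
    refine Finset.sum_congr rfl fun e he => ?_
    rw [hlab e (Finset.mem_of_mem_erase he) (Finset.ne_of_mem_erase he)]
  have hle : ∀ i, (ts.map (ind i)).sum ≤ ts.length := by
    intro i
    have := List.sum_le_card_nsmul (ts.map (ind i)) 1 (by
      intro x hx
      obtain ⟨y, _, rfl⟩ := List.mem_map.1 hx
      exact ind_le i y)
    simpa using this
  have hvc : (ts.map vcode).sum = (ts.map (ind 1)).sum + 16 * (ts.map (ind 2)).sum := by
    clear hlen hts hmap h1 h2 h3 hzl hE hle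
    induction ts with
    | nil => rfl
    | cons t ts ih => simp only [List.map_cons, List.sum_cons, ih, vcode_eq]; ring
  refine ⟨f, hf, hff, hmap, hlab, (ts.map (ind 1)).sum + a, (ts.map (ind 2)).sum + b,
    ind 1 ((f₀ (T.par z) + ts.sum + a + 2 * b) % k), ind 2 ((f₀ (T.par z) + ts.sum + a + 2 * b) % k),
    ?_, ?_, ?_, ind_le _ _, ind_le _ _, ?_, ?_, ?_, ?_⟩
  · rw [hvc, ecode_eq]; ring
  · have := hle 1; omega
  · have := hle 2; omega
  · rw [hV, h1, add_zero]
  · rw [hV, h2, add_zero]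
  · rw [hE, add_zero]
  · rw [hE, add_zero]

end HypertreeCordial

/-! ### Effect of relabelling a vertex and of adding a private vertex -/

namespace HypertreeCordial

set_option linter.unusedSectionVars false

variable {V E : Type*} [DecidableEq V] [DecidableEq E] {T : Rooting V E} {S S₀ S₁ : State V E}

theorem Rooting.up_par_ne (T : Rooting V E) (e : E) : T.up (T.par e) ≠ some e := fun h => by
  have := T.depth_eq e e h
  omega

theorem lab_update {k t : ℕ} {v : V} {f : V → ℕ} (hf : f v < k) {e : E} (hv : v ∈ S.W) :
    lab T k S (Function.update f v t) e =
      if T.par e = v ∨ T.up v = some e then (lab T k S f e + (t + (k - f v))) % k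
      else lab T k S f e := by
  -- The difference of new and old label is written as `t + (k - f v)`, which avoids truncation
  -- because `f v < k`.
  have hmod : ∀ a : ℕ, (t + a) % k = ((f v + a) % k + (t + (k - f v))) % k := by
    intro a
    rw [Nat.mod_add_mod, show f v + a + (t + (k - f v)) = t + a + k by omega, Nat.add_mod_right]
  by_cases h1 : T.par e = v
  · rw [if_pos (Or.inl h1), lab, lab, h1, Function.update_self, ← hmod]
    congr 2
    refine Finset.sum_congr rfl fun w hw => Function.update_of_ne ?_ _ _
    rintro rfl
    exact T.up_par_ne e (h1 ▸ (mem_ch.1 hw).2)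
  · by_cases h2 : T.up v = some e
    · rw [if_pos (Or.inr h2), lab, lab, Function.update_of_ne h1]
      have hm : v ∈ ch T S e := mem_ch.2 ⟨hv, h2⟩
      rw [← Finset.sum_erase_add _ _ hm, ← Finset.sum_erase_add _ f hm, Function.update_self,
        Finset.sum_congr rfl fun w hw => Function.update_of_ne (Finset.ne_of_mem_erase hw) _ _]
      rw [show ∀ a b : ℕ, a + (b + t) = t + (a + b) by intros; omega, hmod]
      congr 3; omega
    · rw [if_neg (by tauto), lab, lab, Function.update_of_ne h1]
      congr 2
      refine Finset.sum_congr rfl fun w hw => Function.update_of_ne ?_ _ _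
      rintro rfl
      exact h2 (mem_ch.1 hw).2

theorem cntV_update {i t : ℕ} {v : V} {f : V → ℕ} (hv : v ∈ S.W) :
    cntV i S (Function.update f v t) + ind i (f v) = cntV i S f + ind i t := by
  unfold cntV
  rw [← Finset.sum_erase_add _ _ hv, ← Finset.sum_erase_add _ (fun w => ind i (f w)) hv,
    Function.update_self, Finset.sum_congr rfl fun w hw => by
      rw [Function.update_of_ne (Finset.ne_of_mem_erase hw)]]
  omega

/-- Only the edges through `v` change. Each of them gets the offset 1, so that losing its old label
and gaining the new one is a natural number. -/
theorem cntE_update {k i t : ℕ} {v : V} {f : V → ℕ} (hf : f v < k) (hv : v ∈ S.W) {L : List E}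
    (hL : L.Nodup) (hLX : ∀ e ∈ L, e ∈ S.X)
    (h : ∀ e ∈ S.X, (T.par e = v ∨ T.up v = some e) ↔ e ∈ L) :
    cntE T k i S (Function.update f v t) + L.length = cntE T k i S f +
      (L.map fun e => (1 - ind i (lab T k S f e)) +
        ind i ((lab T k S f e + (t + (k - f v))) % k)).sum := by
  have hsub : L.toFinset ⊆ S.X := fun e he => hLX e (List.mem_toFinset.1 he)
  unfold cntE
  rw [← Finset.sum_sdiff hsub, ← Finset.sum_sdiff (f := fun e => ind i (lab T k S f e)) hsub,
    ← List.sum_toFinset _ hL, ← List.toFinset_card_of_nodup hL, Finset.card_eq_sum_ones, add_assoc,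
    add_assoc, ← Finset.sum_add_distrib, ← Finset.sum_add_distrib]
  congr 1
  · refine Finset.sum_congr rfl fun e he => ?_
    rw [Finset.mem_sdiff, List.mem_toFinset] at he
    rw [lab_update hf hv, if_neg (fun hh => he.2 ((h e he.1).1 hh))]
  · refine Finset.sum_congr rfl fun e he => ?_
    rw [List.mem_toFinset] at he
    rw [lab_update hf hv, if_pos ((h e (hLX e he)).2 he)]
    have := ind_le i (lab T k S f e)
    omega

/-- Here 4352 is 256 + 4096, and a label has at most one of the two edge digits, so the subtraction
acts digit by digit without borrowing. -/
theorem sum_ecode_sub (L : List E) (a b : E → ℕ) :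
    (L.map fun e => (4352 - ecode (a e)) + ecode (b e)).sum =
      256 * (L.map fun e => (1 - ind 1 (a e)) + ind 1 (b e)).sum +
        4096 * (L.map fun e => (1 - ind 2 (a e)) + ind 2 (b e)).sum := by
  induction L with
  | nil => rfl
  | cons e L ih =>
    rw [List.map_cons, List.sum_cons, ih]
    simp only [List.map_cons, List.sum_cons, ecode_eq]
    have := ind_add_le (a e)
    omega

theorem sum_ind_le (L : List E) (i : ℕ) (a b : E → ℕ) :
    (L.map fun e => (1 - ind i (a e)) + ind i (b e)).sum ≤ 2 * L.length := by
  induction L with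
  | nil => simp
  | cons e L ih =>
    simp only [List.map_cons, List.sum_cons, List.length_cons]
    have := ind_le i (b e)
    omega

theorem shift_flip {k t : ℕ} {v : V} {f : V → ℕ} (hf : f v < k) (hv : v ∈ S.W) {L : List E}
    (hL : L.Nodup) (hLX : ∀ e ∈ L, e ∈ S.X)
    (h : ∀ e ∈ S.X, (T.par e = v ∨ T.up v = some e) ↔ e ∈ L) :
    Shift T k 1 L.length 2 (2 * L.length) S f S (Function.update f v t)
      ((17 - vcode (f v)) + vcode t + (L.map fun e => (4352 - ecode (lab T k S f e)) +
        ecode ((lab T k S f e + (t + (k - f v))) % k)).sum) := by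
  have h1 := cntV_update (i := 1) (t := t) (f := f) hv
  have h2 := cntV_update (i := 2) (t := t) (f := f) hv
  have h3 := ind_le 1 (f v)
  have h4 := ind_le 2 (f v)
  have h5 := ind_le 1 t
  have h6 := ind_le 2 t
  refine ⟨1 - ind 1 (f v) + ind 1 t, 1 - ind 2 (f v) + ind 2 t, _, _, ?_, by omega, by omega,
    sum_ind_le L 1 _ _, sum_ind_le L 2 _ _, by omega, by omega,
    cntE_update hf hv hL hLX h, cntE_update hf hv hL hLX h⟩
  rw [sum_ecode_sub, vcode_eq, vcode_eq]
  have := ind_add_le (f v)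
  omega

/-- With label 0 a private vertex contributes nothing to its edge. Adding a vertex thereby reduces,
for edge labels, to relabelling one from 0. -/
theorem lab_removeVertex {k : ℕ} {v : V} {f : V → ℕ} {e : E} (h : T.par e ≠ v) :
    lab T k S (Function.update f v 0) e = lab T k (removeVertex S v) f e := by
  rw [lab, lab, Function.update_of_ne h, ch_removeVertex]
  congr 2
  by_cases hv : v ∈ ch T S e
  · rw [← Finset.sum_erase_add _ _ hv, Function.update_self, add_zero]
    exact Finset.sum_congr rfl fun w hw => Function.update_of_ne (Finset.ne_of_mem_erase hw) _ _
  · rw [Finset.erase_eq_of_notMem hv]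
    refine Finset.sum_congr rfl fun w hw => Function.update_of_ne ?_ _ _
    rintro rfl; exact hv hw

theorem shift_vert {k t : ℕ} (hk : 0 < k) {v : V} {e : E} {f : V → ℕ} (hS : Closed T S)
    (hv : Private T S v) (he : T.up v = some e) :
    Shift T k 0 1 1 2 (removeVertex S v) f S (Function.update f v t)
      (vcode t + (4352 - ecode (lab T k (removeVertex S v) f e)) +
        ecode ((lab T k (removeVertex S v) f e + t) % k)) := by
  have heX := hS.up_mem v hv.1 e he
  have hE0 : ∀ i, cntE T k i (removeVertex S v) f = cntE T k i S (Function.update f v 0) := fun i =>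
    Finset.sum_congr rfl fun e he => by rw [lab_removeVertex (hv.2 e he)]
  have hE : ∀ i, cntE T k i S (Function.update f v t) + 1 = cntE T k i (removeVertex S v) f +
      ((1 - ind i (lab T k (removeVertex S v) f e)) +
        ind i ((lab T k (removeVertex S v) f e + t) % k)) := by
    intro i
    have := cntE_update (T := T) (k := k) (i := i) (t := t) (f := Function.update f v 0) (L := [e])
      (by simpa using hk) hv.1 (by simp) (by simpa using heX) (by
        intro e' he'
        rw [he, List.mem_singleton, Option.some_inj]
        have := hv.2 e' he'
        tauto)
    simp only [Function.update_idem, List.length_singleton, Function.update_self, tsub_zero,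
      List.map_cons, List.map_nil, List.sum_singleton, lab_removeVertex (hv.2 e heX)] at this
    rw [this, hE0, ← Nat.add_assoc _ t k, Nat.add_mod_right]
  have hV : ∀ i, cntV i S (Function.update f v t) = cntV i (removeVertex S v) f + ind i t := by
    intro i
    unfold cntV
    rw [← Finset.sum_erase_add _ _ hv.1, Function.update_self]
    congr 1
    exact Finset.sum_congr rfl fun w hw => by
      rw [Function.update_of_ne (Finset.ne_of_mem_erase hw)]
  refine ⟨ind 1 t, ind 2 t, _, _, ?_, ind_le _ _, ind_le _ _, ?_, ?_, by simpa using hV 1,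
    by simpa using hV 2, hE 1, hE 2⟩
  · rw [vcode_eq, ecode_eq, ecode_eq]
    have := ind_add_le (lab T k (removeVertex S v) f e)
    omega
  · have := ind_le 1 ((lab T k (removeVertex S v) f e + t) % k); omega
  · have := ind_le 2 ((lab T k (removeVertex S v) f e + t) % k); omega

end HypertreeCordial

/-! ### Soundness of the bitmap search -/

namespace HypertreeCordial

set_option linter.unusedSectionVars false

theorem testBit_bigUnion {L : List ℕ} {c : ℕ} :
    (bigUnion L).testBit c = true ↔ ∃ a ∈ L, a.testBit c = true := by
  unfold bigUnion
  induction L with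
  | nil => simp
  | cons a L ih => simp [ih]

theorem testBit_shiftUnion {L : List ℕ} {M c : ℕ} :
    (shiftUnion L M).testBit c = true ↔ ∃ a ∈ L, a ≤ c ∧ M.testBit (c - a) = true := by
  unfold shiftUnion
  induction L with
  | nil => simp
  | cons a L ih => simp [ih]

theorem mem_tuples {k n : ℕ} {l : List ℕ} :
    l ∈ tuples k n ↔ l.length = n ∧ ∀ x ∈ l, x < k := by
  induction n generalizing l with
  | zero =>
    simp only [tuples, List.mem_singleton]
    constructor
    · rintro rfl; simp
    · exact fun h => List.length_eq_zero_iff.1 h.1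
  | succ n ih =>
    simp only [tuples, List.mem_flatMap, List.mem_range, List.mem_map]
    constructor
    · rintro ⟨x, hx, l', hl', rfl⟩
      have := ih.1 hl'
      simp only [List.length_cons, List.mem_cons, forall_eq_or_imp]
      exact ⟨by omega, hx, this.2⟩
    · rintro ⟨h1, h2⟩
      cases l with
      | nil => simp at h1
      | cons x l =>
        simp only [List.length_cons, List.mem_cons, forall_eq_or_imp] at h1 h2
        exact ⟨x, h2.1, l, ih.2 ⟨by omega, h2.2⟩, rfl⟩

theorem mem_comps {k d : ℕ} {c : ℕ × ℕ} (h : c ∈ comps k d) :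
    c.1 + c.2 ≤ d ∧ (c.2 = 0 ∨ k = 3) := by
  simp only [comps, List.mem_flatMap, List.mem_range, List.mem_map] at h
  obtain ⟨i, hi, j, hj, rfl⟩ := h
  split_ifs at hj with hk
  · exact ⟨by simp only; omega, Or.inr hk⟩
  · exact ⟨by simp only; omega, Or.inl (by simp only; omega)⟩

theorem getElem?_setAll {k t : ℕ} {ls js : List ℕ} (hjs : js.Nodup) (n : ℕ) :
    (setAll k ls js t)[n]? = if n ∈ js then ls[n]?.map (fun x => (x + t) % k) else ls[n]? := by
  unfold setAll
  induction js generalizing n with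
  | nil => simp
  | cons j js ih =>
    obtain ⟨h1, h2⟩ := List.nodup_cons.1 hjs
    have ih := ih h2
    rw [List.foldr_cons, List.getElem?_set]
    by_cases hjn : j = n
    · subst hjn
      have ihj := ih j
      rw [if_neg h1] at ihj
      rw [if_pos rfl, if_pos List.mem_cons_self, List.getD_eq_getElem?_getD, ihj]
      by_cases hl : j < ls.length
      · rw [List.getElem?_eq_getElem hl] at ihj ⊢
        rw [if_pos (List.getElem?_eq_some_iff.1 ihj).1]
        rfl
      · have hl' : ls.length ≤ j := by omega
        rw [List.getElem?_eq_none hl'] at ihj ⊢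
        rw [if_neg (by have := List.getElem?_eq_none_iff.1 ihj; omega)]
        rfl
    · rw [if_neg hjn, ih n]
      simp [Ne.symm hjn]

variable {V E : Type*} [DecidableEq V] [DecidableEq E] {T : Rooting V E} {S S₀ S₁ : State V E}

theorem map_set_eq {vs : List V} (hnd : vs.Nodup) {f : V → ℕ} {i t : ℕ} {v : V}
    (hi : vs[i]? = some v) : vs.map (Function.update f v t) = (vs.map f).set i t := by
  apply List.ext_getElem?
  intro n
  obtain ⟨hi', rfl⟩ := List.getElem?_eq_some_iff.1 hi
  rw [List.getElem?_set, List.getElem?_map]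
  by_cases h : i = n
  · subst h; simp [hi']
  · rw [if_neg h, List.getElem?_map]
    by_cases hn : n < vs.length
    · have : vs[n] ≠ vs[i] := fun h' => h ((hnd.getElem_inj_iff).1 h').symm
      simp [hn, this]
    · simp [hn]

theorem map_setAll_eq {k t : ℕ} {es : List E} (hnd : es.Nodup) {a b : E → ℕ} {js : List ℕ}
    (hjs : js.Nodup) (h : ∀ e ∈ es, b e = if ∃ j ∈ js, es[j]? = some e then (a e + t) % k else a e) :
    es.map b = setAll k (es.map a) js t := by
  apply List.ext_getElem?
  intro n
  rw [getElem?_setAll hjs, List.getElem?_map, List.getElem?_map]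
  by_cases hn : n < es.length
  · have : (∃ j ∈ js, es[j]? = some es[n]) ↔ n ∈ js := by
      constructor
      · rintro ⟨j, hj, h'⟩
        obtain ⟨hj', h''⟩ := List.getElem?_eq_some_iff.1 h'
        rwa [← (hnd.getElem_inj_iff).1 h'']
      · exact fun hj => ⟨n, hj, List.getElem?_eq_getElem hn⟩
    simp only [List.getElem?_eq_getElem hn, Option.map_some, h _ (List.getElem_mem hn), this]
    split_ifs <;> rfl
  · simp [hn]

theorem getD_map_of_getElem? {A : Type*} {l : List A} {g : A → ℕ} {i : ℕ} {a : A}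
    (h : l[i]? = some a) : (l.map g).getD i 0 = g a := by
  simp [List.getD_eq_getElem?_getD, h]

/-- Induction on the operations. A reachable code comes from one choice for the first operation and
a code reachable by the rest. After that choice the register lists are again the labels of an actual
labelling, so the induction applies, and the two increments add up by `Shift.trans`. Distinctness of
the listed edges makes the positional updates of the registers agree with the labels. -/
theorem testBit_run_sound {k : ℕ} (hk : 2 ≤ k) {vs : List V} {es : List E} {ops : List Op}
    (h : Built T S₀ vs es ops S) (hS : Closed T S) :
    ∀ f₀ : V → ℕ, (∀ v, f₀ v < k) → (∀ v ∈ vs, v ∈ S₀.W) → (∀ e ∈ es, e ∈ S₀.X) →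
      es.Nodup → ∀ c, (run k ops (vs.map f₀) (es.map (lab T k S₀ f₀))).testBit c = true →
      ∃ f, (∀ v, f v < k) ∧ Shift T k (ops.map Op.offV).sum (ops.map Op.offE).sum
        (ops.map Op.maxV).sum (ops.map Op.maxE).sum S₀ f₀ S f c := by
  induction h with
  | nil S vs es =>
    intro f₀ hf₀ _ _ _ c hc
    have : c = 0 := by
      rw [run] at hc
      by_contra hne
      rw [Nat.testBit_one_eq_true_iff_self_eq_zero] at hc
      exact hne hc
    subst this
    exact ⟨f₀, hf₀, 0, 0, 0, 0, by simp⟩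
  | @edge S₁ S vs ws es ops i q z h hz hi hnd hws hq ih =>
    intro f₀ hf₀ hvs hes hen c hc
    rw [run, testBit_bigUnion] at hc
    obtain ⟨_, h1, h2⟩ := hc
    obtain ⟨ts, hts, rfl⟩ := List.mem_map.1 h1
    obtain ⟨hlen, htk⟩ := mem_tuples.1 hts
    obtain ⟨_, h3, hle, h4⟩ := testBit_shiftUnion.1 h2
    obtain ⟨⟨a, b⟩, hab, rfl⟩ := List.mem_map.1 h3
    obtain ⟨hab1, hab2⟩ := mem_comps hab
    obtain ⟨f, hf, hff, hmap, hlab, hsh⟩ :=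
      shift_edge hk (h.closed hS) hz hnd hws hq hlen htk hab1 hab2 hf₀
    simp only [getD_map_of_getElem? hi] at hle h4
    have hvs' : vs.map f₀ = vs.map f := List.map_congr_left fun v hv =>
      (hff v (Finset.mem_sdiff.1 (hvs v hv)).2).symm
    have hes' : es.map (lab T k (removeLeaf T S₁ z) f₀) = es.map (lab T k S₁ f) :=
      List.map_congr_left fun e he => by
        obtain ⟨h5, h6⟩ := Finset.mem_erase.1 (hes e he)
        exact (hlab e h6 h5).symm
    rw [hvs', hes', ← hmap, ← List.map_append] at h4
    obtain ⟨g, hg, hsh'⟩ := ih hS f hf (by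
        intro v hv
        rcases List.mem_append.1 hv with hv | hv
        · exact (Finset.mem_sdiff.1 (hvs v hv)).1
        · exact ch_subset _ (hws v hv))
      (fun e he => Finset.mem_of_mem_erase (hes e he))
      hen _ h4
    refine ⟨g, hg, ?_⟩
    have := hsh.trans hsh'
    rw [hmap] at this
    rw [Nat.sub_add_cancel hle] at this
    simpa [Op.offV, Op.offE, Op.maxV, Op.maxE] using this
  | @vert S₁ S vs es ops j v w e h hv he hw hne hj ih =>
    intro f₀ hf₀ hvs hes hen c hc
    rw [run, testBit_bigUnion] at hc
    obtain ⟨_, h1, h2⟩ := hc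
    obtain ⟨t, ht, rfl⟩ := List.mem_map.1 h1
    rw [List.mem_range] at ht
    rw [Nat.testBit_shiftLeft, Bool.and_eq_true, decide_eq_true_eq] at h2
    obtain ⟨hle, h4⟩ := h2
    have hsh := shift_vert (t := t) (f := f₀) (k := k) (by omega) (h.closed hS) hv he
    simp only [getD_map_of_getElem? hj] at hle h4
    have hvs' : vs.map f₀ = vs.map (Function.update f₀ v t) := List.map_congr_left fun u hu => by
      rw [Function.update_of_ne]
      exact Finset.ne_of_mem_erase (hvs u hu)
    have hes' : es.map (lab T k S₁ (Function.update f₀ v t)) =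
        setAll k (es.map (lab T k (removeVertex S₁ v) f₀)) [j] t := by
      refine map_setAll_eq hen (List.nodup_singleton j) fun e' he' => ?_
      have := lab_update (T := T) (S := S₁) (k := k) (t := t) (f := Function.update f₀ v 0) (v := v)
        (e := e') (by simp; omega) hv.1
      have hpe := hv.2 e' (hes e' he')
      rw [Function.update_idem, lab_removeVertex hpe] at this
      rw [this]
      simp only [hpe, he, Function.update_self, Option.some_inj, List.mem_singleton,
        exists_eq_left, hj, false_or, tsub_zero]
      rw [← Nat.add_assoc, Nat.add_mod_right]
    have hset : setAll k (es.map (lab T k (removeVertex S₁ v) f₀)) [j] t =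
      (es.map (lab T k (removeVertex S₁ v) f₀)).set j
        ((lab T k (removeVertex S₁ v) f₀ e + t) % k) := by
      simp only [setAll, List.foldr_cons, List.foldr_nil, getD_map_of_getElem? hj]
    rw [← hset, ← hes', hvs'] at h4
    obtain ⟨g, hg, hsh'⟩ := ih hS (Function.update f₀ v t) (by
        intro u
        by_cases hu : u = v
        · subst hu; simpa using ht
        · rw [Function.update_of_ne hu]; exact hf₀ u)
      (by
        intro u hu
        rcases List.mem_append.1 hu with hu | hu
        · exact Finset.mem_of_mem_erase (hvs u hu)
        · rw [List.mem_singleton.1 hu]; exact hv.1)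
      hes
      hen _ (by
        rw [List.map_append, List.map_singleton, Function.update_self]
        exact h4)
    refine ⟨g, hg, ?_⟩
    have := hsh.trans hsh'
    rw [Nat.sub_add_cancel hle] at this
    simpa [Op.offV, Op.offE, Op.maxV, Op.maxE] using this
  | @flip S₁ S vs es ops i js v h hvn hi hjs hjl hv ih =>
    intro f₀ hf₀ hvs hes hen c hc
    rw [run, testBit_bigUnion] at hc
    obtain ⟨_, h1, h2⟩ := hc
    obtain ⟨t, ht, rfl⟩ := List.mem_map.1 h1
    rw [List.mem_range] at ht
    rw [Nat.testBit_shiftLeft, Bool.and_eq_true, decide_eq_true_eq] at h2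
    obtain ⟨hle, h4⟩ := h2
    have hvW : v ∈ S₁.W := hvs v (List.mem_of_getElem? hi)
    simp only [getD_map_of_getElem? hi] at hle h4
    -- `L` lists the edges to which the indices `js` refer.
    obtain ⟨L, hL⟩ : ∃ L : List E, js.map (fun j => es[j]?) = L.map some := by
      refine ⟨js.filterMap (fun j => es[j]?), ?_⟩
      clear hv hle h4 h1 hjs
      induction js with
      | nil => rfl
      | cons j js ihj =>
        have := hjl j List.mem_cons_self
        rw [List.map_cons, List.filterMap_cons, List.getElem?_eq_getElem this]
        simp only [List.map_cons]
        rw [ihj fun j hj => hjl j (List.mem_cons_of_mem _ hj)]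
    have hLmem : ∀ e, e ∈ L ↔ ∃ j ∈ js, es[j]? = some e := by
      intro e
      have : some e ∈ L.map some ↔ e ∈ L := by simp
      rw [← this, ← hL, List.mem_map]
    have hLn : L.Nodup := by
      have : (L.map some).Nodup := by
        rw [← hL]
        refine List.Nodup.map_on ?_ hjs
        intro a ha b hb hab
        rw [List.getElem?_eq_getElem (hjl a ha), List.getElem?_eq_getElem (hjl b hb)] at hab
        exact (hen.getElem_inj_iff).1 (Option.some.inj hab)
      exact List.Nodup.of_map _ this
    have hLlen : L.length = js.length := by
      have := congrArg List.length hL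
      simpa using this.symm
    have hsum : (js.map fun j => (4352 - ecode ((es.map (lab T k S₁ f₀)).getD j 0)) +
        ecode (((es.map (lab T k S₁ f₀)).getD j 0 + (t + (k - f₀ v))) % k)) =
        L.map fun e => (4352 - ecode (lab T k S₁ f₀ e)) +
        ecode ((lab T k S₁ f₀ e + (t + (k - f₀ v))) % k) := by
      have := congrArg (List.map fun o : Option E => (4352 - ecode ((o.map (lab T k S₁ f₀)).getD 0)) +
        ecode (((o.map (lab T k S₁ f₀)).getD 0 + (t + (k - f₀ v))) % k)) hL
      simp only [List.map_map, Function.comp_def, Option.map_some, Option.getD_some] at this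
      rw [← this]
      refine List.map_congr_left fun j _ => ?_
      rw [List.getD_eq_getElem?_getD, List.getElem?_map]
    rw [hsum] at hle h4
    have hsh := shift_flip (t := t) (hf₀ v) hvW hLn
      (fun e he => by
        obtain ⟨j, _, hj⟩ := (hLmem e).1 he
        exact hes e (List.mem_of_getElem? hj))
      (fun e he => (hv e he).trans (hLmem e).symm)
    rw [← map_set_eq hvn hi (f := f₀) (t := t), ← map_setAll_eq hen hjs
      (b := lab T k S₁ (Function.update f₀ v t)) fun e he => by
        rw [lab_update (hf₀ v) hvW]
        exact if_congr (hv e (hes e he)) rfl rfl] at h4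
    obtain ⟨g, hg, hsh'⟩ := ih hS (Function.update f₀ v t) (by
        intro u
        by_cases hu : u = v
        · subst hu; simpa using ht
        · rw [Function.update_of_ne hu]; exact hf₀ u)
      hvs hes hen _ h4
    refine ⟨g, hg, ?_⟩
    have := hsh.trans hsh'
    rw [Nat.sub_add_cancel hle, hLlen] at this
    simpa [Op.offV, Op.offE, Op.maxV, Op.maxE] using this

end HypertreeCordial

/-! ### Profiles, and the passage from a successful check to labellings -/

namespace HypertreeCordial

set_option linter.unusedSectionVars false

variable {V E : Type*} [DecidableEq V] [DecidableEq E] {T : Rooting V E} {S S₀ S₁ : State V E}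

/-- The labelling `f` has the counts that the code `t` prescribes relative to equal distribution. -/
def Profile (T : Rooting V E) (k : ℕ) (S : State V E) (f : V → ℕ) (t : ℕ) : Prop :=
  (∀ v, f v < k) ∧
  cntV 1 S f = S.W.card / k + t % 16 ∧ cntV 2 S f = (k - 2) * (S.W.card / k) + t / 16 % 16 ∧
  cntE T k 1 S f = S.X.card / k + t / 256 % 16 ∧ cntE T k 2 S f = (k - 2) * (S.X.card / k) + t / 4096

/-- The strengthened induction statement; it is void unless `k` divides the number of edges. -/
def Achieves (T : Rooting V E) (k : ℕ) (S : State V E) : Prop :=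
  k ∣ S.X.card → ∀ t ∈ allowed k (S.W.card % k), ∃ f, Profile T k S f t

def Balanced (T : Rooting V E) (k : ℕ) (S : State V E) : Prop :=
  ∃ t ∈ vbal k (S.W.card % k), ∃ b ∈ vbal k (S.X.card % k), ∃ f, Profile T k S f (t + 256 * b)

theorem prevResidue_eq {k a b : ℕ} {ops : List Op} (hk : k = 2 ∨ k = 3)
    (h : a = b + (ops.map Op.newV).sum) : prevResidue k ops (a % k) = b % k := by
  unfold prevResidue
  rcases hk with rfl | rfl <;> omega

theorem ind_neg {x : ℕ} (h : x < 3) :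
    ind 1 ((3 - x) % 3) = ind 2 x ∧ ind 2 ((3 - x) % 3) = ind 1 x := by
  unfold ind; interval_cases x <;> simp

theorem neg_sum (C : Finset V) (f : V → ℕ) (a : ℕ) (ha : a < 3) (hf : ∀ v, f v < 3) :
    ((3 - a) % 3 + ∑ v ∈ C, (3 - f v) % 3) % 3 = (3 - (a + ∑ v ∈ C, f v) % 3) % 3 := by
  induction C using Finset.induction_on with
  | empty => simp only [Finset.sum_empty]; omega
  | insert v C hv ih =>
    rw [Finset.sum_insert hv, Finset.sum_insert hv]
    have := hf v
    omega

theorem lab_neg {f : V → ℕ} (hf : ∀ v, f v < 3) (e : E) :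
    lab T 3 S (fun v => (3 - f v) % 3) e = (3 - lab T 3 S f e) % 3 :=
  neg_sum _ _ _ (hf _) hf

theorem swap_digits {t : ℕ} (ht : t < 65536) :
    swap t % 16 = t / 16 % 16 ∧ swap t / 16 % 16 = t % 16 ∧ swap t / 256 % 16 = t / 4096 ∧
      swap t / 4096 = t / 256 % 16 := by
  have h1 : t % 16 < 16 := by omega
  have h2 : t / 16 % 16 < 16 := by omega
  have h3 : t / 256 % 16 < 16 := by omega
  have h4 : t / 4096 < 16 := by omega
  unfold swap
  generalize t % 16 = a at *
  generalize t / 16 % 16 = b at *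
  generalize t / 256 % 16 = c at *
  generalize t / 4096 = d at *
  omega

/-- Negation modulo 3 fixes 0 and exchanges 1 and 2 on the vertices. Being additive, it does the
same to the edge labels. -/
theorem Profile.neg {f : V → ℕ} {t : ℕ} (h : Profile T 3 S f t) (ht : t < 65536) :
    Profile T 3 S (fun v => (3 - f v) % 3) (swap t) := by
  obtain ⟨h0, h1, h2, h3, h4⟩ := h
  obtain ⟨d1, d2, d3, d4⟩ := swap_digits ht
  have e1 : ∀ i j, (∀ x < 3, ind i ((3 - x) % 3) = ind j x) →
      cntV i S (fun v => (3 - f v) % 3) = cntV j S f := fun i j h =>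
    Finset.sum_congr rfl fun v _ => h _ (h0 v)
  have e2 : ∀ i j, (∀ x < 3, ind i ((3 - x) % 3) = ind j x) →
      cntE T 3 i S (fun v => (3 - f v) % 3) = cntE T 3 j S f := fun i j h =>
    Finset.sum_congr rfl fun e _ => by rw [lab_neg h0]; exact h _ (lab_lt (by omega) S f e)
  refine ⟨fun v => Nat.mod_lt _ (by omega), ?_, ?_, ?_, ?_⟩
  · rw [e1 1 2 fun x hx => (ind_neg hx).1, h2, d1]; omega
  · rw [e1 2 1 fun x hx => (ind_neg hx).2, h1, d2]; omega
  · rw [e2 1 2 fun x hx => (ind_neg hx).1, h4, d3]; omega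
  · rw [e2 2 1 fun x hx => (ind_neg hx).2, h3, d4]; omega

theorem mem_vbal {k r t : ℕ} (h : t ∈ vbal k r) : t = 0 ∨ t = 1 ∨ (k ≠ 2 ∧ (t = 16 ∨ t = 17)) := by
  unfold vbal at h
  split_ifs at h <;> simp at h <;> tauto

theorem mem_allowed {k r t : ℕ} (h : t ∈ allowed k r) :
    t = 0 ∨ t = 1 ∨ t = 256 ∨ (k ≠ 2 ∧ (t = 16 ∨ t = 17 ∨ t = 4096)) := by
  unfold allowed at h
  split_ifs at h
  · simp at h; tauto
  · simp at h; tauto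
  · have := mem_vbal h; tauto

theorem digits_unique {n₁ n₂ m₁ m₂ n₁' n₂' m₁' m₂' : ℕ}
    (h : n₁ + 16 * n₂ + 256 * m₁ + 4096 * m₂ = n₁' + 16 * n₂' + 256 * m₁' + 4096 * m₂')
    (h1 : n₁ < 16) (h2 : n₂ < 16) (h3 : m₁ < 16) (h1' : n₁' < 16) (h2' : n₂' < 16)
    (h3' : m₁' < 16) : n₁ = n₁' ∧ n₂ = n₂' ∧ m₁ = m₁' ∧ m₂ = m₂' := by
  omega

/-- Since the lower digits stay below 16, no carries occur and the single equation between codes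
splits into four equations between counts. -/
theorem code_unique {κ J M oV oE t t₁ n₁ n₂ m₁ m₂ a₁ a₂ a₃ a₄ a₁' a₂' a₃' a₄' : ℕ}
    (hκ : κ = 0 ∨ κ = 1)
    (hle : t₁ ≤ t + (J * (1 + 16 * κ) + oV * 17 + (M * (256 + 4096 * κ) + oE * 4352)))
    (hc : t + (J * (1 + 16 * κ) + oV * 17 + (M * (256 + 4096 * κ) + oE * 4352)) - t₁ =
      n₁ + 16 * n₂ + 256 * m₁ + 4096 * m₂)
    (ht : t = a₁ + 16 * a₂ + 256 * a₃ + 4096 * a₄)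
    (ht₁ : t₁ = a₁' + 16 * a₂' + 256 * a₃' + 4096 * a₄')
    (h1 : n₁ + a₁' < 16) (h2 : n₂ + a₂' < 16) (h3 : m₁ + a₃' < 16) (h1' : a₁ + J + oV < 16)
    (h2' : a₂ + J + oV < 16) (h3' : a₃ + M + oE < 16) :
    n₁ + a₁' = a₁ + J + oV ∧ n₂ + a₂' = a₂ + κ * J + oV ∧ m₁ + a₃' = a₃ + M + oE ∧
      m₂ + a₄' = a₄ + κ * M + oE := by
  rcases hκ with rfl | rfl
  · refine digits_unique ?_ h1 h2 h3 h1' (by omega) h3'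
    omega
  · refine digits_unique ?_ h1 h2 h3 h1' (by omega) h3'
    omega

theorem div_sub_div {k a b N : ℕ} (hk : k = 2 ∨ k = 3) (h : a = b + N) :
    (N + b % k - a % k) / k + b / k = a / k := by
  rcases hk with rfl | rfl <;> omega

/-- One extension step: a successful `ext` produces a labelling with the target profile. -/
theorem exists_profile {k : ℕ} (hk : k = 2 ∨ k = 3) {vs : List V} {es : List E} {ops : List Op}
    (h : Built T S₀ vs es ops S) (hS : Closed T S) (hvs : ∀ v ∈ vs, v ∈ S₀.W)
    (hes : ∀ e ∈ es, e ∈ S₀.X) (hen : es.Nodup) (hb : opsBounded k ops = true)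
    (hX : k ∣ S₀.X.card) {t t₁ : ℕ} {f₀ : V → ℕ} (hf₀ : Profile T k S₀ f₀ t₁)
    (ht₁ : t₁ = 0 ∨ t₁ = 1 ∨ t₁ = 256 ∨ (k ≠ 2 ∧ (t₁ = 16 ∨ t₁ = 17 ∨ t₁ = 4096)))
    (ht : t % 16 ≤ 1 ∧ t / 16 % 16 ≤ 1 ∧ t / 256 % 16 ≤ 1 ∧ t / 4096 ≤ 1)
    (hext : ext k ops vs.length (vs.map f₀ ++ es.map (lab T k S₀ f₀))
      (t + target k ops (S₀.W.card % k) (S.W.card % k)) t₁ = true) :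
    ∃ f, Profile T k S f t := by
  obtain ⟨hW, hXc⟩ := h.card
  unfold ext at hext
  rw [Bool.and_eq_true, Nat.ble_eq, Nat.beq_eq] at hext
  obtain ⟨hle, hbit⟩ := hext
  rw [List.take_left' (by simp), List.drop_left' (by simp)] at hbit
  have hbit' : (run k ops (vs.map f₀) (es.map (lab T k S₀ f₀))).testBit
      (t + target k ops (S₀.W.card % k) (S.W.card % k) - t₁) = true := by
    rw [Nat.testBit_eq_decide_div_mod_eq, decide_eq_true_eq, ← Nat.shiftRight_eq_div_pow]
    exact hbit
  obtain ⟨f, hf, n₁, n₂, m₁, m₂, hc, b1, b2, b3, b4, c1, c2, c3, c4⟩ :=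
    testBit_run_sound (by omega) h hS f₀ hf₀.1 hvs hes hen _ hbit'
  obtain ⟨-, p1, p2, p3, p4⟩ := hf₀
  refine ⟨f, hf, ?_⟩
  unfold opsBounded at hb
  simp only [Bool.and_eq_true, Nat.ble_eq] at hb
  obtain ⟨⟨⟨d1, d2⟩, d3⟩, d4⟩ := hb
  unfold target at hc hle
  generalize (ops.map Op.newV).sum = N at *
  generalize (ops.map Op.newE).sum = M at *
  generalize (ops.map Op.offV).sum = oV at *
  generalize (ops.map Op.offE).sum = oE at *
  generalize (ops.map Op.maxV).sum = xV at *
  generalize (ops.map Op.maxE).sum = xE at *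
  obtain ⟨q1, q2, q3, q4⟩ : t₁ % 16 ≤ 1 ∧ t₁ / 16 % 16 ≤ 1 ∧ t₁ / 256 % 16 ≤ 1 ∧ t₁ / 4096 ≤ 1 := by
    rcases ht₁ with rfl | rfl | rfl | ⟨-, rfl | rfl | rfl⟩ <;> decide
  have et : t = t % 16 + 16 * (t / 16 % 16) + 256 * (t / 256 % 16) + 4096 * (t / 4096) := by
    clear * -; omega
  have et₁ : t₁ = t₁ % 16 + 16 * (t₁ / 16 % 16) + 256 * (t₁ / 256 % 16) + 4096 * (t₁ / 4096) := by
    clear * -; omega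
  have e1 := div_sub_div hk hW
  have e2 : M / k + S₀.X.card / k = S.X.card / k := by
    rw [hXc, Nat.add_div_of_dvd_right hX, Nat.add_comm]
  clear ht₁ hbit hbit' h hS hvs hes hen hX hW hXc
  obtain ⟨r1, r2, r3, r4⟩ := ht
  generalize t % 16 = a₁ at *
  generalize t / 16 % 16 = a₂ at *
  generalize t / 256 % 16 = a₃ at *
  generalize t / 4096 = a₄ at *
  generalize t₁ % 16 = a₁' at *
  generalize t₁ / 16 % 16 = a₂' at *
  generalize t₁ / 256 % 16 = a₃' at *
  generalize t₁ / 4096 = a₄' at *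
  have d5 : (N + S₀.W.card % k - S.W.card % k) / k ≤ N / k + 1 := by
    rw [← Nat.add_div_right _ (by omega)]
    have := Nat.mod_lt S₀.W.card (show 0 < k by omega)
    exact Nat.div_le_div_right (by omega)
  generalize (N + S₀.W.card % k - S.W.card % k) / k = J at *
  generalize N / k = N' at *
  generalize M / k = M' at *
  generalize S.W.card / k = A at *
  generalize S₀.W.card / k = A₀ at *
  generalize S.X.card / k = B at *
  generalize S₀.X.card / k = B₀ at *
  -- The factor `k - 2` switches label 2 on for `k = 3` and off for `k = 2`.
  have hκ : k - 2 = 0 ∨ k - 2 = 1 := by omega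
  clear hk
  generalize k - 2 = κ at *
  obtain ⟨u1, u2, u3, u4⟩ := code_unique hκ hle hc et et₁ (by omega) (by omega) (by omega)
    (by omega) (by omega) (by omega)
  clear hle hc et et₁
  rcases hκ with rfl | rfl
  · refine ⟨?_, ?_, ?_, ?_⟩ <;> omega
  · refine ⟨?_, ?_, ?_, ?_⟩ <;> omega

theorem code_digits {k t : ℕ}
    (h : t = 0 ∨ t = 1 ∨ t = 256 ∨ (k ≠ 2 ∧ (t = 16 ∨ t = 17 ∨ t = 4096))) :
    t % 16 ≤ 1 ∧ t / 16 % 16 ≤ 1 ∧ t / 256 % 16 ≤ 1 ∧ t / 4096 ≤ 1 := by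
  rcases h with rfl | rfl | rfl | ⟨-, rfl | rfl | rfl⟩ <;> decide

theorem registers_mem_tuples {k : ℕ} (hk : 0 < k) {f : V → ℕ} (hf : ∀ v, f v < k) (vs : List V)
    (es : List E) : vs.map f ++ es.map (lab T k S f) ∈ tuples k (vs.length + es.length) := by
  refine mem_tuples.2 ⟨by simp, fun x hx => ?_⟩
  rcases List.mem_append.1 hx with hx | hx <;> obtain ⟨y, -, rfl⟩ := List.mem_map.1 hx
  · exact hf y
  · exact lab_lt hk S f y

theorem swap_code {t : ℕ} (h : t = 0 ∨ t = 1 ∨ t = 256 ∨ (3 ≠ 2 ∧ (t = 16 ∨ t = 17 ∨ t = 4096))) :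
    swap t = 0 ∨ swap t = 1 ∨ swap t = 256 ∨
      (3 ≠ 2 ∧ (swap t = 16 ∨ swap t = 17 ∨ swap t = 4096)) := by
  rcases h with rfl | rfl | rfl | ⟨-, rfl | rfl | rfl⟩ <;> decide

/-- The profile `t₁` is chosen before the labelling `f₀` is known. The labels that `f₀` gives to the
registers cannot be controlled, which is why the check ranges over all of them. -/
theorem Built.achieves {k : ℕ} (hk : k = 2 ∨ k = 3) {vs : List V} {es : List E} {ops : List Op}
    {known : List (ℕ × List ℕ)} (h : Built T S₀ vs es ops S) (hS : Closed T S)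
    (hvs : ∀ v ∈ vs, v ∈ S₀.W) (hes : ∀ e ∈ es, e ∈ S₀.X) (hen : es.Nodup)
    (hknown : ∀ f₀ : V → ℕ, (∀ v, f₀ v < k) →
      consistent k vs.length known (vs.map f₀ ++ es.map (lab T k S₀ f₀)) = true)
    (hc : check k ops vs.length es.length known = true) (ih : Achieves T k S₀) :
    Achieves T k S := by
  intro hX t ht
  unfold check at hc
  rw [Bool.and_eq_true, Bool.and_eq_true, Nat.beq_eq, List.all_eq_true] at hc
  obtain ⟨⟨hb, hM⟩, hc⟩ := hc
  have hX₀ : k ∣ S₀.X.card := by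
    rw [h.card.2] at hX
    exact (Nat.dvd_add_left (Nat.dvd_of_mod_eq_zero hM)).1 hX
  have hc := hc (S.W.card % k) (List.mem_range.2 (Nat.mod_lt _ (by omega)))
  simp only [prevResidue_eq hk h.card.1, List.all_eq_true, List.any_eq_true] at hc
  obtain ⟨t₁, ht₁, hc⟩ := hc t ht
  obtain ⟨f₀, hf₀⟩ := ih hX₀ t₁ ht₁
  have hc := hc _ (List.mem_filter.2 ⟨registers_mem_tuples (by omega) hf₀.1 vs es, hknown f₀ hf₀.1⟩)
  rw [Bool.or_eq_true] at hc
  have h1 := mem_allowed ht₁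
  have h2 := code_digits (mem_allowed ht)
  rcases hc with hc | hc
  · exact exists_profile hk h hS hvs hes hen hb hX₀ hf₀ h1 h2 hc
  · rw [Bool.and_eq_true, Nat.beq_eq] at hc
    obtain ⟨rfl, hc⟩ := hc
    -- The extension starts from the negated labelling, whose register labels are the negated ones.
    refine exists_profile hk h hS hvs hes hen hb hX₀ (hf₀.neg (by omega)) (swap_code h1) h2 ?_
    simp only [List.map_append, List.map_map, Function.comp_def] at hc
    rw [List.map_congr_left (l := es) fun e _ => lab_neg hf₀.1 e]
    exact hc

theorem Built.balanced {k : ℕ} (hk : k = 2 ∨ k = 3) {vs : List V} {ops : List Op}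
    (h : Built T S₀ vs [] ops S) (hS : Closed T S)
    (hvs : ∀ v ∈ vs, v ∈ S₀.W) (hX₀ : k ∣ S₀.X.card)
    (hc : checkFinal k ops vs.length = true) (ih : Achieves T k S₀) : Balanced T k S := by
  unfold checkFinal at hc
  rw [Bool.and_eq_true, List.all_eq_true] at hc
  obtain ⟨hb, hc⟩ := hc
  have hc := hc (S.W.card % k) (List.mem_range.2 (Nat.mod_lt _ (by omega)))
  simp only [prevResidue_eq hk h.card.1, List.all_eq_true, List.any_eq_true] at hc
  obtain ⟨t₁, ht₁, hc⟩ := hc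
  obtain ⟨f₀, hf₀⟩ := ih hX₀ t₁ ht₁
  have hreg := registers_mem_tuples (T := T) (S := S₀) (by omega) hf₀.1 vs []
  obtain ⟨t, ht, b, hb', hc⟩ := hc _ (by simpa using hreg)
  have hM : (ops.map Op.newE).sum % k = S.X.card % k := by
    rw [h.card.2, ← Nat.mod_add_mod, Nat.mod_eq_zero_of_dvd hX₀, zero_add]
  rw [hM] at hb'
  refine ⟨t, ht, b, hb', exists_profile hk h hS hvs (by simp) List.nodup_nil hb hX₀ hf₀
    (mem_allowed ht₁) ?_ (by simpa using hc)⟩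
  rcases mem_vbal ht with rfl | rfl | ⟨-, rfl | rfl⟩ <;>
    rcases mem_vbal hb' with rfl | rfl | ⟨-, rfl | rfl⟩ <;> decide

end HypertreeCordial

/-! ### Cutting off edges and private vertices -/

namespace HypertreeCordial

set_option linter.unusedSectionVars false

variable {V E : Type*} [DecidableEq V] [DecidableEq E] {T : Rooting V E} {S S₀ S₁ : State V E}

variable (T S) in
/-- The edges whose parent vertex is `w`. -/
def hang (w : V) : Finset E := S.X.filter fun e => T.par e = w

variable (T S) in
/-- The children of `e` that carry further edges. -/
def inner (e : E) : Finset V := (ch T S e).filter fun w => (hang T S w).Nonempty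

theorem mem_hang {w : V} {e : E} : e ∈ hang T S w ↔ e ∈ S.X ∧ T.par e = w := by simp [hang]

theorem mem_inner {w : V} {e : E} :
    w ∈ inner T S e ↔ w ∈ ch T S e ∧ ∃ z ∈ S.X, T.par z = w := by
  simp [inner, Finset.Nonempty, mem_hang]

theorem hang_eq_empty_iff {w : V} : hang T S w = ∅ ↔ ∀ e ∈ S.X, T.par e ≠ w := by
  simp [hang, Finset.filter_eq_empty_iff]

variable (T S) in
-- A description of the reduced state that does not depend on the order of deletions, so that
-- membership of the registers is settled by `mem_cut_W` and `mem_cut_X`.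
def cut (Z : Finset E) (P : Finset V) : State V E := ⟨(S.W \ Z.biUnion (ch T S)) \ P, S.X \ Z⟩

theorem mem_cut_W {Z : Finset E} {P : Finset V} {v : V} :
    v ∈ (cut T S Z P).W ↔ v ∈ S.W ∧ (∀ z ∈ Z, T.up v ≠ some z) ∧ v ∉ P := by
  simp only [cut, Finset.mem_sdiff, Finset.mem_biUnion, mem_ch, not_exists, not_and]
  constructor
  · rintro ⟨⟨h1, h2⟩, h3⟩; exact ⟨h1, fun z hz => h2 z hz h1, h3⟩
  · rintro ⟨h1, h2, h3⟩; exact ⟨⟨h1, fun z hz _ => h2 z hz⟩, h3⟩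

theorem mem_cut_X {Z : Finset E} {P : Finset V} {e : E} :
    e ∈ (cut T S Z P).X ↔ e ∈ S.X ∧ e ∉ Z := by simp [cut]

theorem cut_empty : cut T S ∅ ∅ = S := by simp [cut]

theorem mem_ch_cut {Z : Finset E} {P : Finset V} {e : E} (he : e ∉ Z) {v : V} :
    v ∈ ch T (cut T S Z P) e ↔ v ∈ ch T S e ∧ v ∉ P := by
  rw [mem_ch, mem_cut_W, mem_ch]
  constructor
  · rintro ⟨⟨h1, h2, h3⟩, h4⟩; exact ⟨⟨h1, h4⟩, h3⟩
  · rintro ⟨⟨h1, h4⟩, h3⟩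
    refine ⟨⟨h1, fun z hz h => he ?_, h3⟩, h4⟩
    rw [h4] at h
    rwa [Option.some.inj h]

theorem ch_cut {Z : Finset E} {e : E} (he : e ∉ Z) : ch T (cut T S Z ∅) e = ch T S e := by
  ext v; simp [mem_ch_cut he]

theorem removeLeaf_cut {Z : Finset E} {z : E} (hz : z ∉ Z) :
    removeLeaf T (cut T S Z ∅) z = cut T S (insert z Z) ∅ := by
  rw [removeLeaf, ch_cut hz]
  ext x
  · simp only [cut, Finset.mem_sdiff, Finset.biUnion_insert, Finset.mem_union,
      Finset.notMem_empty, not_false_eq_true, and_true]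
    tauto
  · simp only [cut, Finset.mem_sdiff, Finset.mem_erase, Finset.mem_insert]
    tauto

theorem removeVertex_cut {Z : Finset E} {P : Finset V} {v : V} :
    removeVertex (cut T S Z P) v = cut T S Z (insert v P) := by
  ext x
  · simp only [removeVertex, cut, Finset.mem_sdiff, Finset.mem_erase, Finset.mem_insert]
    tauto
  · rfl

/-- `z` is a leaf edge at `w` with `d` children. -/
structure LeafAt (T : Rooting V E) (S : State V E) (z : E) (w : V) (d : ℕ) : Prop where
  mem : z ∈ S.X
  par : T.par z = w
  not_up : ∀ e ∈ S.X, T.up (T.par e) ≠ some z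
  card : (ch T S z).card = d

/-- The deletions are made downwards from `S`, and each one prepends the operation that undoes it.
The resulting list therefore begins with the operation that is performed first when rebuilding. -/
theorem Built.start (vs : List V) (es : List E) : Built T (cut T S ∅ ∅) vs es [] S := by
  rw [cut_empty]; exact Built.nil _ _ _

/-- Once all edges below `y` are in `Z`, `y` has become a leaf. The children in `ws` are registers
only for later operations and are dropped here. -/
theorem Built.cutInner {vs : List V} {es : List E} {ops : List Op} {Z : Finset E} {y : E} {i q : ℕ}
    (ws : List V) (h : Built T (cut T S Z ∅) (vs ++ ws) es ops S) (hy : y ∈ S.X) (hyZ : y ∉ Z)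
    (hi : vs[i]? = some (T.par y)) (hnd : ws.Nodup) (hws : ∀ w ∈ ws, w ∈ ch T S y)
    (hZ : ∀ e ∈ S.X, T.up (T.par e) = some y → e ∈ Z)
    (hq : (ch T S y).card = ws.length + q) :
    Built T (cut T S (insert y Z) ∅) vs es (.edge i ws.length q :: ops) S := by
  rw [← removeLeaf_cut hyZ]
  refine Built.edge h ⟨mem_cut_X.2 ⟨hy, hyZ⟩, fun e he h' => ?_⟩ hi hnd ?_ ?_
  · have := mem_cut_X.1 he
    exact this.2 (hZ e this.1 h')
  · rwa [ch_cut hyZ]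
  · rwa [ch_cut hyZ]

theorem Built.cutLeaf {vs : List V} {es : List E} {ops : List Op} {Z : Finset E} {z : E} {i d : ℕ}
    {w : V} (h : Built T (cut T S Z ∅) vs es ops S) (hz : LeafAt T S z w d) (hzZ : z ∉ Z)
    (hi : vs[i]? = some w) : Built T (cut T S (insert z Z) ∅) vs es (.edge i 0 d :: ops) S := by
  refine Built.cutInner (ws := []) (by rwa [List.append_nil]) hz.mem hzZ (by rw [hz.par, hi])
    List.nodup_nil (by simp) (fun e he h' => (hz.not_up e he h').elim) (by simp [hz.card])

/-- All edges hanging at `v` are already cut, so `v` is private; the child `w` keeps the edge from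
losing all its children. -/
theorem Built.cutVert {vs : List V} {es : List E} {ops : List Op} {Z : Finset E} {P : Finset V}
    {j : ℕ} {v w : V} {y : E} (h : Built T (cut T S Z P) (vs ++ [v]) es ops S) (hv : v ∈ ch T S y)
    (hyZ : y ∉ Z) (hvP : v ∉ P) (hZ : ∀ e ∈ S.X, T.par e = v → e ∈ Z) (hw : w ∈ ch T S y)
    (hwv : w ≠ v) (hwP : w ∉ P) (hj : es[j]? = some y) :
    Built T (cut T S Z (insert v P)) vs es (.vert j :: ops) S := by
  rw [← removeVertex_cut]
  obtain ⟨hv1, hv2⟩ := mem_ch.1 ((mem_ch_cut hyZ).2 ⟨hv, hvP⟩)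
  refine Built.vert (w := w) h ⟨hv1, fun e he h' => ?_⟩ hv2 ((mem_ch_cut hyZ).2 ⟨hw, hwP⟩) hwv hj
  have := mem_cut_X.1 he
  exact this.2 (hZ e this.1 h')

theorem Built.cutFlip {vs : List V} {es : List E} {ops : List Op} {Z : Finset E} {P : Finset V}
    {i : ℕ} {js : List ℕ} {v : V} (h : Built T (cut T S Z P) vs es ops S) (hvs : vs.Nodup)
    (hi : vs[i]? = some v) (hjs : js.Nodup) (hes : ∀ j ∈ js, j < es.length)
    (hv : ∀ e ∈ S.X, e ∉ Z → ((T.par e = v ∨ T.up v = some e) ↔ ∃ j ∈ js, es[j]? = some e)) :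
    Built T (cut T S Z P) vs es (.flip i js :: ops) S :=
  Built.flip h hvs hi hjs hes fun e he => hv e (mem_cut_X.1 he).1 (mem_cut_X.1 he).2

/-! ### Removing private vertices -/

/-- The number of private vertices that can be removed from an edge at once. -/
def blockSize (k : ℕ) : ℕ := if k = 2 then 4 else 3

def removePrivate (S : State V E) (P : Finset V) : State V E := ⟨S.W \ P, S.X⟩

theorem closed_removePrivate (hS : Closed T S) {e : E} {P : Finset V} (hP : P ⊂ ch T S e)
    (hpriv : ∀ v ∈ P, hang T S v = ∅) : Closed T (removePrivate S P) := by
  have hup : ∀ v ∈ P, T.up v = some e := fun v hv => (mem_ch.1 (hP.1 hv)).2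
  refine ⟨?_, ?_, ?_, ?_⟩
  · refine Finset.mem_sdiff.2 ⟨hS.root_mem, fun h => ?_⟩
    have := hup _ h
    rw [(T.up_eq_none T.root).2 rfl] at this
    cases this
  · exact fun e' he' => Finset.mem_sdiff.2 ⟨hS.par_mem e' he',
      fun h => hang_eq_empty_iff.1 (hpriv _ h) e' he' rfl⟩
  · exact fun v hv => hS.up_mem v (Finset.mem_sdiff.1 hv).1
  · intro e' he'
    by_cases h : e' = e
    · subst h
      obtain ⟨w, hw, hwP⟩ := Finset.exists_of_ssubset hP
      exact ⟨w, mem_ch.2 ⟨Finset.mem_sdiff.2 ⟨(mem_ch.1 hw).1, hwP⟩, (mem_ch.1 hw).2⟩⟩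
    · obtain ⟨w, hw⟩ := hS.ch_nonempty e' he'
      refine ⟨w, mem_ch.2 ⟨Finset.mem_sdiff.2 ⟨(mem_ch.1 hw).1, fun hwP => h ?_⟩, (mem_ch.1 hw).2⟩⟩
      have := hup w hwP
      rw [(mem_ch.1 hw).2] at this
      exact Option.some.inj this

/-- A balanced labelling of a block of private vertices with vanishing sum. -/
theorem exists_block {k : ℕ} (hk : k = 2 ∨ k = 3) {P : Finset V} (hP : P.card = blockSize k)
    {f₀ : V → ℕ} (hf₀ : ∀ v, f₀ v < k) :
    ∃ f : V → ℕ, (∀ v, f v < k) ∧ (∀ v ∉ P, f v = f₀ v) ∧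
      ∑ v ∈ P, ind 1 (f v) = blockSize k / k ∧
      ∑ v ∈ P, ind 2 (f v) = (k - 2) * (blockSize k / k) ∧ k ∣ ∑ v ∈ P, f v := by
  have hk2 : 2 ≤ k := by omega
  rcases hk with rfl | rfl
  -- Labels 0, 0, 1, 1. Two vertices labelled 0 and 1 would be balanced as well, but have odd sum.
  · obtain ⟨f, h1, h2, -, h3, h4, h5⟩ := exists_labels (q := 4) (a := 2) (b := 0) hk2 (C := P)
      (ws := []) List.nodup_nil (by simp) (by simpa [blockSize] using hP) (ts := []) rfl (by simp)
      (by omega) (Or.inl rfl) hf₀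
    exact ⟨f, h1, h2, by simpa [blockSize] using h3, by simpa using h4, by rw [h5]; simp⟩
  -- Labels 0, 1, 2.
  · obtain ⟨f, h1, h2, -, h3, h4, h5⟩ := exists_labels (q := 3) (a := 1) (b := 1) hk2 (C := P)
      (ws := []) List.nodup_nil (by simp) (by simpa [blockSize] using hP) (ts := []) rfl (by simp)
      (by omega) (Or.inr rfl) hf₀
    exact ⟨f, h1, h2, by simpa [blockSize] using h3, by simpa [blockSize] using h4, by rw [h5]; simp⟩

theorem dvd_blockSize {k : ℕ} (hk : k = 2 ∨ k = 3) : k ∣ blockSize k := by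
  rcases hk with rfl | rfl <;> decide

theorem card_removePrivate {P : Finset V} (hP : P ⊆ S.W) :
    S.W.card = (removePrivate S P).W.card + P.card :=
  (Finset.card_sdiff_add_card_eq_card hP).symm

/-- The block lies in a single edge and sums to zero, so no edge label changes; all vertex counts
grow equally, so the profile stays the same. -/
theorem Profile.of_removePrivate {k : ℕ} (hk : k = 2 ∨ k = 3) {e : E} {P : Finset V}
    (hP : P ⊆ ch T S e) (hpriv : ∀ v ∈ P, hang T S v = ∅) (hc : P.card = blockSize k)
    {f₀ : V → ℕ} {t : ℕ} (h : Profile T k (removePrivate S P) f₀ t) : ∃ f, Profile T k S f t := by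
  obtain ⟨h0, h1, h2, h3, h4⟩ := h
  obtain ⟨f, g0, g1, g2, g3, g4⟩ := exists_block hk hc h0
  have hPW : P ⊆ S.W := hP.trans (ch_subset e)
  have hV : ∀ i, cntV i S f = cntV i (removePrivate S P) f₀ + ∑ v ∈ P, ind i (f v) := by
    intro i
    unfold cntV
    rw [← Finset.sum_sdiff hPW]
    congr 1
    exact Finset.sum_congr rfl fun v hv => by rw [g1 v (Finset.mem_sdiff.1 hv).2]
  have hlab : ∀ e' ∈ S.X, lab T k S f e' = lab T k (removePrivate S P) f₀ e' := by
    intro e' he'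
    unfold lab
    rw [g1 _ fun h => hang_eq_empty_iff.1 (hpriv _ h) e' he' rfl]
    have hch : ch T (removePrivate S P) e' = ch T S e' \ P := by
      ext v
      simp only [mem_ch, removePrivate, Finset.mem_sdiff]
      tauto
    have hsum : ∑ v ∈ ch T S e' \ P, f v = ∑ v ∈ ch T S e' \ P, f₀ v :=
      Finset.sum_congr rfl fun v hv => g1 v (Finset.mem_sdiff.1 hv).2
    rw [hch]
    by_cases he : e' = e
    · subst he
      rw [← Finset.sum_sdiff hP, hsum, ← add_assoc, ← Nat.add_mod_mod, Nat.mod_eq_zero_of_dvd g4,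
        add_zero]
    · rw [Finset.sdiff_eq_self_of_disjoint] at hsum ⊢
      · rw [hsum]
      all_goals
        rw [Finset.disjoint_left]
        intro v hv hvP
        have := (mem_ch.1 (hP hvP)).2
        rw [(mem_ch.1 hv).2] at this
        exact he (Option.some.inj this)
  have hE : ∀ i, cntE T k i S f = cntE T k i (removePrivate S P) f₀ := fun i =>
    Finset.sum_congr rfl fun e' he' => by rw [hlab e' he']
  have hdiv : S.W.card / k = (removePrivate S P).W.card / k + blockSize k / k := by
    rw [card_removePrivate hPW, hc, Nat.add_div_of_dvd_left (dvd_blockSize hk)]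
  refine ⟨f, g0, ?_, ?_, ?_, ?_⟩
  · rw [hV, h1, g2, hdiv]; omega
  · rw [hV, h2, g3, hdiv]; ring
  · rw [hE, h3]; rfl
  · rw [hE, h4]; rfl

theorem mod_removePrivate {k : ℕ} (hk : k = 2 ∨ k = 3) {P : Finset V} (hP : P ⊆ S.W)
    (hc : P.card = blockSize k) : S.W.card % k = (removePrivate S P).W.card % k := by
  rw [card_removePrivate hP, hc, ← Nat.add_mod_mod, Nat.mod_eq_zero_of_dvd (dvd_blockSize hk),
    add_zero]

theorem Achieves.of_removePrivate {k : ℕ} (hk : k = 2 ∨ k = 3) {e : E} {P : Finset V}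
    (hP : P ⊆ ch T S e) (hpriv : ∀ v ∈ P, hang T S v = ∅) (hc : P.card = blockSize k)
    (h : Achieves T k (removePrivate S P)) : Achieves T k S := by
  intro hX t ht
  rw [mod_removePrivate hk (hP.trans (ch_subset e)) hc] at ht
  obtain ⟨f₀, hf₀⟩ := h hX t ht
  exact hf₀.of_removePrivate hk hP hpriv hc

theorem Balanced.of_removePrivate {k : ℕ} (hk : k = 2 ∨ k = 3) {e : E} {P : Finset V}
    (hP : P ⊆ ch T S e) (hpriv : ∀ v ∈ P, hang T S v = ∅) (hc : P.card = blockSize k)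
    (h : Balanced T k (removePrivate S P)) : Balanced T k S := by
  obtain ⟨t, ht, b, hb, f₀, hf₀⟩ := h
  rw [← mod_removePrivate hk (hP.trans (ch_subset e)) hc] at ht
  exact ⟨t, ht, b, hb, hf₀.of_removePrivate hk hP hpriv hc⟩

end HypertreeCordial

namespace HypertreeCordial

set_option linter.unusedSectionVars false

variable {V E : Type*} [DecidableEq V] [DecidableEq E] {T : Rooting V E} {S S₀ S₁ : State V E}

/-! ### Structure of rooted hypertrees -/

/-- A counterexample of maximal depth is not a leaf, and any edge below it is deeper, hence
satisfies `Q`. The counterpart `root_induction` uses minimal depth. -/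
theorem leaf_induction {Q : E → Prop}
    (hleaf : ∀ t ∈ S.X, (∀ e ∈ S.X, T.up (T.par e) ≠ some t) → Q t)
    (hstep : ∀ e ∈ S.X, ∀ e' ∈ S.X, T.up (T.par e') = some e → Q e' → Q e) :
    ∀ e ∈ S.X, Q e := by
  classical
  by_contra! hne
  obtain ⟨e₀, he₀, hQ₀⟩ := hne
  obtain ⟨e, he, hmax⟩ := (S.X.filter fun e => ¬ Q e).exists_max_image T.depth
    ⟨e₀, Finset.mem_filter.2 ⟨he₀, hQ₀⟩⟩
  obtain ⟨heX, hQ⟩ := Finset.mem_filter.1 he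
  refine hQ (hleaf e heX fun e' he' hup => hQ (hstep e heX e' he' hup ?_))
  by_contra hQ'
  have := hmax e' (Finset.mem_filter.2 ⟨he', hQ'⟩)
  have := T.depth_eq e' e hup
  omega

theorem root_induction (hS : Closed T S) {Q : E → Prop}
    (hroot : ∀ e ∈ S.X, T.up (T.par e) = none → Q e)
    (hstep : ∀ e ∈ S.X, ∀ e' ∈ S.X, T.up (T.par e') = some e → Q e → Q e') :
    ∀ e ∈ S.X, Q e := by
  classical
  by_contra! hne
  obtain ⟨e₀, he₀, hQ₀⟩ := hne
  obtain ⟨e, he, hmin⟩ := (S.X.filter fun e => ¬ Q e).exists_min_image T.depth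
    ⟨e₀, Finset.mem_filter.2 ⟨he₀, hQ₀⟩⟩
  obtain ⟨heX, hQ⟩ := Finset.mem_filter.1 he
  rcases h : T.up (T.par e) with _ | e'
  · exact hQ (hroot e heX h)
  · have he' := hS.up_mem _ (hS.par_mem e heX) _ h
    refine hQ (hstep e' he' e heX h ?_)
    by_contra hQ'
    have := hmin e' (Finset.mem_filter.2 ⟨he', hQ'⟩)
    have := T.depth_eq e e' h
    omega

/-- `e` is `y` or an ancestor of `y`. -/
def Anc (T : Rooting V E) (y e : E) : Prop :=
  Relation.ReflTransGen (fun a b => T.up (T.par a) = some b) y e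

theorem Anc.depth_le {y e : E} (h : Anc T y e) : T.depth e ≤ T.depth y ∧
    (T.depth e = T.depth y → e = y) := by
  induction h with
  | refl => exact ⟨le_rfl, fun _ => rfl⟩
  | tail _ hbc ih =>
    have := T.depth_eq _ _ hbc
    exact ⟨by omega, fun h => by omega⟩

theorem depth_eq_of_par_eq {e e' : E} (h : T.par e = T.par e') : T.depth e = T.depth e' := by
  rcases hu : T.up (T.par e) with _ | x
  · rw [T.depth_root e hu, T.depth_root e' (h ▸ hu)]
  · rw [T.depth_eq e x hu, T.depth_eq e' x (h ▸ hu)]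

/-- Edges with the same parent vertex have the same depth, and the only edge of that depth among `y`
and its ancestors is `y`. -/
theorem hang_eq_of_chain {y : E} (hy : y ∈ S.X)
    (hQ : ∀ e ∈ S.X, T.up (T.par e) = some y ∨ Anc T y e) : hang T S (T.par y) = {y} := by
  ext e
  rw [mem_hang, Finset.mem_singleton]
  constructor
  · rintro ⟨he, hp⟩
    rcases hQ e he with h | h
    · rw [hp] at h; exact (T.up_par_ne y h).elim
    · exact h.depth_le.2 (depth_eq_of_par_eq hp)
  · rintro rfl; exact ⟨hy, rfl⟩

theorem inner_eq_of_chain (hS : Closed T S) {y x : E} (hy : y ∈ S.X)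
    (hQ : ∀ e ∈ S.X, T.up (T.par e) = some y ∨ T.par e = T.par y ∨ Anc T y e)
    (hx : T.up (T.par y) = some x) : inner T S x = {T.par y} := by
  ext c
  rw [mem_inner, Finset.mem_singleton]
  constructor
  · rintro ⟨hc, e, he, rfl⟩
    have hup := (mem_ch.1 hc).2
    rcases hQ e he with h | h | h
    · rw [hup] at h
      obtain rfl := Option.some.inj h
      exact (T.up_par_ne _ hx).elim
    · exact h
    · rw [h.depth_le.2 (by rw [T.depth_eq e x hup, T.depth_eq y x hx])]
  · rintro rfl
    exact ⟨mem_ch.2 ⟨hS.par_mem y hy, hx⟩, y, hy, rfl⟩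

/-- If all leaves lie just below `y` (or satisfy `R`), all other edges are ancestors of `y`. -/
theorem chain_of_leaves {y : E} {R : E → Prop}
    (hR : ∀ e e', R e' → T.up (T.par e') = some e → T.up (T.par y) = some e)
    (hleaf : ∀ t ∈ S.X, (∀ e ∈ S.X, T.up (T.par e) ≠ some t) → T.up (T.par t) = some y ∨ R t) :
    ∀ e ∈ S.X, T.up (T.par e) = some y ∨ R e ∨ Anc T y e := by
  refine leaf_induction (T := T) (fun t ht htl => (hleaf t ht htl).imp_right Or.inl) ?_
  intro e he e' he' hup hQ
  rcases hQ with h | h | h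
  · rw [hup] at h
    rw [Option.some.inj h]
    exact Or.inr (Or.inr Relation.ReflTransGen.refl)
  · exact Or.inr (Or.inr (Relation.ReflTransGen.single (hR e e' h hup)))
  · exact Or.inr (Or.inr (h.tail hup))

theorem mem_inner_of_up (hS : Closed T S) {y e : E} (he : e ∈ S.X) (h : T.up (T.par e) = some y) :
    T.par e ∈ inner T S y :=
  mem_inner.2 ⟨mem_ch.2 ⟨hS.par_mem e he, h⟩, e, he, rfl⟩

theorem up_of_mem_inner {y : E} {w : V} (h : w ∈ inner T S y) : T.up w = some y :=
  (mem_ch.1 (mem_inner.1 h).1).2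

theorem LeafAt.intro {z : E} (hz : z ∈ S.X) (h : ∀ e ∈ S.X, T.up (T.par e) ≠ some z) :
    LeafAt T S z (T.par z) (ch T S z).card := ⟨hz, rfl, h, rfl⟩

theorem LeafAt.up_ne {z z' : E} {w w' : V} {d d' : ℕ} (h : LeafAt T S z w d)
    (h' : LeafAt T S z' w' d') : T.up w ≠ some z' := by
  rw [← h.par]; exact h'.not_up z h.mem

theorem LeafAt.mem_W {z : E} {w : V} {d : ℕ} (h : LeafAt T S z w d) (hS : Closed T S) : w ∈ S.W := by
  rw [← h.par]; exact hS.par_mem z h.mem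

theorem LeafAt.ne_of_inner {z y : E} {w w' : V} {d : ℕ} (h : LeafAt T S z w d)
    (hw : w' ∈ inner T S y) : z ≠ y := by
  rintro rfl
  obtain ⟨h1, e, he, rfl⟩ := mem_inner.1 hw
  exact h.not_up e he (mem_ch.1 h1).2

/-! ### Irreducible states and the lowest level of edges -/

/-- A state all of whose reductions are already known to be labellable, and from which no block of
private vertices can be removed. -/
structure Irreducible (T : Rooting V E) (k : ℕ) (S : State V E) : Prop where
  hk : k = 2 ∨ k = 3
  closed : Closed T S
  achieves : ∀ S₀, Closed T S₀ → S₀.W.card + S₀.X.card < S.W.card + S.X.card → Achieves T k S₀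
  not_ssubset : ∀ e ∈ S.X, ∀ P ⊂ ch T S e, (∀ v ∈ P, hang T S v = ∅) → P.card ≠ blockSize k

theorem Irreducible.finish_known {k : ℕ} (c : Irreducible T k S) {Z : Finset E} {P : Finset V}
    {vs : List V} {es : List E} {ops : List Op} {known : List (ℕ × List ℕ)}
    (h : Built T (cut T S Z P) vs es ops S) (hvs : ∀ v ∈ vs, v ∈ (cut T S Z P).W)
    (hes : ∀ e ∈ es, e ∈ (cut T S Z P).X) (hen : es.Nodup)
    (hknown : ∀ f₀ : V → ℕ, (∀ v, f₀ v < k) →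
      consistent k vs.length known (vs.map f₀ ++ es.map (lab T k (cut T S Z P) f₀)) = true)
    (hc : check k ops vs.length es.length known = true) (hpos : 0 < (ops.map Op.newE).sum) :
    Achieves T k S := by
  refine h.achieves c.hk c.closed hvs hes hen hknown hc (c.achieves _ (h.closed c.closed) ?_)
  have := h.card
  omega

/-- The common end of the reductions. Only `flip` requires distinct vertex registers. Otherwise two
registers may name the same vertex, since `check` covers every combination of labels. -/
theorem Irreducible.finish {k : ℕ} (c : Irreducible T k S) {Z : Finset E} {P : Finset V}
    {vs : List V} {es : List E} {ops : List Op}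
    (h : Built T (cut T S Z P) vs es ops S) (hc : check k ops vs.length es.length [] = true)
    (hvs : ∀ v ∈ vs, v ∈ (cut T S Z P).W)
    (hes : ∀ e ∈ es, e ∈ (cut T S Z P).X) (hen : es.Nodup)
    (hpos : 0 < (ops.map Op.newE).sum) :
    Achieves T k S :=
  c.finish_known h hvs hes hen (fun _ _ => rfl) hc hpos

/-- A removable block must leave a child of the edge behind. A leaf can therefore still have
`blockSize k` children, whereas an edge with an inner child has fewer private ones than that
(`exists_private_card`). -/
theorem Irreducible.leaf_card {k : ℕ} (c : Irreducible T k S) {z : E} {w : V} {d : ℕ}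
    (h : LeafAt T S z w d) : 1 ≤ d ∧ d ≤ blockSize k := by
  rw [← h.card]
  refine ⟨Finset.card_pos.2 (c.closed.ch_nonempty z h.mem), ?_⟩
  by_contra! hlt
  obtain ⟨P, hP, hPc⟩ := Finset.exists_subset_card_eq hlt.le
  refine c.not_ssubset z h.mem P (hP.ssubset_of_ne ?_) (fun v hv => ?_) hPc
  · rintro rfl; omega
  · rw [hang_eq_empty_iff]
    rintro e he rfl
    exact h.not_up e he (mem_ch.1 (hP hv)).2

theorem Irreducible.exists_private_card {k : ℕ} (c : Irreducible T k S) {y : E} {w : V}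
    (hw : w ∈ inner T S y) :
    ∃ q, (ch T S y).card = (inner T S y).card + q ∧ q < blockSize k := by
  have hsub : inner T S y ⊆ ch T S y := Finset.filter_subset _ _
  have hcard := Finset.card_sdiff_add_card_eq_card hsub
  refine ⟨(ch T S y \ inner T S y).card, by omega, ?_⟩
  by_contra! hle
  obtain ⟨P, hP, hPc⟩ := Finset.exists_subset_card_eq hle
  refine c.not_ssubset y (c.closed.up_mem w (mem_ch.1 (hsub hw)).1 y (mem_ch.1 (hsub hw)).2) P
    ⟨hP.trans Finset.sdiff_subset, fun h => ?_⟩ (fun v hv => ?_) hPc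
  · exact (Finset.mem_sdiff.1 (hP (h (hsub hw)))).2 hw
  · obtain ⟨h1, h2⟩ := Finset.mem_sdiff.1 (hP hv)
    rw [hang_eq_empty_iff]
    rintro e he rfl
    exact h2 (mem_inner.2 ⟨h1, e, he, rfl⟩)

theorem Irreducible.leaf_mem_three (c : Irreducible T 3 S) {z : E} {w : V} {d : ℕ}
    (h : LeafAt T S z w d) : d ∈ [1, 2, 3] := by
  have := c.leaf_card h
  simp [blockSize] at this
  simp; omega

theorem Irreducible.leaf_mem_two (c : Irreducible T 2 S) {z : E} {w : V} {d : ℕ}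
    (h : LeafAt T S z w d) : d ∈ [1, 2, 3, 4] := by
  have := c.leaf_card h
  simp [blockSize] at this
  simp; omega

theorem mem_of_lt_three {q : ℕ} (h : q < blockSize 3) : q ∈ [0, 1, 2] := by
  simp [blockSize] at h; simp; omega

theorem mem_of_lt_two {q : ℕ} (h : q < blockSize 2) : q ∈ [0, 1, 2, 3] := by
  simp [blockSize] at h; simp; omega

/-- All edges below `y` are leaves. -/
def Bottom (T : Rooting V E) (S : State V E) (y : E) : Prop :=
  y ∈ S.X ∧ ∀ e ∈ S.X, T.up (T.par e) = some y → ∀ e' ∈ S.X, T.up (T.par e') ≠ some e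

/-- A deepest edge below another one determines a level of bottom edges. -/
theorem exists_bottom (hS : Closed T S) :
    (∀ e ∈ S.X, T.up (T.par e) = none) ∨ ∃ y ∈ S.X, (inner T S y).Nonempty ∧
      ∀ e ∈ S.X, T.depth y ≤ T.depth e → Bottom T S e := by
  by_cases h : ∀ e ∈ S.X, T.up (T.par e) = none
  · exact Or.inl h
  · push Not at h
    obtain ⟨e₁, he₁, h₁⟩ := h
    obtain ⟨y₁, hy₁⟩ := Option.ne_none_iff_exists'.1 h₁
    obtain ⟨z, hz, hmax⟩ := S.X.exists_max_image T.depth ⟨e₁, he₁⟩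
    have hd : T.depth z ≠ 0 := by
      have := hmax e₁ he₁
      have := T.depth_eq e₁ y₁ hy₁
      omega
    rcases hup : T.up (T.par z) with _ | y
    · exact (hd (T.depth_root z hup)).elim
    · refine Or.inr ⟨y, hS.up_mem _ (hS.par_mem z hz) y hup, ⟨_, mem_inner_of_up hS hz hup⟩,
        fun e he hle => ⟨he, fun e' he' h' e'' he'' h'' => ?_⟩⟩
      have := T.depth_eq _ _ hup
      have := T.depth_eq _ _ h'
      have := T.depth_eq _ _ h''
      have := hmax e'' he''
      omega

/-- The child `w` carries exactly one edge, a leaf with `d` children. -/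
def Single (T : Rooting V E) (S : State V E) (w : V) (z : E) (d : ℕ) : Prop :=
  hang T S w = {z} ∧ LeafAt T S z w d

/-- The child `w` carries exactly two edges, both leaves. -/
def Double (T : Rooting V E) (S : State V E) (w : V) (a b : E) (da db : ℕ) : Prop :=
  a ≠ b ∧ hang T S w = {a, b} ∧ LeafAt T S a w da ∧ LeafAt T S b w db

theorem Bottom.leaf {y e : E} {w : V} (h : Bottom T S y) (hw : w ∈ inner T S y)
    (he : e ∈ hang T S w) : LeafAt T S e w (ch T S e).card := by
  obtain ⟨h1, rfl⟩ := mem_hang.1 he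
  exact LeafAt.intro h1 (h.2 e h1 (up_of_mem_inner hw))

theorem Bottom.single {y : E} {w : V} (h : Bottom T S y) (hw : w ∈ inner T S y)
    (hc : (hang T S w).card = 1) : ∃ z d, Single T S w z d := by
  obtain ⟨z, hz⟩ := Finset.card_eq_one.1 hc
  exact ⟨z, _, hz, h.leaf hw (by simp [hz])⟩

theorem Bottom.double {y : E} {w : V} (h : Bottom T S y) (hw : w ∈ inner T S y)
    (hc : (hang T S w).card = 2) : ∃ a b da db, Double T S w a b da db := by
  obtain ⟨a, b, hne, hz⟩ := Finset.card_eq_two.1 hc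
  exact ⟨a, b, _, _, hne, hz, h.leaf hw (by simp [hz]), h.leaf hw (by simp [hz])⟩

theorem hang_card_pos {y : E} {w : V} (hw : w ∈ inner T S y) : 0 < (hang T S w).card :=
  Finset.card_pos.2 (Finset.mem_filter.1 hw).2

theorem Single.eq_of_par {w : V} {z e : E} {d : ℕ} (h : Single T S w z d) (he : e ∈ S.X)
    (hp : T.par e = w) : e = z := by
  have : e ∈ hang T S w := mem_hang.2 ⟨he, hp⟩
  rwa [h.1, Finset.mem_singleton] at this

theorem Double.eq_of_par {w : V} {a b e : E} {da db : ℕ} (h : Double T S w a b da db) (he : e ∈ S.X)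
    (hp : T.par e = w) : e = a ∨ e = b := by
  have : e ∈ hang T S w := mem_hang.2 ⟨he, hp⟩
  rwa [h.2.1, Finset.mem_insert, Finset.mem_singleton] at this

end HypertreeCordial

namespace HypertreeCordial

set_option linter.unusedSectionVars false

variable {V E : Type*} [DecidableEq V] [DecidableEq E] {T : Rooting V E} {S S₀ S₁ : State V E}

/-! ### Labels modulo 2 -/

theorem Irreducible.two_twoLeaves (c : Irreducible T 2 S) {a b : E} {w : V} {d e : ℕ} (hab : a ≠ b)
    (ha : LeafAt T S a w d) (hb : LeafAt T S b w e) : Achieves T 2 S := by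
  have h := ((Built.start [w] []).cutLeaf hb (by simp) (i := 0) rfl).cutLeaf ha (by simpa using hab) (i := 0) rfl
  refine c.finish h (check_two_twoLeaves d (c.leaf_mem_two ha) e (c.leaf_mem_two hb)) ?_ (by simp)
    (by simp) (by simp [Op.newE])
  simpa [mem_cut_W] using ⟨ha.mem_W c.closed, ha.up_ne ha, ha.up_ne hb⟩

theorem Irreducible.two_pair (c : Irreducible T 2 S) {y z : E} {w : V} {d : ℕ} (hy : y ∈ S.X)
    (hin : inner T S y = {w}) (hw : Single T S w z d) : Achieves T 2 S := by
  have hwi : w ∈ inner T S y := by simp [hin]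
  obtain ⟨q, hq, hq'⟩ := c.exists_private_card hwi
  rw [hin, Finset.card_singleton] at hq
  have h := ((Built.start [T.par y, w] []).cutLeaf hw.2 (by simp) (i := 1) rfl).cutInner (i := 0)
    (vs := [T.par y]) [w] hy (by simpa using (hw.2.ne_of_inner hwi).symm) rfl (by simp)
    (by simpa using (mem_inner.1 hwi).1)
    (fun e he hup => by
      have := mem_inner_of_up c.closed he hup
      rw [hin, Finset.mem_singleton] at this
      simpa using hw.eq_of_par he this) hq
  refine c.finish h (check_two_pair q (mem_of_lt_two hq') d (c.leaf_mem_two hw.2)) ?_ (by simp)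
    (by simp) (by simp [Op.newE])
  simpa [mem_cut_W] using ⟨c.closed.par_mem y hy, T.up_par_ne y, hw.2.not_up y hy⟩

/-- Here `y` stays, because its child `w` remains: the two leaves are cut, and then `p` and `r` are
detached from `y`. -/
theorem Irreducible.two_detachSingles (c : Irreducible T 2 S) {y a b : E} {p r w : V} {d e : ℕ}
    (hy : y ∈ S.X) (hp : p ∈ inner T S y) (hr : r ∈ inner T S y) (hpr : p ≠ r)
    (hpa : Single T S p a d) (hrb : Single T S r b e) (hw : w ∈ ch T S y) (hwp : w ≠ p)
    (hwr : w ≠ r) : Achieves T 2 S := by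
  have hab : a ≠ b := by
    rintro rfl; exact hpr (hpa.2.par.symm.trans hrb.2.par)
  have hya := hpa.2.ne_of_inner hp
  have hyb := hrb.2.ne_of_inner hr
  have h := ((((Built.start [p, r] [y]).cutLeaf hrb.2 (by simp) (i := 1) rfl).cutLeaf hpa.2
    (by simpa using hab) (i := 0) rfl).cutVert (vs := [p]) (j := 0) (mem_inner.1 hr).1
    (by simpa using ⟨hya.symm, hyb.symm⟩) (by simp) (fun e he hep => by
      simpa using Or.inr (hrb.eq_of_par he hep)) hw hwr (by simp) rfl).cutVert (vs := []) (j := 0)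
    (mem_inner.1 hp).1 (by simpa using ⟨hya.symm, hyb.symm⟩) (by simpa using hpr) (fun e he hep => by
      simpa using Or.inl (hpa.eq_of_par he hep)) hw hwp (by simpa using hwr) rfl
  refine c.finish h (check_two_detachSingles d (c.leaf_mem_two hpa.2) e (c.leaf_mem_two hrb.2))
    (by simp) ?_ (by simp) (by simp [Op.newE])
  simpa [mem_cut_X] using ⟨hy, hya.symm, hyb.symm⟩

theorem child_edge_of_inner (hS : Closed T S) {y e : E} {p r : V} (hin : inner T S y = {p, r})
    (he : e ∈ S.X) (hup : T.up (T.par e) = some y) : T.par e = p ∨ T.par e = r := by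
  have := mem_inner_of_up hS he hup
  rwa [hin, Finset.mem_insert, Finset.mem_singleton] at this

theorem LeafAt.up_ne_of_inner (hS : Closed T S) {y t : E} {s p r : V} {f : ℕ}
    (ht : LeafAt T S t s f) (hin : inner T S y = {p, r}) (hsp : s ≠ p) (hsr : s ≠ r) :
    T.up s ≠ some y := fun h => by
  rcases child_edge_of_inner hS hin ht.mem (ht.par ▸ h) with h | h
  · exact hsp (ht.par.symm.trans h)
  · exact hsr (ht.par.symm.trans h)

/-- The edge `y` and the two leaves below it are three edges; a further leaf `t`, wherever it is,
makes the number even. In `two_twoSinglesChain` the edge above `y` plays this role. -/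
theorem Irreducible.two_twoSinglesLeaf (c : Irreducible T 2 S) {y a b t : E} {p r s : V}
    {d e f : ℕ} (hy : y ∈ S.X) (hin : inner T S y = {p, r}) (hcard : (ch T S y).card = 2)
    (hpr : p ≠ r) (hpa : Single T S p a d) (hrb : Single T S r b e) (ht : LeafAt T S t s f)
    (hta : t ≠ a) (htb : t ≠ b) : Achieves T 2 S := by
  have hab : a ≠ b := by
    rintro rfl; exact hpr (hpa.2.par.symm.trans hrb.2.par)
  have hp : p ∈ inner T S y := by simp [hin]
  have hr : r ∈ inner T S y := by simp [hin]
  have hya := hpa.2.ne_of_inner hp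
  have hyb := hrb.2.ne_of_inner hr
  have hyt := ht.ne_of_inner hr
  have hsy : T.up s ≠ some y := ht.up_ne_of_inner c.closed hin
    (by rintro rfl; exact hta (hpa.eq_of_par ht.mem ht.par))
    (by rintro rfl; exact htb (hrb.eq_of_par ht.mem ht.par))
  have h := (((Built.start [T.par y, s, p, r] []).cutLeaf ht (by simp) (i := 1) rfl).cutLeaf hrb.2
    (by simpa using htb.symm) (i := 3) rfl).cutLeaf hpa.2 (by simpa using ⟨hab, hta.symm⟩) (i := 2) rfl
  have h := Built.cutInner (i := 0) (q := 0) (vs := [T.par y, s]) [p, r] h hy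
    (by simpa using ⟨hya.symm, hyb.symm, hyt.symm⟩) rfl (by simpa using hpr)
    (by simpa using ⟨(mem_inner.1 hp).1, (mem_inner.1 hr).1⟩)
    (fun e he hup => by
      rcases child_edge_of_inner c.closed hin he hup with h | h
      · simpa using Or.inl (hpa.eq_of_par he h)
      · simpa using Or.inr (Or.inl (hrb.eq_of_par he h))) hcard
  refine c.finish h (check_two_twoSinglesLeaf d (c.leaf_mem_two hpa.2) e (c.leaf_mem_two hrb.2) f
    (c.leaf_mem_two ht)) ?_ (by simp) (by simp) (by simp [Op.newE])
  simpa [mem_cut_W] using ⟨⟨c.closed.par_mem y hy, T.up_par_ne y, hpa.2.not_up y hy,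
    hrb.2.not_up y hy, ht.not_up y hy⟩, ht.mem_W c.closed, hsy, ht.up_ne hpa.2, ht.up_ne hrb.2,
    ht.up_ne ht⟩

theorem Irreducible.two_twoSinglesChain (c : Irreducible T 2 S) {y x a b : E} {p r : V}
    {d e : ℕ} (hy : y ∈ S.X) (hin : inner T S y = {p, r}) (hcard : (ch T S y).card = 2)
    (hpr : p ≠ r) (hpa : Single T S p a d) (hrb : Single T S r b e) (hx : x ∈ S.X)
    (hinx : inner T S x = {T.par y}) (hu : hang T S (T.par y) = {y}) : Achieves T 2 S := by
  have hab : a ≠ b := by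
    rintro rfl; exact hpr (hpa.2.par.symm.trans hrb.2.par)
  have hp : p ∈ inner T S y := by simp [hin]
  have hr : r ∈ inner T S y := by simp [hin]
  have hyx : T.par y ∈ inner T S x := by simp [hinx]
  have hya := hpa.2.ne_of_inner hp
  have hyb := hrb.2.ne_of_inner hr
  have hxa := hpa.2.ne_of_inner hyx
  have hxb := hrb.2.ne_of_inner hyx
  have hup := up_of_mem_inner hyx
  have hxy : y ≠ x := by rintro rfl; exact T.up_par_ne _ hup
  obtain ⟨q, hq, hq'⟩ := c.exists_private_card hyx
  rw [hinx, Finset.card_singleton] at hq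
  have h := ((Built.start [T.par x, T.par y, p, r] []).cutLeaf hrb.2
    (by simp) (i := 3) rfl).cutLeaf hpa.2 (by simpa using hab) (i := 2) rfl
  have h := Built.cutInner (i := 1) (q := 0) (vs := [T.par x, T.par y]) [p, r] h hy
    (by simpa using ⟨hya.symm, hyb.symm⟩) rfl (by simpa using hpr)
    (by simpa using ⟨(mem_inner.1 hp).1, (mem_inner.1 hr).1⟩)
    (fun e he hup => by
      rcases child_edge_of_inner c.closed hin he hup with h | h
      · simpa using Or.inl (hpa.eq_of_par he h)
      · simpa using Or.inr (hrb.eq_of_par he h)) hcard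
  have h := Built.cutInner (i := 0) (q := q) (vs := [T.par x]) [T.par y] h hx
    (by simpa using ⟨hxy.symm, hxa.symm, hxb.symm⟩) rfl (by simp)
    (by simpa using (mem_inner.1 hyx).1)
    (fun e he hup => by
      have := mem_inner_of_up c.closed he hup
      rw [hinx, Finset.mem_singleton] at this
      have : e ∈ hang T S (T.par y) := mem_hang.2 ⟨he, this⟩
      rw [hu, Finset.mem_singleton] at this
      simp [this]) hq
  refine c.finish h (check_two_twoSinglesChain d (c.leaf_mem_two hpa.2) e (c.leaf_mem_two hrb.2) q
    (mem_of_lt_two hq')) ?_ (by simp) (by simp) (by simp [Op.newE])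
  have hdy := T.depth_eq _ _ hup
  simpa [mem_cut_W] using ⟨c.closed.par_mem x hx, T.up_par_ne x, fun h' => by
      have := T.depth_eq _ _ h'
      omega,
    hpa.2.not_up x hx, hrb.2.not_up x hx⟩

/-- Two leaves at one vertex reduce at once, so each inner child of a lowest `y` carries a single
leaf. One inner child gives a pair. With two of them and any third child of `y`, both are detached;
with no third child, a leaf elsewhere or the edge above `y` is needed. -/
theorem Irreducible.achieves_two (c : Irreducible T 2 S) (hne : S.X.Nonempty) : Achieves T 2 S := by
  intro hdvd
  suffices Achieves T 2 S from this hdvd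
  have hcard : 2 ≤ S.X.card := by
    have := Finset.card_pos.2 hne
    omega
  rcases exists_bottom c.closed with hroot | ⟨y, hy, ⟨w, hw⟩, hbot⟩
  · obtain ⟨a, ha, b, hb, hab⟩ := Finset.one_lt_card.1 hcard
    have hpar : ∀ e ∈ S.X, T.par e = T.root := fun e he => (T.up_eq_none _).1 (hroot e he)
    have hl : ∀ z ∈ S.X, LeafAt T S z T.root (ch T S z).card := fun z hz => by
      rw [← hpar z hz]
      exact LeafAt.intro hz fun e he h => by rw [hroot e he] at h; cases h
    exact c.two_twoLeaves hab (hl a ha) (hl b hb)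
  · have hyb := hbot y hy le_rfl
    by_cases htwo : ∃ w ∈ inner T S y, 1 < (hang T S w).card
    · obtain ⟨w, hw, h⟩ := htwo
      obtain ⟨a, ha, b, hb, hab⟩ := Finset.one_lt_card.1 h
      exact c.two_twoLeaves hab (hyb.leaf hw ha) (hyb.leaf hw hb)
    push Not at htwo
    have hsingle : ∀ w ∈ inner T S y, ∃ z d, Single T S w z d := fun w hw =>
      hyb.single hw (le_antisymm (htwo w hw) (hang_card_pos hw))
    obtain ⟨a, d, hwa⟩ := hsingle w hw
    by_cases hone : ∃ r ∈ inner T S y, r ≠ w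
    · obtain ⟨r, hr, hrw⟩ := hone
      obtain ⟨b, e, hrb⟩ := hsingle r hr
      by_cases hthird : ∃ v ∈ ch T S y, v ≠ w ∧ v ≠ r
      · obtain ⟨v, hv, hvw, hvr⟩ := hthird
        exact c.two_detachSingles hy hw hr hrw.symm hwa hrb hv hvw hvr
      · push Not at hthird
        have hch : ch T S y = {w, r} := by
          ext v
          rw [Finset.mem_insert, Finset.mem_singleton]
          constructor
          · intro hv
            by_contra! h
            exact h.2 (hthird v hv h.1)
          · rintro (rfl | rfl)
            exacts [(mem_inner.1 hw).1, (mem_inner.1 hr).1]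
        have hin : inner T S y = {w, r} := by
          refine Finset.Subset.antisymm (fun v hv => hch ▸ (mem_inner.1 hv).1) ?_
          intro v hv
          rw [Finset.mem_insert, Finset.mem_singleton] at hv
          rcases hv with rfl | rfl
          exacts [hw, hr]
        have hc2 : (ch T S y).card = 2 := by rw [hch, Finset.card_pair hrw.symm]
        by_cases hleaf : ∃ t ∈ S.X, (∀ e ∈ S.X, T.up (T.par e) ≠ some t) ∧ t ≠ a ∧ t ≠ b
        · obtain ⟨t, ht, htl, hta, htb⟩ := hleaf
          exact c.two_twoSinglesLeaf hy hin hc2 hrw.symm hwa hrb (LeafAt.intro ht htl) hta htb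
        · push Not at hleaf
          have hQ : ∀ e ∈ S.X, T.up (T.par e) = some y ∨ Anc T y e := by
            have := chain_of_leaves (T := T) (S := S) (y := y) (R := fun _ => False)
              (fun _ _ h => h.elim) fun t ht htl => Or.inl <| by
                by_cases hta : t = a
                · rw [hta, hwa.2.par]; exact up_of_mem_inner hw
                · rw [hleaf t ht htl hta, hrb.2.par]; exact up_of_mem_inner hr
            simpa using this
          have hhang := hang_eq_of_chain hy hQ
          rcases hux : T.up (T.par y) with _ | x
          -- With no edge above `y`, the whole tree has three edges, contrary to parity.
          · exfalso
            have hX : S.X = {y, a, b} := by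
              ext e
              simp only [Finset.mem_insert, Finset.mem_singleton]
              constructor
              · intro he
                rcases hQ e he with h | h
                · rcases child_edge_of_inner c.closed hin he h with h | h
                  · exact Or.inr (Or.inl (hwa.eq_of_par he h))
                  · exact Or.inr (Or.inr (hrb.eq_of_par he h))
                · rcases Relation.ReflTransGen.cases_head h with h | ⟨e', h, -⟩
                  · exact Or.inl h.symm
                  · rw [hux] at h; cases h
              · rintro (rfl | rfl | rfl)
                exacts [hy, hwa.2.mem, hrb.2.mem]
            have hab : a ≠ b := by
              rintro rfl; exact hrw (hrb.2.par.symm.trans hwa.2.par)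
            rw [hX, Finset.card_insert_of_notMem, Finset.card_pair hab] at hdvd
            · omega
            · simpa using ⟨(hwa.2.ne_of_inner hw).symm, (hrb.2.ne_of_inner hr).symm⟩
          · exact c.two_twoSinglesChain hy hin hc2 hrw.symm hwa hrb
              (c.closed.up_mem _ (c.closed.par_mem y hy) x hux)
              (inner_eq_of_chain c.closed hy (fun e he => (hQ e he).imp_right Or.inr) hux) hhang
    · push Not at hone
      have hin : inner T S y = {w} := Finset.eq_singleton_iff_unique_mem.2 ⟨hw, hone⟩
      exact c.two_pair hy hin hwa

end HypertreeCordial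

namespace HypertreeCordial

set_option linter.unusedSectionVars false

variable {V E : Type*} [DecidableEq V] [DecidableEq E] {T : Rooting V E} {S S₀ S₁ : State V E}

/-! ### Configurations modulo 3 -/

theorem LeafAt.ne {a b : E} {w w' : V} {d d' : ℕ} (ha : LeafAt T S a w d) (hb : LeafAt T S b w' d')
    (h : w ≠ w') : a ≠ b := by
  rintro rfl; exact h (ha.par.symm.trans hb.par)

theorem child_edge_of_inner_singleton (hS : Closed T S) {y e : E} {w : V} (hin : inner T S y = {w})
    (he : e ∈ S.X) (hup : T.up (T.par e) = some y) : T.par e = w := by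
  have := mem_inner_of_up hS he hup
  rwa [hin, Finset.mem_singleton] at this

theorem Irreducible.threeLeaves (c : Irreducible T 3 S) {a b t : E} {w : V} {d e f : ℕ}
    (hab : a ≠ b) (hat : a ≠ t) (hbt : b ≠ t)
    (ha : LeafAt T S a w d) (hb : LeafAt T S b w e) (ht : LeafAt T S t w f) : Achieves T 3 S := by
  have h := (((Built.start [w] []).cutLeaf ht (i := 0) (by grind) rfl).cutLeaf hb (i := 0)
    (by grind) rfl).cutLeaf ha (i := 0) (by grind) rfl
  refine c.finish h (check_threeLeaves d (c.leaf_mem_three ha) e (c.leaf_mem_three hb) f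
    (c.leaf_mem_three ht)) ?_ (by simp) (by simp) (by simp [Op.newE])
  simpa [mem_cut_W] using ⟨ha.mem_W c.closed, ha.up_ne ha, ha.up_ne hb, ha.up_ne ht⟩

theorem Irreducible.cherry (c : Irreducible T 3 S) {y a b : E} {w : V} {d e : ℕ} (hy : y ∈ S.X)
    (hin : inner T S y = {w}) (hw : Double T S w a b d e) : Achieves T 3 S := by
  have hwi : w ∈ inner T S y := by simp [hin]
  obtain ⟨q, hq, hq'⟩ := c.exists_private_card hwi
  rw [hin, Finset.card_singleton] at hq
  obtain ⟨hab, -, ha, hb⟩ := id hw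
  have hay := ha.ne_of_inner hwi
  have hby := hb.ne_of_inner hwi
  have h := (((Built.start [T.par y, w] []).cutLeaf hb (i := 1) (by grind) rfl).cutLeaf ha (i := 1)
    (by grind) rfl).cutInner (i := 0) (vs := [T.par y]) [w] hy (by grind) rfl (by simp)
    (by simpa using (mem_inner.1 hwi).1)
    (fun e he hup => by
      have := hw.eq_of_par he (child_edge_of_inner_singleton c.closed hin he hup)
      grind) hq
  refine c.finish h (check_cherry q (mem_of_lt_three hq') d (c.leaf_mem_three ha) e
    (c.leaf_mem_three hb)) ?_ (by simp) (by simp) (by simp [Op.newE])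
  simpa [mem_cut_W] using ⟨c.closed.par_mem y hy, T.up_par_ne y, ha.not_up y hy, hb.not_up y hy⟩

theorem Irreducible.twoSingles (c : Irreducible T 3 S) {y a b : E} {p r : V} {d e : ℕ}
    (hy : y ∈ S.X) (hin : inner T S y = {p, r}) (hpr : p ≠ r) (hpa : Single T S p a d)
    (hrb : Single T S r b e) : Achieves T 3 S := by
  have hp : p ∈ inner T S y := by simp [hin]
  have hr : r ∈ inner T S y := by simp [hin]
  obtain ⟨q, hq, hq'⟩ := c.exists_private_card hp
  rw [hin, Finset.card_pair hpr] at hq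
  have hab := hpa.2.ne hrb.2 hpr
  have hay := hpa.2.ne_of_inner hp
  have hby := hrb.2.ne_of_inner hr
  have h := (((Built.start [T.par y, p, r] []).cutLeaf hrb.2 (i := 2) (by grind) rfl).cutLeaf hpa.2
    (i := 1) (by grind) rfl).cutInner (i := 0) (vs := [T.par y]) [p, r] hy (by grind) rfl
    (by simpa using hpr) (by simpa using ⟨(mem_inner.1 hp).1, (mem_inner.1 hr).1⟩)
    (fun e he hup => by
      rcases child_edge_of_inner c.closed hin he hup with h | h
      · have := hpa.eq_of_par he h; grind
      · have := hrb.eq_of_par he h; grind) hq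
  refine c.finish h (check_twoSingles q (mem_of_lt_three hq') d (c.leaf_mem_three hpa.2) e
    (c.leaf_mem_three hrb.2)) ?_ (by simp) (by simp) (by simp [Op.newE])
  simpa [mem_cut_W] using ⟨c.closed.par_mem y hy, T.up_par_ne y, hpa.2.not_up y hy,
    hrb.2.not_up y hy⟩

/-- There may be many further children, so `y` stays. After the leaves are cut, `s` lies on `y`
alone and can be relabelled; `p` and `r` are detached. -/
theorem Irreducible.threeSingles (c : Irreducible T 3 S) {y a b t : E} {s p r : V} {d e f : ℕ}
    (hy : y ∈ S.X) (hs : s ∈ inner T S y) (hp : p ∈ inner T S y) (hr : r ∈ inner T S y)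
    (hsp : s ≠ p) (hsr : s ≠ r) (hpr : p ≠ r) (hsa : Single T S s a d) (hpb : Single T S p b e)
    (hrt : Single T S r t f) : Achieves T 3 S := by
  have hab := hsa.2.ne hpb.2 hsp
  have hat := hsa.2.ne hrt.2 hsr
  have hbt := hpb.2.ne hrt.2 hpr
  have hay := hsa.2.ne_of_inner hs
  have hby := hpb.2.ne_of_inner hp
  have hty := hrt.2.ne_of_inner hr
  have hup := up_of_mem_inner hs
  have h := (((Built.start [s, p, r] [y]).cutLeaf hrt.2 (i := 2) (by grind) rfl).cutLeaf hpb.2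
    (i := 1) (by grind) rfl).cutLeaf hsa.2 (i := 0) (by grind) rfl
  have h := h.cutFlip (v := s) (i := 0) (js := [0]) (by grind) rfl (by simp) (by simp)
    (fun e he heZ => by
      have : T.par e ≠ s := fun hh => heZ (by have := hsa.eq_of_par he hh; grind)
      simp [this, hup])
  have h := h.cutVert (vs := [s, p]) (j := 0) (mem_inner.1 hr).1 (by grind) (by simp)
    (fun e he hep => by have := hrt.eq_of_par he hep; grind) (mem_inner.1 hs).1 hsr (by simp) rfl
  have h := h.cutVert (vs := [s]) (j := 0) (mem_inner.1 hp).1 (by grind) (by grind)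
    (fun e he hep => by have := hpb.eq_of_par he hep; grind) (mem_inner.1 hs).1 hsp (by grind) rfl
  refine c.finish h (check_threeSingles d (c.leaf_mem_three hsa.2) e (c.leaf_mem_three hpb.2) f
    (c.leaf_mem_three hrt.2)) ?_ ?_ (by simp) (by simp [Op.newE])
  · simpa [mem_cut_W] using ⟨hsa.2.mem_W c.closed,
      ⟨hsa.2.up_ne hsa.2, hsa.2.up_ne hpb.2, hsa.2.up_ne hrt.2⟩, hsp, hsr⟩
  · simpa [mem_cut_X] using ⟨hy, hay.symm, hby.symm, hty.symm⟩

/-- Three leaves of size 1 are the exception. They are handled by `detachDoubleSingle` if `y` has a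
third child; otherwise they form a `Mixed` configuration. -/
theorem Irreducible.doubleSingle (c : Irreducible T 3 S) {y a b t : E} {p r : V} {d e f : ℕ}
    (hy : y ∈ S.X) (hp : p ∈ inner T S y) (hr : r ∈ inner T S y) (hpr : p ≠ r)
    (hpab : Double T S p a b d e) (hrt : Single T S r t f) (hone : d = 1 → e = 1 → f ≠ 1) :
    Achieves T 3 S := by
  obtain ⟨hab, -, ha, hb⟩ := id hpab
  have hat := ha.ne hrt.2 hpr
  have hbt := hb.ne hrt.2 hpr
  have hay := ha.ne_of_inner hp
  have hby := hb.ne_of_inner hp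
  have hty := hrt.2.ne_of_inner hr
  have hup := up_of_mem_inner hp
  have h := (((Built.start [p, r] [y]).cutLeaf hrt.2 (i := 1) (by grind) rfl).cutLeaf hb
    (i := 0) (by grind) rfl).cutLeaf ha (i := 0) (by grind) rfl
  have h := h.cutFlip (v := p) (i := 0) (js := [0]) (by grind) rfl (by simp) (by simp)
    (fun e he heZ => by
      have : T.par e ≠ p := fun hh => heZ (by have := hpab.eq_of_par he hh; grind)
      simp [this, hup])
  have h := h.cutVert (vs := [p]) (j := 0) (mem_inner.1 hr).1 (by grind) (by simp)
    (fun e he hep => by have := hrt.eq_of_par he hep; grind) (mem_inner.1 hp).1 hpr (by simp) rfl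
  refine c.finish h (check_doubleSingle d (c.leaf_mem_three ha) e (c.leaf_mem_three hb) f
    (c.leaf_mem_three hrt.2) hone) ?_ ?_ (by simp) (by simp [Op.newE])
  · simpa [mem_cut_W] using ⟨ha.mem_W c.closed,
      ⟨ha.up_ne ha, ha.up_ne hb, ha.up_ne hrt.2⟩, hpr⟩
  · simpa [mem_cut_X] using ⟨hy, hay.symm, hby.symm, hty.symm⟩

theorem Irreducible.detachDoubleSingle (c : Irreducible T 3 S) {y a b t : E} {p r w : V}
    (hy : y ∈ S.X) (hp : p ∈ inner T S y) (hr : r ∈ inner T S y) (hpr : p ≠ r)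
    (hpab : Double T S p a b 1 1) (hrt : Single T S r t 1) (hw : w ∈ ch T S y) (hwp : w ≠ p)
    (hwr : w ≠ r) : Achieves T 3 S := by
  obtain ⟨hab, -, ha, hb⟩ := id hpab
  have hat := ha.ne hrt.2 hpr
  have hbt := hb.ne hrt.2 hpr
  have hay := ha.ne_of_inner hp
  have hby := hb.ne_of_inner hp
  have hty := hrt.2.ne_of_inner hr
  have h := (((Built.start [p, r] [y]).cutLeaf hrt.2 (i := 1) (by grind) rfl).cutLeaf hb
    (i := 0) (by grind) rfl).cutLeaf ha (i := 0) (by grind) rfl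
  have h := h.cutVert (vs := [p]) (j := 0) (mem_inner.1 hr).1 (by grind) (by simp)
    (fun e he hep => by have := hrt.eq_of_par he hep; grind) hw hwr (by simp) rfl
  have h := h.cutVert (vs := []) (j := 0) (mem_inner.1 hp).1 (by grind) (by grind)
    (fun e he hep => by have := hpab.eq_of_par he hep; grind) hw hwp (by grind) rfl
  refine c.finish h check_detachDoubleSingle (by simp) ?_ (by simp) (by simp [Op.newE])
  simpa [mem_cut_X] using ⟨hy, hay.symm, hby.symm, hty.symm⟩

theorem Irreducible.detachDouble (c : Irreducible T 3 S) {y a b t : E} {p r : V} {d e f : ℕ}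
    (hy : y ∈ S.X) (hp : p ∈ inner T S y) (hr : r ∈ inner T S y) (hpr : p ≠ r)
    (hpab : Double T S p a b d e) (ht : LeafAt T S t r f) (hone : d = 1 → e ≠ 1) :
    Achieves T 3 S := by
  obtain ⟨hab, -, ha, hb⟩ := id hpab
  have hat := ha.ne ht hpr
  have hbt := hb.ne ht hpr
  have hay := ha.ne_of_inner hp
  have hby := hb.ne_of_inner hp
  have hty := ht.ne_of_inner hr
  have h := (((Built.start [r, p] [y]).cutLeaf ht (i := 0) (by grind) rfl).cutLeaf hb
    (i := 1) (by grind) rfl).cutLeaf ha (i := 1) (by grind) rfl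
  have h := h.cutVert (vs := [r]) (j := 0) (mem_inner.1 hp).1 (by grind) (by simp)
    (fun e he hep => by have := hpab.eq_of_par he hep; grind) (mem_inner.1 hr).1 hpr.symm (by simp)
    rfl
  refine c.finish h (check_detachDouble d (c.leaf_mem_three ha) e (c.leaf_mem_three hb) f
    (c.leaf_mem_three ht) hone) ?_ ?_ (by simp) (by simp [Op.newE])
  · simpa [mem_cut_W] using ⟨ht.mem_W c.closed,
      ⟨ht.up_ne ha, ht.up_ne hb, ht.up_ne ht⟩, hpr.symm⟩
  · simpa [mem_cut_X] using ⟨hy, hay.symm, hby.symm, hty.symm⟩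

theorem Irreducible.detachTwoDoubles (c : Irreducible T 3 S) {y a₁ a₂ b₁ b₂ t₁ t₂ : E} {s p r : V}
    (hy : y ∈ S.X) (hs : s ∈ inner T S y) (hp : p ∈ inner T S y) (hr : r ∈ inner T S y)
    (hsp : s ≠ p) (hsr : s ≠ r) (hpr : p ≠ r) (hsa : Double T S s a₁ a₂ 1 1)
    (hpb : Double T S p b₁ b₂ 1 1) (hrt : Double T S r t₁ t₂ 1 1) : Achieves T 3 S := by
  obtain ⟨ha, -, ha₁, ha₂⟩ := id hsa
  obtain ⟨hb, -, hb₁, hb₂⟩ := id hpb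
  obtain ⟨ht, -, ht₁, ht₂⟩ := id hrt
  have h11 := ha₁.ne hb₁ hsp
  have h12 := ha₁.ne hb₂ hsp
  have h21 := ha₂.ne hb₁ hsp
  have h22 := ha₂.ne hb₂ hsp
  have k11 := ha₁.ne ht₁ hsr
  have k12 := ha₁.ne ht₂ hsr
  have k21 := ha₂.ne ht₁ hsr
  have k22 := ha₂.ne ht₂ hsr
  have l11 := hb₁.ne ht₁ hpr
  have l12 := hb₁.ne ht₂ hpr
  have l21 := hb₂.ne ht₁ hpr
  have l22 := hb₂.ne ht₂ hpr
  have hya₁ := (ha₁.ne_of_inner hs).symm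
  have hya₂ := (ha₂.ne_of_inner hs).symm
  have hyb₁ := (hb₁.ne_of_inner hp).symm
  have hyb₂ := (hb₂.ne_of_inner hp).symm
  have hyt₁ := (ht₁.ne_of_inner hr).symm
  have hyt₂ := (ht₂.ne_of_inner hr).symm
  have h := (((Built.start [s, p, r] [y]).cutLeaf ha₂ (i := 0) (by grind) rfl).cutLeaf ha₁
    (i := 0) (by grind) rfl)
  have h := (h.cutLeaf ht₂ (i := 2) (by grind) rfl).cutLeaf ht₁ (i := 2) (by grind) rfl
  have h := (h.cutLeaf hb₂ (i := 1) (by grind) rfl).cutLeaf hb₁ (i := 1) (by grind) rfl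
  have h := h.cutVert (vs := [s, p]) (j := 0) (mem_inner.1 hr).1 (by grind) (by simp)
    (fun e he hep => by have := hrt.eq_of_par he hep; grind) (mem_inner.1 hs).1 hsr (by simp) rfl
  have h := h.cutVert (vs := [s]) (j := 0) (mem_inner.1 hp).1 (by grind) (by grind)
    (fun e he hep => by have := hpb.eq_of_par he hep; grind) (mem_inner.1 hs).1 hsp (by grind) rfl
  refine c.finish h check_detachTwoDoubles ?_ ?_ (by simp) (by simp [Op.newE])
  · simpa [mem_cut_W] using ⟨ha₁.mem_W c.closed,
      ⟨ha₁.up_ne hb₁, ha₁.up_ne hb₂, ha₁.up_ne ht₁, ha₁.up_ne ht₂, ha₁.up_ne ha₁, ha₁.up_ne ha₂⟩,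
        hsp, hsr⟩
  · simpa [mem_cut_X] using ⟨hy, hyb₁, hyb₂, hyt₁, hyt₂, hya₁, hya₂⟩

end HypertreeCordial

/-! ### Two doubles, mixed configurations and pairs modulo 3 -/

namespace HypertreeCordial

set_option linter.unusedSectionVars false

variable {V E : Type*} [DecidableEq V] [DecidableEq E] {T : Rooting V E} {S S₀ S₁ : State V E}

/-- Five edges at `y` together with one further leaf make six. If there is no further leaf,
`twoDoublesChain` takes the edge above `y` instead. -/
theorem Irreducible.twoDoublesLeaf (c : Irreducible T 3 S) {y a₁ a₂ b₁ b₂ t : E} {p r s : V} {d : ℕ}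
    (hy : y ∈ S.X) (hin : inner T S y = {p, r}) (hpr : p ≠ r) (hpa : Double T S p a₁ a₂ 1 1)
    (hrb : Double T S r b₁ b₂ 1 1) (ht : LeafAt T S t s d) (hsp : s ≠ p) (hsr : s ≠ r) :
    Achieves T 3 S := by
  obtain ⟨ha, -, ha₁, ha₂⟩ := id hpa
  obtain ⟨hb, -, hb₁, hb₂⟩ := id hrb
  have hp : p ∈ inner T S y := by simp [hin]
  have hr : r ∈ inner T S y := by simp [hin]
  obtain ⟨q, hq, hq'⟩ := c.exists_private_card hp
  rw [hin, Finset.card_pair hpr] at hq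
  have h11 := ha₁.ne hb₁ hpr
  have h12 := ha₁.ne hb₂ hpr
  have h21 := ha₂.ne hb₁ hpr
  have h22 := ha₂.ne hb₂ hpr
  have k1 := ht.ne ha₁ hsp
  have k2 := ht.ne ha₂ hsp
  have k3 := ht.ne hb₁ hsr
  have k4 := ht.ne hb₂ hsr
  have hya₁ := (ha₁.ne_of_inner hp).symm
  have hya₂ := (ha₂.ne_of_inner hp).symm
  have hyb₁ := (hb₁.ne_of_inner hr).symm
  have hyb₂ := (hb₂.ne_of_inner hr).symm
  have hyt := (ht.ne_of_inner hr).symm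
  have h := (Built.start [T.par y, s, p, r] []).cutLeaf ht (i := 1) (by grind) rfl
  have h := (h.cutLeaf hb₂ (i := 3) (by grind) rfl).cutLeaf hb₁ (i := 3) (by grind) rfl
  have h := (h.cutLeaf ha₂ (i := 2) (by grind) rfl).cutLeaf ha₁ (i := 2) (by grind) rfl
  have h := h.cutInner (i := 0) (vs := [T.par y, s]) [p, r] hy (by grind) rfl
    (by simpa using hpr) (by simpa using ⟨(mem_inner.1 hp).1, (mem_inner.1 hr).1⟩)
    (fun e he hup => by
      rcases child_edge_of_inner c.closed hin he hup with h | h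
      · have := hpa.eq_of_par he h; grind
      · have := hrb.eq_of_par he h; grind) hq
  refine c.finish h (check_twoDoublesLeaf q (mem_of_lt_three hq') d (c.leaf_mem_three ht)) ?_
    (by simp) (by simp) (by simp [Op.newE])
  simpa [mem_cut_W] using ⟨⟨c.closed.par_mem y hy, T.up_par_ne y, ha₁.not_up y hy, ha₂.not_up y hy,
    hb₁.not_up y hy, hb₂.not_up y hy, ht.not_up y hy⟩, ht.mem_W c.closed,
    ht.up_ne_of_inner c.closed hin hsp hsr, ht.up_ne ha₁, ht.up_ne ha₂, ht.up_ne hb₁, ht.up_ne hb₂,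
    ht.up_ne ht⟩

theorem up_par_ne_of_up {y x : E} (h : T.up (T.par y) = some x) : T.up (T.par x) ≠ some y := by
  intro h'
  have := T.depth_eq _ _ h
  have := T.depth_eq _ _ h'
  omega

theorem ne_of_up {y x : E} (h : T.up (T.par y) = some x) : x ≠ y := by
  rintro rfl; exact T.up_par_ne _ h

theorem Irreducible.twoDoublesChain (c : Irreducible T 3 S) {y x a₁ a₂ b₁ b₂ : E} {p r : V}
    (hy : y ∈ S.X) (hin : inner T S y = {p, r}) (hpr : p ≠ r) (hpa : Double T S p a₁ a₂ 1 1)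
    (hrb : Double T S r b₁ b₂ 1 1) (hx : x ∈ S.X)
    (hinx : inner T S x = {T.par y}) (hu : hang T S (T.par y) = {y}) : Achieves T 3 S := by
  obtain ⟨ha, -, ha₁, ha₂⟩ := id hpa
  obtain ⟨hb, -, hb₁, hb₂⟩ := id hrb
  have hp : p ∈ inner T S y := by simp [hin]
  have hr : r ∈ inner T S y := by simp [hin]
  have hyx : T.par y ∈ inner T S x := by simp [hinx]
  obtain ⟨q, hq, hq'⟩ := c.exists_private_card hp
  rw [hin, Finset.card_pair hpr] at hq
  obtain ⟨d, hd, hd'⟩ := c.exists_private_card hyx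
  rw [hinx, Finset.card_singleton] at hd
  have hup := up_of_mem_inner hyx
  have hxy := ne_of_up hup
  have h11 := ha₁.ne hb₁ hpr
  have h12 := ha₁.ne hb₂ hpr
  have h21 := ha₂.ne hb₁ hpr
  have h22 := ha₂.ne hb₂ hpr
  have hya₁ := (ha₁.ne_of_inner hp).symm
  have hya₂ := (ha₂.ne_of_inner hp).symm
  have hyb₁ := (hb₁.ne_of_inner hr).symm
  have hyb₂ := (hb₂.ne_of_inner hr).symm
  have hxa₁ := (ha₁.ne_of_inner hyx).symm
  have hxa₂ := (ha₂.ne_of_inner hyx).symm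
  have hxb₁ := (hb₁.ne_of_inner hyx).symm
  have hxb₂ := (hb₂.ne_of_inner hyx).symm
  have h := (Built.start [T.par x, T.par y, p, r] []).cutLeaf hb₂ (i := 3) (by grind) rfl
  have h := h.cutLeaf hb₁ (i := 3) (by grind) rfl
  have h := (h.cutLeaf ha₂ (i := 2) (by grind) rfl).cutLeaf ha₁ (i := 2) (by grind) rfl
  have h := h.cutInner (i := 1) (vs := [T.par x, T.par y]) [p, r] hy (by grind) rfl
    (by simpa using hpr) (by simpa using ⟨(mem_inner.1 hp).1, (mem_inner.1 hr).1⟩)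
    (fun e he hup => by
      rcases child_edge_of_inner c.closed hin he hup with h | h
      · have := hpa.eq_of_par he h; grind
      · have := hrb.eq_of_par he h; grind) hq
  have h := h.cutInner (i := 0) (vs := [T.par x]) [T.par y] hx (by grind) rfl
    (by simp) (by simpa using (mem_inner.1 hyx).1)
    (fun e he hup => by
      have : e ∈ hang T S (T.par y) :=
        mem_hang.2 ⟨he, child_edge_of_inner_singleton c.closed hinx he hup⟩
      rw [hu] at this
      grind) hd
  refine c.finish h (check_twoDoublesChain q (mem_of_lt_three hq') d (mem_of_lt_three hd')) ?_
    (by simp) (by simp) (by simp [Op.newE])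
  simpa [mem_cut_W] using ⟨c.closed.par_mem x hx, T.up_par_ne x, up_par_ne_of_up hup,
    ha₁.not_up x hx, ha₂.not_up x hx, hb₁.not_up x hx, hb₂.not_up x hx⟩

/-- An edge with exactly two children, one carrying two and the other one leaf edge, all of
minimal size. -/
structure Mixed (T : Rooting V E) (S : State V E) (y : E) (p r : V) (a b z : E) : Prop where
  mem : y ∈ S.X
  ch_eq : ch T S y = {p, r}
  ne : p ≠ r
  double : Double T S p a b 1 1
  single : Single T S r z 1

/-- An edge with exactly one child carrying further edges, namely one leaf edge with `d` children;
the edge has `q` other children. -/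
structure Pair (T : Rooting V E) (S : State V E) (y : E) (w : V) (z : E) (q d : ℕ) : Prop where
  mem : y ∈ S.X
  inner_eq : inner T S y = {w}
  single : Single T S w z d
  card : (ch T S y).card = 1 + q

theorem Mixed.inner_eq {y a b z : E} {p r : V} (h : Mixed T S y p r a b z) :
    inner T S y = {p, r} := by
  refine Finset.Subset.antisymm (fun v hv => h.ch_eq ▸ (mem_inner.1 hv).1) fun v hv => ?_
  refine mem_inner.2 ⟨by rwa [h.ch_eq], ?_⟩
  rw [Finset.mem_insert, Finset.mem_singleton] at hv
  rcases hv with rfl | rfl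
  exacts [⟨a, h.double.2.2.1.mem, h.double.2.2.1.par⟩, ⟨z, h.single.2.mem, h.single.2.par⟩]

theorem Mixed.mem_left {y a b z : E} {p r : V} (h : Mixed T S y p r a b z) : p ∈ inner T S y := by
  simp [h.inner_eq]

theorem Mixed.mem_right {y a b z : E} {p r : V} (h : Mixed T S y p r a b z) : r ∈ inner T S y := by
  simp [h.inner_eq]

theorem Mixed.card {y a b z : E} {p r : V} (h : Mixed T S y p r a b z) :
    (ch T S y).card = 2 + 0 := by
  rw [h.ch_eq, Finset.card_pair h.ne]

theorem Mixed.eq_of_up (hS : Closed T S) {y a b z e : E} {p r : V} (h : Mixed T S y p r a b z)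
    (he : e ∈ S.X) (hup : T.up (T.par e) = some y) : e = a ∨ e = b ∨ e = z := by
  rcases child_edge_of_inner hS h.inner_eq he hup with h' | h'
  · have := h.double.eq_of_par he h'; tauto
  · exact Or.inr (Or.inr (h.single.eq_of_par he h'))

/-- The edges of a mixed configuration are distinct. -/
theorem Mixed.distinct {y a b z : E} {p r : V} (h : Mixed T S y p r a b z) :
    a ≠ b ∧ a ≠ z ∧ b ≠ z ∧ y ≠ a ∧ y ≠ b ∧ y ≠ z :=
  ⟨h.double.1, h.double.2.2.1.ne h.single.2 h.ne, h.double.2.2.2.ne h.single.2 h.ne,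
    (h.double.2.2.1.ne_of_inner h.mem_left).symm, (h.double.2.2.2.ne_of_inner h.mem_left).symm,
    (h.single.2.ne_of_inner h.mem_right).symm⟩

theorem Mixed.up_ne (hS : Closed T S) {y a b z t : E} {p r s : V} {d : ℕ}
    (h : Mixed T S y p r a b z) (ht : LeafAt T S t s d) (hta : t ≠ a) (htb : t ≠ b) (htz : t ≠ z) :
    T.up s ≠ some y := fun hup => by
  rcases h.eq_of_up hS ht.mem (ht.par ▸ hup) with h | h | h
  exacts [hta h, htb h, htz h]

theorem Pair.mem_inner {y z : E} {w : V} {q d : ℕ} (h : Pair T S y w z q d) : w ∈ inner T S y := by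
  simp [h.inner_eq]

theorem Pair.ne {y z : E} {w : V} {q d : ℕ} (h : Pair T S y w z q d) : y ≠ z :=
  (h.single.2.ne_of_inner h.mem_inner).symm

theorem Pair.eq_of_up (hS : Closed T S) {y z e : E} {w : V} {q d : ℕ} (h : Pair T S y w z q d)
    (he : e ∈ S.X) (hup : T.up (T.par e) = some y) : e = z :=
  h.single.eq_of_par he (child_edge_of_inner_singleton hS h.inner_eq he hup)

theorem Pair.up_ne (hS : Closed T S) {y z t : E} {w s : V} {q d f : ℕ}
    (h : Pair T S y w z q d) (ht : LeafAt T S t s f) (htz : t ≠ z) : T.up s ≠ some y :=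
  fun hup => htz (h.eq_of_up hS ht.mem (ht.par ▸ hup))

theorem Irreducible.pair_lt (c : Irreducible T 3 S) {y z : E} {w : V} {q d : ℕ}
    (h : Pair T S y w z q d) : q ∈ [0, 1, 2] := by
  obtain ⟨q', hq, hq'⟩ := c.exists_private_card h.mem_inner
  rw [h.inner_eq, Finset.card_singleton, h.card] at hq
  exact mem_of_lt_three (by omega)

theorem Irreducible.mixedTwoLeaves (c : Irreducible T 3 S) {y a b z t₁ t₂ : E} {p r s₁ s₂ : V}
    {d e : ℕ} (h : Mixed T S y p r a b z) (ht₁ : LeafAt T S t₁ s₁ d) (ht₂ : LeafAt T S t₂ s₂ e)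
    (hne : t₁ ≠ t₂) (h1a : t₁ ≠ a) (h1b : t₁ ≠ b) (h1z : t₁ ≠ z) (h2a : t₂ ≠ a) (h2b : t₂ ≠ b)
    (h2z : t₂ ≠ z) : Achieves T 3 S := by
  obtain ⟨hab, haz, hbz, hya, hyb, hyz⟩ := h.distinct
  obtain ⟨-, -, ha, hb⟩ := h.double
  have hy := h.mem
  have hz := h.single.2
  have hyt₁ := (ht₁.ne_of_inner h.mem_left).symm
  have hyt₂ := (ht₂.ne_of_inner h.mem_left).symm
  have H := (Built.start [T.par y, s₁, s₂, p, r] []).cutLeaf ht₂ (i := 2) (by grind) rfl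
  have H := (H.cutLeaf ht₁ (i := 1) (by grind) rfl).cutLeaf hz (i := 4) (by grind) rfl
  have H := (H.cutLeaf hb (i := 3) (by grind) rfl).cutLeaf ha (i := 3) (by grind) rfl
  have H := H.cutInner (i := 0) (vs := [T.par y, s₁, s₂]) [p, r] hy (by grind) rfl
    (by simpa using h.ne) (by simp [h.ch_eq])
    (fun e he hup => by have := h.eq_of_up c.closed he hup; grind) h.card
  refine c.finish H (check_mixedTwoLeaves d (c.leaf_mem_three ht₁) e (c.leaf_mem_three ht₂)) ?_
    (by simp) (by simp) (by simp [Op.newE])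
  simpa [mem_cut_W] using ⟨⟨c.closed.par_mem y hy, T.up_par_ne y, ha.not_up y hy, hb.not_up y hy,
    hz.not_up y hy, ht₁.not_up y hy, ht₂.not_up y hy⟩,
    ⟨ht₁.mem_W c.closed, h.up_ne c.closed ht₁ h1a h1b h1z, ht₁.up_ne ha, ht₁.up_ne hb,
      ht₁.up_ne hz, ht₁.up_ne ht₁, ht₁.up_ne ht₂⟩,
    ht₂.mem_W c.closed, h.up_ne c.closed ht₂ h2a h2b h2z, ht₂.up_ne ha, ht₂.up_ne hb,
      ht₂.up_ne hz, ht₂.up_ne ht₁, ht₂.up_ne ht₂⟩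

theorem lab_cut {k : ℕ} {Z : Finset E} {P : Finset V} {y : E} {w : V} (hyZ : y ∉ Z)
    (hw : ∀ v, v ∈ ch T S y ∧ v ∉ P ↔ v = w) (f : V → ℕ) :
    lab T k (cut T S Z P) f y = (f (T.par y) + f w) % k := by
  have : ch T (cut T S Z P) y = {w} := by
    ext v; rw [mem_ch_cut hyZ, hw, Finset.mem_singleton]
  rw [lab, this, Finset.sum_singleton]

/-- The three leaves are cut and `r` is detached, so that `y` consists of its parent and `p` only;
its label is then known. Both vertices may be relabelled: `p` lies only on `y`, and the parent only
on `y` and `x`. -/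
theorem Irreducible.mixedSole (c : Irreducible T 3 S) {y x a b z : E} {p r : V}
    (h : Mixed T S y p r a b z) (hu : hang T S (T.par y) = {y}) (hup : T.up (T.par y) = some x) :
    Achieves T 3 S := by
  obtain ⟨hab, haz, hbz, hya, hyb, hyz⟩ := h.distinct
  obtain ⟨-, -, ha, hb⟩ := h.double
  have hy := h.mem
  have hz := h.single.2
  have hx := c.closed.up_mem _ (c.closed.par_mem y hy) x hup
  have hxy := ne_of_up hup
  have hxu : T.par y ∈ inner T S x := mem_inner_of_up c.closed hy hup
  have hxa := (ha.ne_of_inner hxu).symm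
  have hxb := (hb.ne_of_inner hxu).symm
  have hxz := (hz.ne_of_inner hxu).symm
  have hpu := up_of_mem_inner h.mem_left
  have hru := up_of_mem_inner h.mem_right
  have hup' : T.par y ≠ p := fun h' => T.up_par_ne y (by rw [h', hpu])
  have hur' : T.par y ≠ r := fun h' => T.up_par_ne y (by rw [h', hru])
  have hne := h.ne
  have H := (Built.start [T.par y, p, r] [x, y]).cutLeaf hz (i := 2) (by grind) rfl
  have H := (H.cutLeaf hb (i := 1) (by grind) rfl).cutLeaf ha (i := 1) (by grind) rfl
  have H := H.cutFlip (v := p) (i := 1) (js := [1]) (by grind) rfl (by simp) (by simp)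
    (fun e he heZ => by
      have : T.par e ≠ p := fun hh => heZ (by have := h.double.eq_of_par he hh; grind)
      simp [this, hpu])
  have H := H.cutFlip (v := T.par y) (i := 0) (js := [0, 1]) (by grind) rfl (by simp) (by simp)
    (fun e he heZ => by
      have : T.par e = T.par y ↔ y = e := by
        refine ⟨fun hh => ?_, fun hh => by rw [hh]⟩
        have : e ∈ hang T S (T.par y) := mem_hang.2 ⟨he, hh⟩
        rw [hu, Finset.mem_singleton] at this
        exact this.symm
      simp [this, hup, or_comm])
  have H := H.cutVert (vs := [T.par y, p]) (j := 1) (mem_inner.1 h.mem_right).1 (by grind) (by simp)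
    (fun e he hep => by have := h.single.eq_of_par he hep; grind) (mem_inner.1 h.mem_left).1 h.ne
    (by simp) rfl
  refine c.finish_known H ?_ ?_ ?_ (fun f hf => ?_) check_mixedSole (by simp [Op.newE])
  · simpa [mem_cut_W] using ⟨⟨c.closed.par_mem y hy, ⟨ha.not_up y hy, hb.not_up y hy,
      hz.not_up y hy⟩, hur'⟩, ha.mem_W c.closed, ⟨ha.up_ne ha, ha.up_ne hb, ha.up_ne hz⟩, h.ne⟩
  · simpa [mem_cut_X] using ⟨⟨hx, hxa, hxb, hxz⟩, hy, hya, hyb, hyz⟩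
  · simpa using hxy
  · have := lab_cut (T := T) (S := S) (k := 3) (Z := insert a (insert b (insert z ∅)))
      (P := insert r ∅) (y := y) (w := p) (by grind) (by
        intro v
        rw [h.ch_eq]
        grind) f
    simpa [consistent] using this

theorem Irreducible.mixedPair (c : Irreducible T 3 S) {y y₂ a b z z₂ : E} {p r w : V} {q d : ℕ}
    (h : Mixed T S y p r a b z) (h₂ : Pair T S y₂ w z₂ q d) (hpar : T.par y₂ = T.par y) :
    Achieves T 3 S := by
  obtain ⟨hab, haz, hbz, hya, hyb, hyz⟩ := h.distinct
  obtain ⟨-, -, ha, hb⟩ := h.double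
  have hy := h.mem
  have hz := h.single.2
  have hz₂ := h₂.single.2
  have hne : y ≠ y₂ := by
    rintro rfl
    have := congrArg Finset.card h₂.inner_eq
    rw [h.inner_eq, Finset.card_pair h.ne, Finset.card_singleton] at this
    omega
  have hw := up_of_mem_inner h₂.mem_inner
  have hwp : w ≠ p := by
    rintro rfl
    rw [up_of_mem_inner h.mem_left] at hw
    exact hne (Option.some.inj hw)
  have hwr : w ≠ r := by
    rintro rfl
    rw [up_of_mem_inner h.mem_right] at hw
    exact hne (Option.some.inj hw)
  have k1 := hz₂.ne ha hwp
  have k2 := hz₂.ne hb hwp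
  have k3 := hz₂.ne hz hwr
  have k4 := (hz₂.ne_of_inner h.mem_left).symm
  have l1 := (ha.ne_of_inner h₂.mem_inner).symm
  have l2 := (hb.ne_of_inner h₂.mem_inner).symm
  have l3 := (hz.ne_of_inner h₂.mem_inner).symm
  have l4 := h₂.ne
  have H := (Built.start [T.par y, p, r, w] []).cutLeaf hz₂ (i := 3) (by grind) rfl
  have H := H.cutInner (i := 0) (vs := [T.par y, p, r]) [w] h₂.mem (by grind) (by rw [hpar]; rfl)
    (by simp) (by simpa using (mem_inner.1 h₂.mem_inner).1)
    (fun e he hup => by have := h₂.eq_of_up c.closed he hup; grind) h₂.card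
  have H := H.cutLeaf hz (i := 2) (by grind) rfl
  have H := (H.cutLeaf hb (i := 1) (by grind) rfl).cutLeaf ha (i := 1) (by grind) rfl
  have H := H.cutInner (i := 0) (vs := [T.par y]) [p, r] hy (by grind) rfl
    (by simpa using h.ne) (by simp [h.ch_eq])
    (fun e he hup => by have := h.eq_of_up c.closed he hup; grind) h.card
  refine c.finish H (check_mixedPair q (c.pair_lt h₂) d (c.leaf_mem_three hz₂)) ?_
    (by simp) (by simp) (by simp [Op.newE])
  simpa [mem_cut_W] using ⟨c.closed.par_mem y hy, T.up_par_ne y, ha.not_up y hy, hb.not_up y hy,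
    hz.not_up y hy, by rw [← hpar]; exact T.up_par_ne y₂, hz₂.not_up y hy⟩

theorem Irreducible.mixedChain (c : Irreducible T 3 S) {y x a b z t : E} {p r : V} {d : ℕ}
    (h : Mixed T S y p r a b z) (ht : LeafAt T S t (T.par y) d) (hx : x ∈ S.X)
    (hinx : inner T S x = {T.par y}) (hu : hang T S (T.par y) = {y, t}) : Achieves T 3 S := by
  obtain ⟨hab, haz, hbz, hya, hyb, hyz⟩ := h.distinct
  obtain ⟨-, -, ha, hb⟩ := h.double
  have hy := h.mem
  have hz := h.single.2
  have hxu : T.par y ∈ inner T S x := by simp [hinx]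
  obtain ⟨q, hq, hq'⟩ := c.exists_private_card hxu
  rw [hinx, Finset.card_singleton] at hq
  have hup := up_of_mem_inner hxu
  have hxy := ne_of_up hup
  have hup' : T.par y ≠ p := fun h' => T.up_par_ne y (by rw [h', up_of_mem_inner h.mem_left])
  have hur' : T.par y ≠ r := fun h' => T.up_par_ne y (by rw [h', up_of_mem_inner h.mem_right])
  have hxa := (ha.ne_of_inner hxu).symm
  have hxb := (hb.ne_of_inner hxu).symm
  have hxz := (hz.ne_of_inner hxu).symm
  have hxt := (ht.ne_of_inner hxu).symm
  have hyt := (ht.ne_of_inner h.mem_left).symm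
  have k1 := ht.ne ha hup'
  have k2 := ht.ne hb hup'
  have k3 := ht.ne hz hur'
  have H := (Built.start [T.par x, T.par y, p, r] []).cutLeaf ht (i := 1) (by grind) rfl
  have H := H.cutLeaf hz (i := 3) (by grind) rfl
  have H := (H.cutLeaf hb (i := 2) (by grind) rfl).cutLeaf ha (i := 2) (by grind) rfl
  have H := H.cutInner (i := 1) (vs := [T.par x, T.par y]) [p, r] hy (by grind) rfl
    (by simpa using h.ne) (by simp [h.ch_eq])
    (fun e he hup => by have := h.eq_of_up c.closed he hup; grind) h.card
  have H := H.cutInner (i := 0) (vs := [T.par x]) [T.par y] hx (by grind) rfl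
    (by simp) (by simpa using (mem_inner.1 hxu).1)
    (fun e he hup => by
      have : e ∈ hang T S (T.par y) :=
        mem_hang.2 ⟨he, child_edge_of_inner_singleton c.closed hinx he hup⟩
      rw [hu] at this
      grind) hq
  refine c.finish H (check_mixedChain q (mem_of_lt_three hq') d (c.leaf_mem_three ht)) ?_
    (by simp) (by simp) (by simp [Op.newE])
  simpa [mem_cut_W] using ⟨c.closed.par_mem x hx, T.up_par_ne x, up_par_ne_of_up hup,
    ha.not_up x hx, hb.not_up x hx, hz.not_up x hx, ht.not_up x hx⟩

/-- The three edges `y`, `z`, `t` are cut; `t` may be any other leaf, and its parent may be the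
parent of `y`. -/
theorem Irreducible.pairLeaf (c : Irreducible T 3 S) {y z t : E} {w s : V} {q d e : ℕ}
    (h : Pair T S y w z q d) (ht : LeafAt T S t s e) (htz : t ≠ z)
    (hne : q = 0 → d ≠ e → d = 3 ∨ e = 3) : Achieves T 3 S := by
  have hy := h.mem
  have hz := h.single.2
  have hyz := h.ne
  have hyt := (ht.ne_of_inner h.mem_inner).symm
  have H := ((Built.start [T.par y, s, w] []).cutLeaf ht (i := 1) (by grind) rfl).cutLeaf hz
    (i := 2) (by grind) rfl
  have H := H.cutInner (i := 0) (vs := [T.par y, s]) [w] hy (by grind) rfl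
    (by simp) (by simpa using (mem_inner.1 h.mem_inner).1)
    (fun e he hup => by have := h.eq_of_up c.closed he hup; grind) h.card
  refine c.finish H (check_pairLeaf q (c.pair_lt h) d (c.leaf_mem_three hz) e (c.leaf_mem_three ht)
    hne) ?_ (by simp) (by simp) (by simp [Op.newE])
  simpa [mem_cut_W] using ⟨⟨c.closed.par_mem y hy, T.up_par_ne y, hz.not_up y hy, ht.not_up y hy⟩,
    ht.mem_W c.closed, h.up_ne c.closed ht htz, ht.up_ne hz, ht.up_ne ht⟩

theorem Irreducible.pairLeafAtRoot (c : Irreducible T 3 S) {y z t : E} {w : V} {d e : ℕ}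
    (h : Pair T S y w z 0 d) (ht : LeafAt T S t (T.par y) e) : Achieves T 3 S := by
  have hy := h.mem
  have hz := h.single.2
  have hyz := h.ne
  have hyt := (ht.ne_of_inner h.mem_inner).symm
  have htz := ht.ne hz fun h' => T.up_par_ne y (by rw [h', up_of_mem_inner h.mem_inner])
  have H := ((Built.start [T.par y, w] []).cutLeaf ht (i := 0) (by grind) rfl).cutLeaf hz
    (i := 1) (by grind) rfl
  have H := H.cutInner (i := 0) (vs := [T.par y]) [w] hy (by grind) rfl
    (by simp) (by simpa using (mem_inner.1 h.mem_inner).1)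
    (fun e he hup => by have := h.eq_of_up c.closed he hup; grind) h.card
  refine c.finish H (check_pairLeafAtRoot d (c.leaf_mem_three hz) e (c.leaf_mem_three ht))
    ?_ (by simp) (by simp) (by simp [Op.newE])
  simpa [mem_cut_W] using ⟨c.closed.par_mem y hy, T.up_par_ne y, hz.not_up y hy, ht.not_up y hy⟩

/-- The edge `y₂` stays, reduced to a parent shared with `y` and the child `w₂`. Once `z₂` is cut,
`w₂` lies on `y₂` alone and may be relabelled. -/
theorem Irreducible.pairPair (c : Irreducible T 3 S) {y y₂ z z₂ : E} {w w₂ : V} {d e : ℕ}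
    (h : Pair T S y w z 0 d) (h₂ : Pair T S y₂ w₂ z₂ 0 e) (hne : y ≠ y₂)
    (hpar : T.par y₂ = T.par y) : Achieves T 3 S := by
  have hy := h.mem
  have hz := h.single.2
  have hz₂ := h₂.single.2
  have hyz := h.ne
  have hyz₂ := h₂.ne
  have hw := up_of_mem_inner h.mem_inner
  have hw₂ := up_of_mem_inner h₂.mem_inner
  have hww : w ≠ w₂ := by
    rintro rfl
    rw [hw₂] at hw
    exact hne (Option.some.inj hw).symm
  have hzz := hz.ne hz₂ hww
  have k1 := (hz.ne_of_inner h₂.mem_inner).symm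
  have k2 := (hz₂.ne_of_inner h.mem_inner).symm
  have huw : T.par y ≠ w₂ := fun h' => T.up_par_ne y₂ (by rw [hpar, h', hw₂])
  have hch : ch T S y₂ = {w₂} := by
    obtain ⟨v, hv⟩ := Finset.card_eq_one.1 h₂.card
    have := (mem_inner.1 h₂.mem_inner).1
    rw [hv, Finset.mem_singleton] at this
    rw [hv, this]
  have H := ((Built.start [T.par y, w₂, w] [y₂]).cutLeaf hz₂ (i := 1) (by grind) rfl).cutLeaf hz
    (i := 2) (by grind) rfl
  have H := H.cutInner (i := 0) (vs := [T.par y, w₂]) [w] hy (by grind) rfl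
    (by simp) (by simpa using (mem_inner.1 h.mem_inner).1)
    (fun e he hup => by have := h.eq_of_up c.closed he hup; grind) h.card
  have H := H.cutFlip (v := w₂) (i := 1) (js := [0]) (by grind) rfl (by simp) (by simp)
    (fun e he heZ => by
      have : T.par e ≠ w₂ := fun hh => heZ (by have := h₂.single.eq_of_par he hh; grind)
      simp [this, hw₂])
  refine c.finish_known H ?_ ?_ (by simp) (fun f hf => ?_)
    (check_pairPair d (c.leaf_mem_three hz) e (c.leaf_mem_three hz₂)) (by simp [Op.newE])
  · simpa [mem_cut_W] using ⟨⟨c.closed.par_mem y hy, T.up_par_ne y, hz.not_up y hy,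
      hz₂.not_up y hy⟩, hz₂.mem_W c.closed, by rw [hw₂]; exact fun h => hne (Option.some.inj h).symm,
      hz₂.up_ne hz, hz₂.up_ne hz₂⟩
  · simpa [mem_cut_X] using ⟨h₂.mem, hne.symm, k1, hyz₂⟩
  · have := lab_cut (T := T) (S := S) (k := 3) (Z := insert y (insert z (insert z₂ ∅)))
      (P := ∅) (y := y₂) (w := w₂) (by grind) (by
        intro v
        simp [hch]) f
    rw [hpar] at this
    simpa [consistent] using this

/-- Since `y` is the only edge at its parent, cutting it makes this parent private, so that it can
be detached from `x`, where `v` remains. -/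
theorem Irreducible.detachPair (c : Irreducible T 3 S) {y x z t : E} {w s v : V} {d e : ℕ}
    (h : Pair T S y w z 0 d) (ht : LeafAt T S t s e) (htz : t ≠ z) (hde : d ≠ e)
    (hu : hang T S (T.par y) = {y}) (hup : T.up (T.par y) = some x) (hv : v ∈ ch T S x)
    (hvu : v ≠ T.par y) : Achieves T 3 S := by
  have hy := h.mem
  have hz := h.single.2
  have hyz := h.ne
  have hyt := (ht.ne_of_inner h.mem_inner).symm
  have hxu : T.par y ∈ inner T S x := mem_inner_of_up c.closed hy hup
  have hx := c.closed.up_mem _ (c.closed.par_mem y hy) x hup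
  have hxy := ne_of_up hup
  have hxt := (ht.ne_of_inner hxu).symm
  have hxz := (hz.ne_of_inner hxu).symm
  have heq : ∀ e ∈ S.X, T.par e = T.par y → e = y := fun e he hp => by
    have : e ∈ hang T S (T.par y) := mem_hang.2 ⟨he, hp⟩
    rwa [hu, Finset.mem_singleton] at this
  have hsu : s ≠ T.par y := fun h' => hyt (heq t ht.mem (ht.par.trans h')).symm
  have H := ((Built.start [s, T.par y, w] [x]).cutLeaf ht (i := 0) (by grind) rfl).cutLeaf hz
    (i := 2) (by grind) rfl
  have H := H.cutInner (i := 1) (vs := [s, T.par y]) [w] hy (by grind) rfl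
    (by simp) (by simpa using (mem_inner.1 h.mem_inner).1)
    (fun e he hup => by have := h.eq_of_up c.closed he hup; grind) h.card
  have H := H.cutVert (vs := [s]) (j := 0) (mem_inner.1 hxu).1 (by grind) (by simp)
    (fun e he hep => by have := heq e he hep; grind) hv hvu (by simp) rfl
  refine c.finish H (check_detachPair d (c.leaf_mem_three hz) e (c.leaf_mem_three ht) hde) ?_ ?_
    (by simp) (by simp [Op.newE])
  · simpa [mem_cut_W] using ⟨ht.mem_W c.closed, ⟨h.up_ne c.closed ht htz, ht.up_ne hz,
      ht.up_ne ht⟩, hsu⟩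
  · simpa [mem_cut_X] using ⟨hx, hxy, hxz, hxt⟩

theorem Irreducible.pairChain (c : Irreducible T 3 S) {y x z : E} {w : V} {q d : ℕ}
    (h : Pair T S y w z q d) (hx : x ∈ S.X) (hinx : inner T S x = {T.par y})
    (hu : hang T S (T.par y) = {y}) : Achieves T 3 S := by
  have hy := h.mem
  have hz := h.single.2
  have hyz := h.ne
  have hxu : T.par y ∈ inner T S x := by simp [hinx]
  obtain ⟨q', hq, hq'⟩ := c.exists_private_card hxu
  rw [hinx, Finset.card_singleton] at hq
  have hup := up_of_mem_inner hxu
  have hxy := ne_of_up hup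
  have hxz := (hz.ne_of_inner hxu).symm
  have H := (Built.start [T.par x, T.par y, w] []).cutLeaf hz (i := 2) (by grind) rfl
  have H := H.cutInner (i := 1) (vs := [T.par x, T.par y]) [w] hy (by grind) rfl
    (by simp) (by simpa using (mem_inner.1 h.mem_inner).1)
    (fun e he hup => by have := h.eq_of_up c.closed he hup; grind) h.card
  have H := H.cutInner (i := 0) (vs := [T.par x]) [T.par y] hx (by grind) rfl
    (by simp) (by simpa using (mem_inner.1 hxu).1)
    (fun e he hup => by
      have : e ∈ hang T S (T.par y) :=
        mem_hang.2 ⟨he, child_edge_of_inner_singleton c.closed hinx he hup⟩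
      rw [hu] at this
      grind) hq
  refine c.finish H (check_pairChain q' (mem_of_lt_three hq') q (c.pair_lt h) d
    (c.leaf_mem_three hz)) ?_ (by simp) (by simp) (by simp [Op.newE])
  simpa [mem_cut_W] using ⟨c.closed.par_mem x hx, T.up_par_ne x, up_par_ne_of_up hup,
    hz.not_up x hx⟩

end HypertreeCordial

namespace HypertreeCordial

set_option linter.unusedSectionVars false

variable {V E : Type*} [DecidableEq V] [DecidableEq E] {T : Rooting V E} {S S₀ S₁ : State V E}

/-! ### Case analysis modulo 3 -/

theorem inner_empty_leaf (hS : Closed T S) {y : E} (hy : y ∈ S.X) (h : ¬ (inner T S y).Nonempty) :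
    LeafAt T S y (T.par y) (ch T S y).card :=
  LeafAt.intro hy fun _ he hup => h ⟨_, mem_inner_of_up hS he hup⟩

theorem Irreducible.twoDoubles (c : Irreducible T 3 S) (hdvd : 3 ∣ S.X.card)
    {y a₁ a₂ b₁ b₂ : E} {p r : V}
    (hy : y ∈ S.X) (hin : inner T S y = {p, r}) (hpr : p ≠ r) (hpa : Double T S p a₁ a₂ 1 1)
    (hrb : Double T S r b₁ b₂ 1 1) : Achieves T 3 S := by
  by_cases hleaf : ∃ t ∈ S.X, (∀ e ∈ S.X, T.up (T.par e) ≠ some t) ∧ T.par t ≠ p ∧ T.par t ≠ r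
  · obtain ⟨t, ht, htl, htp, htr⟩ := hleaf
    exact c.twoDoublesLeaf hy hin hpr hpa hrb (LeafAt.intro ht htl) htp htr
  push Not at hleaf
  have hp : T.up p = some y := up_of_mem_inner (show p ∈ inner T S y by simp [hin])
  have hr : T.up r = some y := up_of_mem_inner (show r ∈ inner T S y by simp [hin])
  have hQ : ∀ e ∈ S.X, T.up (T.par e) = some y ∨ Anc T y e := by
    have := chain_of_leaves (T := T) (S := S) (y := y) (R := fun _ => False)
      (fun _ _ h => h.elim) fun t ht htl => Or.inl <| by
        by_cases htp : T.par t = p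
        · rw [htp, hp]
        · rw [hleaf t ht htl htp, hr]
    simpa using this
  have hhang := hang_eq_of_chain hy hQ
  rcases hux : T.up (T.par y) with _ | x
  · exfalso
    obtain ⟨ha, -, ha₁, ha₂⟩ := id hpa
    obtain ⟨hb, -, hb₁, hb₂⟩ := id hrb
    have hX : S.X = {y, a₁, a₂, b₁, b₂} := by
      ext e
      simp only [Finset.mem_insert, Finset.mem_singleton]
      constructor
      · intro he
        rcases hQ e he with h | h
        · rcases child_edge_of_inner c.closed hin he h with h | h
          · have := hpa.eq_of_par he h; tauto
          · have := hrb.eq_of_par he h; tauto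
        · rcases Relation.ReflTransGen.cases_head h with h | ⟨e', h, -⟩
          · exact Or.inl h.symm
          · rw [hux] at h; cases h
      · rintro (rfl | rfl | rfl | rfl | rfl)
        exacts [hy, ha₁.mem, ha₂.mem, hb₁.mem, hb₂.mem]
    have h11 := ha₁.ne hb₁ hpr
    have h12 := ha₁.ne hb₂ hpr
    have h21 := ha₂.ne hb₁ hpr
    have h22 := ha₂.ne hb₂ hpr
    have hp' : p ∈ inner T S y := by simp [hin]
    have hya₁ := (ha₁.ne_of_inner hp').symm
    have hya₂ := (ha₂.ne_of_inner hp').symm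
    have hyb₁ := (hb₁.ne_of_inner hp').symm
    have hyb₂ := (hb₂.ne_of_inner hp').symm
    -- With no edge above `y` there are exactly five edges, contradicting divisibility by 3.
    have : S.X.card = 5 := by
      rw [hX, Finset.card_insert_of_notMem (by grind), Finset.card_insert_of_notMem (by grind),
        Finset.card_insert_of_notMem (by grind), Finset.card_pair hb]
    omega
  · exact c.twoDoublesChain hy hin hpr hpa hrb (c.closed.up_mem _ (c.closed.par_mem y hy) x hux)
      (inner_eq_of_chain c.closed hy (fun e he => (hQ e he).imp_right Or.inr) hux) hhang

/-- A bottom edge is reducible unless it forms a pair or mixed configuration. -/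
theorem Irreducible.bottom_cases (c : Irreducible T 3 S) (hdvd : 3 ∣ S.X.card) {y : E}
    (hyb : Bottom T S y) (hne : (inner T S y).Nonempty) :
    Achieves T 3 S ∨ (∃ w z q d, Pair T S y w z q d) ∨ ∃ p r a b z, Mixed T S y p r a b z := by
  have hy := hyb.1
  by_cases hthree : ∃ w ∈ inner T S y, 2 < (hang T S w).card
  · obtain ⟨w, hw, h⟩ := hthree
    obtain ⟨a, ha, b, hb, t, ht, hab, hat, hbt⟩ := Finset.two_lt_card.1 h
    exact Or.inl (c.threeLeaves hab hat hbt (hyb.leaf hw ha) (hyb.leaf hw hb) (hyb.leaf hw ht))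
  push Not at hthree
  by_cases hS : ∃ r ∈ inner T S y, (hang T S r).card = 1
  · obtain ⟨r, hr, hr1⟩ := hS
    obtain ⟨z, f, hrz⟩ := hyb.single hr hr1
    by_cases hD : ∃ p ∈ inner T S y, (hang T S p).card = 2
    · obtain ⟨p, hp, hp2⟩ := hD
      obtain ⟨a, b, d, e, hpab⟩ := hyb.double hp hp2
      have hpr : p ≠ r := by rintro rfl; omega
      by_cases hone : d = 1 ∧ e = 1 ∧ f = 1
      · obtain ⟨rfl, rfl, rfl⟩ := hone
        by_cases hthird : ∃ w ∈ ch T S y, w ≠ p ∧ w ≠ r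
        · obtain ⟨w, hw, hwp, hwr⟩ := hthird
          exact Or.inl (c.detachDoubleSingle hy hp hr hpr hpab hrz hw hwp hwr)
        · push Not at hthird
          refine Or.inr (Or.inr ⟨p, r, a, b, z, hy, ?_, hpr, hpab, hrz⟩)
          ext v
          rw [Finset.mem_insert, Finset.mem_singleton]
          constructor
          · intro hv
            by_contra! h
            exact h.2 (hthird v hv h.1)
          · rintro (rfl | rfl)
            exacts [(mem_inner.1 hp).1, (mem_inner.1 hr).1]
      · exact Or.inl (c.doubleSingle hy hp hr hpr hpab hrz fun h1 h2 h3 => hone ⟨h1, h2, h3⟩)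
    · push Not at hD
      have hsingle : ∀ w ∈ inner T S y, ∃ z d, Single T S w z d := fun w hw => by
        refine hyb.single hw ?_
        have := hthree w hw
        have := hD w hw
        have := hang_card_pos hw
        omega
      rcases Nat.lt_trichotomy (inner T S y).card 2 with h | h | h
      · have h1 : (inner T S y).card = 1 := by
          have := Finset.card_pos.2 hne
          omega
        obtain ⟨w, hw⟩ := Finset.card_eq_one.1 h1
        have hwi : w ∈ inner T S y := by simp [hw]
        obtain ⟨z, d, hwz⟩ := hsingle w hwi
        obtain ⟨q, hq, -⟩ := c.exists_private_card hwi
        exact Or.inr (Or.inl ⟨w, z, q, d, hy, hw, hwz, by rw [hq, h1]⟩)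
      · obtain ⟨p, r, hpr, hin⟩ := Finset.card_eq_two.1 h
        obtain ⟨a, d, hpa⟩ := hsingle p (by simp [hin])
        obtain ⟨b, e, hrb⟩ := hsingle r (by simp [hin])
        exact Or.inl (c.twoSingles hy hin hpr hpa hrb)
      · obtain ⟨s, hs, p, hp, r, hr, hsp, hsr, hpr⟩ := Finset.two_lt_card.1 h
        obtain ⟨a, d, hsa⟩ := hsingle s hs
        obtain ⟨b, e, hpb⟩ := hsingle p hp
        obtain ⟨t, f, hrt⟩ := hsingle r hr
        exact Or.inl (c.threeSingles hy hs hp hr hsp hsr hpr hsa hpb hrt)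
  · push Not at hS
    left
    have hdouble : ∀ w ∈ inner T S y, ∃ a b d e, Double T S w a b d e := fun w hw => by
      refine hyb.double hw ?_
      have := hthree w hw
      have := hS w hw
      have := hang_card_pos hw
      omega
    by_cases hone : (inner T S y).card = 1
    · obtain ⟨w, hw⟩ := Finset.card_eq_one.1 hone
      obtain ⟨a, b, d, e, h⟩ := hdouble w (by simp [hw])
      exact c.cherry hy hw h
    by_cases hbig : ∃ p ∈ inner T S y, ∃ a b d e, Double T S p a b d e ∧ (d = 1 → e ≠ 1)
    · obtain ⟨p, hp, a, b, d, e, hpab, hde⟩ := hbig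
      obtain ⟨r, hr, hrp⟩ := Finset.exists_mem_ne
        (show 1 < (inner T S y).card by have := Finset.card_pos.2 hne; omega) p
      obtain ⟨t, _, f, _, _, _, ht, _⟩ := hdouble r hr
      exact c.detachDouble hy hp hr hrp.symm hpab ht hde
    · push Not at hbig
      have hdouble : ∀ w ∈ inner T S y, ∃ a b, Double T S w a b 1 1 := fun w hw => by
        obtain ⟨a, b, d, e, h⟩ := hdouble w hw
        obtain ⟨rfl, rfl⟩ := hbig w hw a b d e h
        exact ⟨a, b, h⟩
      rcases Nat.lt_or_ge 2 (inner T S y).card with h | h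
      · obtain ⟨s, hs, p, hp, r, hr, hsp, hsr, hpr⟩ := Finset.two_lt_card.1 h
        obtain ⟨_, _, hsa⟩ := hdouble s hs
        obtain ⟨_, _, hpb⟩ := hdouble p hp
        obtain ⟨_, _, hrt⟩ := hdouble r hr
        exact c.detachTwoDoubles hy hs hp hr hsp hsr hpr hsa hpb hrt
      · have h2 : (inner T S y).card = 2 := by
          have := Finset.card_pos.2 hne
          omega
        obtain ⟨p, r, hpr, hin⟩ := Finset.card_eq_two.1 h2
        obtain ⟨_, _, hpa⟩ := hdouble p (by simp [hin])
        obtain ⟨_, _, hrb⟩ := hdouble r (by simp [hin])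
        exact c.twoDoubles hdvd hy hin hpr hpa hrb

theorem par_eq_of_root {y e : E} (h : T.up (T.par y) = none) (he : T.up (T.par e) = none) :
    T.par e = T.par y := by
  rw [(T.up_eq_none _).1 h, (T.up_eq_none _).1 he]

/-- Two leaves not below `y` suffice. Otherwise consider another edge at the parent of `y`. If it
has edges below it, it reduces or forms a pair. If it is a leaf, it is the only leaf not below `y`,
and apart from it and the edges below `y` the tree is a chain. If there is none, `mixedSole`
applies. Without an edge above `y` the last two cases leave five or four edges. -/
theorem Irreducible.achieves_of_mixed (c : Irreducible T 3 S) (hdvd : 3 ∣ S.X.card)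
    {y a b z : E} {p r : V} (h : Mixed T S y p r a b z)
    (hlev : ∀ e ∈ hang T S (T.par y), Bottom T S e) : Achieves T 3 S := by
  have hy := h.mem
  obtain ⟨hab, haz, hbz, hya, hyb, hyz⟩ := h.distinct
  obtain ⟨-, -, ha, hb⟩ := h.double
  have hz := h.single.2
  by_cases htwo : ∃ t₁ ∈ S.X, ∃ t₂ ∈ S.X, (∀ e ∈ S.X, T.up (T.par e) ≠ some t₁) ∧
      (∀ e ∈ S.X, T.up (T.par e) ≠ some t₂) ∧ t₁ ≠ t₂ ∧ T.up (T.par t₁) ≠ some y ∧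
      T.up (T.par t₂) ≠ some y
  · obtain ⟨t₁, ht₁, t₂, ht₂, hl₁, hl₂, hne, h1, h2⟩ := htwo
    have hpu := up_of_mem_inner h.mem_left
    have hru := up_of_mem_inner h.mem_right
    refine c.mixedTwoLeaves h (LeafAt.intro ht₁ hl₁) (LeafAt.intro ht₂ hl₂) hne ?_ ?_ ?_ ?_ ?_ ?_
    · rintro rfl; exact h1 (by rw [ha.par, hpu])
    · rintro rfl; exact h1 (by rw [hb.par, hpu])
    · rintro rfl; exact h1 (by rw [hz.par, hru])
    · rintro rfl; exact h2 (by rw [ha.par, hpu])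
    · rintro rfl; exact h2 (by rw [hb.par, hpu])
    · rintro rfl; exact h2 (by rw [hz.par, hru])
  by_cases hinner : ∃ y₂ ∈ hang T S (T.par y), y₂ ≠ y ∧ (inner T S y₂).Nonempty
  · obtain ⟨y₂, hy₂, hne, hin⟩ := hinner
    rcases c.bottom_cases hdvd (hlev y₂ hy₂) hin with h' | ⟨w, z₂, q, d, h'⟩ |
      ⟨p₂, r₂, a₂, b₂, z₂, h'⟩
    · exact h'
    · exact c.mixedPair h h' (mem_hang.1 hy₂).2
    -- A second mixed edge would provide two leaves that are not below `y`.
    · exfalso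
      obtain ⟨hab₂, -, ha₂, hb₂⟩ := h'.double
      have hpu := up_of_mem_inner h'.mem_left
      exact htwo ⟨a₂, ha₂.mem, b₂, hb₂.mem, ha₂.not_up, hb₂.not_up, hab₂,
        by rw [ha₂.par, hpu]; exact fun h => hne (Option.some.inj h),
        by rw [hb₂.par, hpu]; exact fun h => hne (Option.some.inj h)⟩
  push Not at hinner
  have hleaf : ∀ t ∈ hang T S (T.par y), t ≠ y → LeafAt T S t (T.par y) (ch T S t).card := by
    intro t ht hty
    have := inner_empty_leaf c.closed (mem_hang.1 ht).1
      (Finset.not_nonempty_iff_eq_empty.2 (hinner t ht hty))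
    rwa [(mem_hang.1 ht).2] at this
  have hstep : ∀ e ∈ S.X, T.up (T.par e) = some y → ∀ e' ∈ S.X, T.up (T.par e') ≠ some e := by
    intro e he hup
    rcases h.eq_of_up c.closed he hup with rfl | rfl | rfl
    exacts [ha.not_up, hb.not_up, hz.not_up]
  by_cases hu : hang T S (T.par y) = {y}
  · rcases hup : T.up (T.par y) with _ | x
    · exfalso
      have hX : ∀ e ∈ S.X, e = y ∨ T.up (T.par e) = some y := by
        refine root_induction c.closed (fun e he hr => Or.inl ?_) fun e he e' he' hup' hQ => ?_
        · have : e ∈ hang T S (T.par y) := mem_hang.2 ⟨he, par_eq_of_root hup hr⟩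
          rwa [hu, Finset.mem_singleton] at this
        · rcases hQ with rfl | hQ
          · exact Or.inr hup'
          · exact (hstep e he hQ e' he' hup').elim
      have hX : S.X = {y, a, b, z} := by
        ext e
        simp only [Finset.mem_insert, Finset.mem_singleton]
        constructor
        · exact fun he => (hX e he).imp_right (h.eq_of_up c.closed he)
        · rintro (rfl | rfl | rfl | rfl)
          exacts [hy, ha.mem, hb.mem, hz.mem]
      have : S.X.card = 4 := by
        rw [hX, Finset.card_insert_of_notMem (by grind), Finset.card_insert_of_notMem (by grind),
          Finset.card_pair hbz]
      omega
    · exact c.mixedSole h hu hup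
  · obtain ⟨t, ht, hty⟩ : ∃ t ∈ hang T S (T.par y), t ≠ y := by
      by_contra! h'
      exact hu (Finset.eq_singleton_iff_unique_mem.2 ⟨mem_hang.2 ⟨hy, rfl⟩, h'⟩)
    have htl := hleaf t ht hty
    have huy : T.up (T.par y) ≠ some y := T.up_par_ne y
    have huniq : ∀ t' ∈ S.X, (∀ e ∈ S.X, T.up (T.par e) ≠ some t') →
        T.up (T.par t') ≠ some y → t' = t := by
      intro t' ht' hl' hup'
      by_contra hne
      exact htwo ⟨t', ht', t, htl.mem, hl', htl.not_up, hne, hup', by rw [htl.par]; exact huy⟩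
    have hu2 : hang T S (T.par y) = {y, t} := by
      ext e
      simp only [Finset.mem_insert, Finset.mem_singleton]
      constructor
      · intro he
        by_cases hey : e = y
        · exact Or.inl hey
        · have := hleaf e he hey
          exact Or.inr (huniq e this.mem this.not_up (by rw [this.par]; exact huy))
      · rintro (rfl | rfl)
        exacts [mem_hang.2 ⟨hy, rfl⟩, ht]
    rcases hup : T.up (T.par y) with _ | x
    · exfalso
      have hX : ∀ e ∈ S.X, e = y ∨ e = t ∨ T.up (T.par e) = some y := by
        refine root_induction c.closed (fun e he hr => ?_) fun e he e' he' hup' hQ => ?_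
        · have : e ∈ hang T S (T.par y) := mem_hang.2 ⟨he, par_eq_of_root hup hr⟩
          rw [hu2, Finset.mem_insert, Finset.mem_singleton] at this
          tauto
        · rcases hQ with rfl | rfl | hQ
          · exact Or.inr (Or.inr hup')
          · exact (htl.not_up e' he' hup').elim
          · exact (hstep e he hQ e' he' hup').elim
      have hX : S.X = {y, t, a, b, z} := by
        ext e
        simp only [Finset.mem_insert, Finset.mem_singleton]
        constructor
        · exact fun he => (hX e he).imp_right (Or.imp_right (h.eq_of_up c.closed he))
        · rintro (rfl | rfl | rfl | rfl | rfl)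
          exacts [hy, htl.mem, ha.mem, hb.mem, hz.mem]
      have hup' : T.par y ≠ p := fun h' => T.up_par_ne y (by rw [h', up_of_mem_inner h.mem_left])
      have hur' : T.par y ≠ r := fun h' => T.up_par_ne y (by rw [h', up_of_mem_inner h.mem_right])
      have k1 := htl.ne ha hup'
      have k2 := htl.ne hb hup'
      have k3 := htl.ne hz hur'
      have : S.X.card = 5 := by
        rw [hX, Finset.card_insert_of_notMem (by grind), Finset.card_insert_of_notMem (by grind),
          Finset.card_insert_of_notMem (by grind), Finset.card_pair hbz]
      omega
    · have hQ := chain_of_leaves (T := T) (S := S) (y := y) (R := fun e => T.par e = T.par y)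
        (fun e e' h1 h2 => by rw [← h1]; exact h2) fun t' ht' hl' => by
          by_cases hup' : T.up (T.par t') = some y
          · exact Or.inl hup'
          · rw [huniq t' ht' hl' hup']; exact Or.inr htl.par
      exact c.mixedChain h htl (c.closed.up_mem _ (c.closed.par_mem y hy) x hup)
        (inner_eq_of_chain c.closed hy hQ hup) hu2

theorem Pair.up_ne_none (hS : Closed T S) (hdvd : 3 ∣ S.X.card) {y z : E} {w : V} {q d : ℕ}
    (h : Pair T S y w z q d) (hu : hang T S (T.par y) = {y}) : T.up (T.par y) ≠ none := by
  intro hup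
  have hX : ∀ e ∈ S.X, e = y ∨ e = z := by
    refine root_induction hS (fun e he hr => Or.inl ?_) fun e he e' he' hup' hQ => ?_
    · have : e ∈ hang T S (T.par y) := mem_hang.2 ⟨he, par_eq_of_root hup hr⟩
      rwa [hu, Finset.mem_singleton] at this
    · rcases hQ with rfl | rfl
      · exact Or.inr (h.eq_of_up hS he' hup')
      · exact (h.single.2.not_up e' he' hup').elim
  have hX : S.X = {y, z} := by
    ext e
    simp only [Finset.mem_insert, Finset.mem_singleton]
    constructor
    · exact hX e
    · rintro (rfl | rfl)
      exacts [h.mem, h.single.2.mem]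
  rw [hX, Finset.card_pair h.ne] at hdvd
  omega

/-- Any leaf other than `z` allows a reduction, unless `q = 0` and the two leaves have sizes 1 and
2. In that exception the other edges at the parent of `y` decide: a leaf, a second pair or a mixed
edge there gives a reduction, and if there are none, the parent is detached from the edge above or
that edge is cut. If `z` is the only leaf, the tree is a chain. -/
theorem Irreducible.achieves_of_pair (c : Irreducible T 3 S) (hdvd : 3 ∣ S.X.card)
    {y z : E} {w : V} {q d : ℕ} (h : Pair T S y w z q d)
    (hlev : ∀ e ∈ hang T S (T.par y), Bottom T S e) : Achieves T 3 S := by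
  have hy := h.mem
  have hz := h.single.2
  have hw := up_of_mem_inner h.mem_inner
  by_cases hgood : ∃ t s e, LeafAt T S t s e ∧ t ≠ z ∧ (q = 0 → d ≠ e → d = 3 ∨ e = 3)
  · obtain ⟨t, s, e, ht, htz, hne⟩ := hgood
    exact c.pairLeaf h ht htz hne
  push Not at hgood
  by_cases hother : ∃ t ∈ S.X, (∀ e ∈ S.X, T.up (T.par e) ≠ some t) ∧ t ≠ z
  · obtain ⟨t, ht, htl, htz⟩ := hother
    have hleaf := LeafAt.intro ht htl
    obtain ⟨rfl, hde, -, -⟩ := hgood _ _ _ hleaf htz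
    by_cases hroot : ∃ t' e, LeafAt T S t' (T.par y) e
    · obtain ⟨t', e, ht'⟩ := hroot
      exact c.pairLeafAtRoot h ht'
    push Not at hroot
    by_cases hsole : ∃ y₂ ∈ hang T S (T.par y), y₂ ≠ y
    · obtain ⟨y₂, hy₂, hne⟩ := hsole
      have hpar := (mem_hang.1 hy₂).2
      have hin : (inner T S y₂).Nonempty := by
        by_contra h'
        have := inner_empty_leaf c.closed (mem_hang.1 hy₂).1 h'
        rw [hpar] at this
        exact hroot _ _ this
      rcases c.bottom_cases hdvd (hlev y₂ hy₂) hin with h' | ⟨w₂, z₂, q₂, d₂, h'⟩ |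
        ⟨p₂, r₂, a₂, b₂, z₂, h'⟩
      · exact h'
      · by_cases hq : q₂ = 0
        · subst hq
          exact c.pairPair h h' hne.symm hpar
        -- With `q₂ ≠ 0` the exception does not arise, so the second pair takes `z` as its
        -- additional leaf.
        · refine c.pairLeaf h' hz ?_ fun h0 => (hq h0).elim
          refine hz.ne h'.single.2 ?_
          rintro rfl
          rw [up_of_mem_inner h'.mem_inner] at hw
          exact hne (Option.some.inj hw)
      · exact c.achieves_of_mixed hdvd h' (by rw [hpar]; exact hlev)
    · push Not at hsole
      have hu : hang T S (T.par y) = {y} :=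
        Finset.eq_singleton_iff_unique_mem.2 ⟨mem_hang.2 ⟨hy, rfl⟩, hsole⟩
      obtain ⟨x, hx⟩ := Option.ne_none_iff_exists'.1 (h.up_ne_none c.closed hdvd hu)
      by_cases hv : ∃ v ∈ ch T S x, v ≠ T.par y
      · obtain ⟨v, hv, hvu⟩ := hv
        exact c.detachPair h hleaf htz hde hu hx hv hvu
      · push Not at hv
        exact c.pairChain h (c.closed.up_mem _ (c.closed.par_mem y hy) x hx)
          (Finset.eq_singleton_iff_unique_mem.2 ⟨mem_inner_of_up c.closed hy hx,
            fun v hv' => hv v (mem_inner.1 hv').1⟩) hu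
  · push Not at hother
    have hQ : ∀ e ∈ S.X, T.up (T.par e) = some y ∨ Anc T y e := by
      have := chain_of_leaves (T := T) (S := S) (y := y) (R := fun _ => False)
        (fun _ _ h => h.elim) fun t ht htl => Or.inl <| by rw [hother t ht htl, hz.par, hw]
      simpa using this
    have hu := hang_eq_of_chain hy hQ
    obtain ⟨x, hx⟩ := Option.ne_none_iff_exists'.1 (h.up_ne_none c.closed hdvd hu)
    exact c.pairChain h (c.closed.up_mem _ (c.closed.par_mem y hy) x hx)
      (inner_eq_of_chain c.closed hy (fun e he => (hQ e he).imp_right Or.inr) hx) hu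

theorem Irreducible.achieves_three (c : Irreducible T 3 S) (hne : S.X.Nonempty) :
    Achieves T 3 S := by
  intro hdvd
  suffices Achieves T 3 S from this hdvd
  have hcard : 2 < S.X.card := by
    have := Finset.card_pos.2 hne
    omega
  rcases exists_bottom c.closed with hroot | ⟨y, hy, hin, hbot⟩
  · obtain ⟨a, ha, b, hb, t, ht, hab, hat, hbt⟩ := Finset.two_lt_card.1 hcard
    have hl : ∀ z ∈ S.X, LeafAt T S z T.root (ch T S z).card := fun z hz => by
      rw [← (T.up_eq_none _).1 (hroot z hz)]
      exact LeafAt.intro hz fun e he h => by rw [hroot e he] at h; cases h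
    exact c.threeLeaves hab hat hbt (hl a ha) (hl b hb) (hl t ht)
  · have hlev : ∀ e ∈ hang T S (T.par y), Bottom T S e := fun e he =>
      hbot e (mem_hang.1 he).1 (depth_eq_of_par_eq (mem_hang.1 he).2).ge
    rcases c.bottom_cases hdvd (hbot y hy le_rfl) hin with h | ⟨w, z, q, d, h⟩ | ⟨p, r, a, b, z, h⟩
    · exact h
    · exact c.achieves_of_pair hdvd h hlev
    · exact c.achieves_of_mixed hdvd h hlev

end HypertreeCordial

namespace HypertreeCordial

set_option linter.unusedSectionVars false

variable {V E : Type*} [DecidableEq V] [DecidableEq E] {T : Rooting V E} {S S₀ S₁ : State V E}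

/-! ### The induction -/

/-- Only the root is left, and its label is free. -/
theorem achieves_of_no_edges {k : ℕ} (hk : k = 2 ∨ k = 3) (hS : Closed T S) (hX : S.X = ∅) :
    Achieves T k S := by
  have hW : S.W = {T.root} := by
    refine Finset.eq_singleton_iff_unique_mem.2 ⟨hS.root_mem, fun v hv => ?_⟩
    rcases h : T.up v with _ | e
    · exact (T.up_eq_none v).1 h
    · have := hS.up_mem v hv e h
      simp [hX] at this
  have key : ∀ x < k, (∀ v : V, (fun _ : V => x) v < k) ∧ cntV 1 S (fun _ => x) = ind 1 x ∧
      cntV 2 S (fun _ => x) = ind 2 x ∧ cntE T k 1 S (fun _ => x) = 0 ∧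
      cntE T k 2 S (fun _ => x) = 0 := fun x hx =>
    ⟨fun _ => hx, by simp [cntV, hW], by simp [cntV, hW], by simp [cntE, hX], by simp [cntE, hX]⟩
  intro _ t ht
  rw [hW, Finset.card_singleton] at ht
  have ht' : ∃ x < k, t = ind 1 x + 16 * ind 2 x := by
    rcases hk with rfl | rfl
    · simp [allowed, vbal] at ht
      rcases ht with rfl | rfl
      exacts [⟨0, by omega, rfl⟩, ⟨1, by omega, rfl⟩]
    · simp [allowed, vbal] at ht
      rcases ht with rfl | rfl | rfl
      exacts [⟨0, by omega, rfl⟩, ⟨1, by omega, rfl⟩, ⟨2, by omega, rfl⟩]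
  obtain ⟨x, hx, rfl⟩ := ht'
  obtain ⟨h0, h1, h2, h3, h4⟩ := key x hx
  have hdiv : 1 / k = 0 := Nat.div_eq_of_lt (by omega)
  have := ind_le 1 x
  have := ind_le 2 x
  refine ⟨_, h0, ?_, ?_, ?_, ?_⟩
  · rw [h1, hW, Finset.card_singleton, hdiv]; omega
  · rw [h2, hW, Finset.card_singleton, hdiv]; omega
  · rw [h3, hX, Finset.card_empty, Nat.zero_div]; omega
  · rw [h4, hX, Finset.card_empty, Nat.zero_div]; omega

theorem blockSize_pos {k : ℕ} : 0 < blockSize k := by unfold blockSize; split_ifs <;> omega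

/-- A state is irreducible, or a block of private vertices can be removed. -/
theorem irreducible_or_removePrivate {k : ℕ} (hk : k = 2 ∨ k = 3) (hS : Closed T S)
    (ih : ∀ S₀, Closed T S₀ → S₀.W.card + S₀.X.card < S.W.card + S.X.card → Achieves T k S₀) :
    Irreducible T k S ∨ ∃ e P, P ⊆ ch T S e ∧ (∀ v ∈ P, hang T S v = ∅) ∧ P.card = blockSize k ∧
      Closed T (removePrivate S P) ∧
      (removePrivate S P).W.card + (removePrivate S P).X.card < S.W.card + S.X.card := by
  by_cases h : ∀ e ∈ S.X, ∀ P ⊂ ch T S e, (∀ v ∈ P, hang T S v = ∅) → P.card ≠ blockSize k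
  · exact Or.inl ⟨hk, hS, ih, h⟩
  · push Not at h
    obtain ⟨e, he, P, hP, hpriv, hc⟩ := h
    refine Or.inr ⟨e, P, hP.1, hpriv, hc, closed_removePrivate hS hP hpriv, ?_⟩
    have h1 := card_removePrivate (hP.1.trans (ch_subset (T := T) (S := S) e))
    have h2 : (removePrivate S P).X = S.X := rfl
    have := blockSize_pos (k := k)
    rw [h2]
    omega

theorem achieves {k : ℕ} (hk : k = 2 ∨ k = 3) (n : ℕ) :
    ∀ S : State V E, Closed T S → S.W.card + S.X.card = n → Achieves T k S := by
  induction n using Nat.strong_induction_on with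
  | _ n ih =>
    rintro S hS rfl
    rcases S.X.eq_empty_or_nonempty with hX | hX
    · exact achieves_of_no_edges hk hS hX
    rcases irreducible_or_removePrivate hk hS fun S₀ hS₀ hlt => ih _ hlt S₀ hS₀ rfl with
      c | ⟨e, P, h1, h2, h3, h4, h5⟩
    · rcases hk with rfl | rfl
      exacts [c.achieves_two hX, c.achieves_three hX]
    · exact Achieves.of_removePrivate hk h1 h2 h3 (ih _ h5 _ h4 rfl)

theorem Achieves.balanced {k : ℕ} (hk : k = 2 ∨ k = 3) (h : Achieves T k S)
    (hdvd : k ∣ S.X.card) : Balanced T k S := by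
  have hr : S.W.card % k < k := Nat.mod_lt _ (by omega)
  have ht : ∃ t, t ∈ allowed k (S.W.card % k) ∧ t ∈ vbal k (S.W.card % k) := by
    generalize S.W.card % k = r at hr
    rcases hk with rfl | rfl <;> interval_cases r <;> simp [allowed, vbal]
  obtain ⟨t, h1, h2⟩ := ht
  obtain ⟨f, hf⟩ := h hdvd t h1
  exact ⟨t, h2, 0, by simp [vbal, Nat.mod_eq_zero_of_dvd hdvd], f, hf⟩

/-! ### Edge numbers not divisible by k, and the resulting counts -/

theorem exists_leaf (hX : S.X.Nonempty) : ∃ z ∈ S.X, ∀ e ∈ S.X, T.up (T.par e) ≠ some z := by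
  obtain ⟨z, hz, hmax⟩ := S.X.exists_max_image T.depth hX
  refine ⟨z, hz, fun e he hup => ?_⟩
  have := T.depth_eq _ _ hup
  have := hmax e he
  omega

theorem Irreducible.balanced_of_built {k : ℕ} (c : Irreducible T k S) {Z : Finset E}
    {vs : List V} {ops : List Op} (h : Built T (cut T S Z ∅) vs [] ops S)
    (hc : checkFinal k ops vs.length = true) (hvs : ∀ v ∈ vs, v ∈ (cut T S Z ∅).W)
    (hmod : S.X.card % k = (ops.map Op.newE).sum % k) (hpos : 0 < (ops.map Op.newE).sum) :
    Balanced T k S := by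
  have hcard := h.card
  refine h.balanced c.hk c.closed hvs ?_ hc (c.achieves _ (h.closed c.closed) ?_)
  · rw [hcard.2] at hmod
    rcases c.hk with rfl | rfl <;> omega
  · omega

/-- Two edges have to go: two leaves if possible. If there is only one leaf, the edges form a chain,
and the leaf goes together with the edge above it. -/
theorem Irreducible.balanced_three (c : Irreducible T 3 S) (hmod : S.X.card % 3 = 2) :
    Balanced T 3 S := by
  obtain ⟨z, hz, hzl⟩ := exists_leaf (T := T) (S := S) (Finset.card_pos.1 (by omega))
  have hleaf := LeafAt.intro hz hzl
  by_cases htwo : ∃ t ∈ S.X, (∀ e ∈ S.X, T.up (T.par e) ≠ some t) ∧ t ≠ z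
  · obtain ⟨t, ht, htl, htz⟩ := htwo
    have hleaf' := LeafAt.intro ht htl
    have H := ((Built.start [T.par z, T.par t] []).cutLeaf hleaf' (i := 1) (by grind) rfl).cutLeaf
      hleaf (i := 0) (by grind) rfl
    refine c.balanced_of_built H (check_finalTwoLeaves _ (c.leaf_mem_three hleaf) _
      (c.leaf_mem_three hleaf')) ?_ (by simp [Op.newE, hmod]) (by simp [Op.newE])
    simpa [mem_cut_W] using ⟨⟨hleaf.mem_W c.closed, hleaf.up_ne hleaf, hleaf.up_ne hleaf'⟩,
      hleaf'.mem_W c.closed, hleaf'.up_ne hleaf, hleaf'.up_ne hleaf'⟩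
  · push Not at htwo
    have hQ : ∀ e ∈ S.X, Anc T z e := by
      refine leaf_induction (T := T) (fun t ht htl => ?_) fun e he e' he' hup h => h.tail hup
      rw [htwo t ht htl]
      exact Relation.ReflTransGen.refl
    rcases hup : T.up (T.par z) with _ | y
    · exfalso
      have hX : S.X = {z} := by
        refine Finset.eq_singleton_iff_unique_mem.2 ⟨hz, fun e he => ?_⟩
        rcases Relation.ReflTransGen.cases_head (hQ e he) with h | ⟨e', h, -⟩
        · exact h.symm
        · rw [hup] at h; cases h
      rw [hX, Finset.card_singleton] at hmod
      omega
    · have hy := c.closed.up_mem _ (c.closed.par_mem z hz) y hup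
      have hin := inner_eq_of_chain c.closed hz (fun e he => Or.inr (Or.inr (hQ e he))) hup
      have hu := hang_eq_of_chain hz fun e he => Or.inr (hQ e he)
      have hw : T.par z ∈ inner T S y := by simp [hin]
      obtain ⟨q, hq, hq'⟩ := c.exists_private_card hw
      rw [hin, Finset.card_singleton] at hq
      have hyz := (hleaf.ne_of_inner hw).symm
      have H := ((Built.start [T.par y, T.par z] []).cutLeaf hleaf (i := 1) (by grind)
        rfl).cutInner (i := 0) (vs := [T.par y]) [T.par z] hy (by grind) rfl (by simp)
        (by simpa using (mem_inner.1 hw).1)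
        (fun e he hup => by
          have : e ∈ hang T S (T.par z) :=
            mem_hang.2 ⟨he, child_edge_of_inner_singleton c.closed hin he hup⟩
          rw [hu] at this
          grind) hq
      refine c.balanced_of_built H (check_finalPair q (mem_of_lt_three hq') _
        (c.leaf_mem_three hleaf)) ?_ (by simp [Op.newE, hmod]) (by simp [Op.newE])
      simpa [mem_cut_W] using ⟨c.closed.par_mem y hy, T.up_par_ne y, hzl y hy⟩

theorem Irreducible.balanced {k : ℕ} (c : Irreducible T k S) (hnd : ¬ k ∣ S.X.card) :
    Balanced T k S := by
  have hX : S.X.Nonempty := by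
    rw [Finset.nonempty_iff_ne_empty]
    intro h
    simp [h] at hnd
  by_cases h2 : S.X.card % k = 2
  · rcases c.hk with rfl | rfl
    · omega
    · exact c.balanced_three h2
  obtain ⟨z, hz, hzl⟩ := exists_leaf (T := T) hX
  have hleaf := LeafAt.intro hz hzl
  have H := (Built.start [T.par z] []).cutLeaf hleaf (i := 0) (by grind) rfl
  rcases c.hk with rfl | rfl
  · refine c.balanced_of_built H (check_two_finalLeaf _ (c.leaf_mem_two hleaf)) ?_
      (by simp [Op.newE]; omega) (by simp [Op.newE])
    simpa [mem_cut_W] using ⟨hleaf.mem_W c.closed, hleaf.up_ne hleaf⟩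
  · refine c.balanced_of_built H (check_finalLeaf _ (c.leaf_mem_three hleaf)) ?_
      (by simp [Op.newE]; omega) (by simp [Op.newE])
    simpa [mem_cut_W] using ⟨hleaf.mem_W c.closed, hleaf.up_ne hleaf⟩

theorem balanced {k : ℕ} (hk : k = 2 ∨ k = 3) (n : ℕ) :
    ∀ S : State V E, Closed T S → S.W.card + S.X.card = n → Balanced T k S := by
  induction n using Nat.strong_induction_on with
  | _ n ih =>
    rintro S hS rfl
    by_cases hdvd : k ∣ S.X.card
    · exact (achieves hk _ S hS rfl).balanced hk hdvd
    rcases irreducible_or_removePrivate hk hS fun S₀ hS₀ _ => achieves hk _ S₀ hS₀ rfl with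
      c | ⟨e, P, h1, h2, h3, h4, h5⟩
    · exact c.balanced hdvd
    · exact Balanced.of_removePrivate hk h1 h2 h3 (ih _ h5 _ h4 rfl)

theorem sum_ind {k : ℕ} (hk : k = 2 ∨ k = 3) {A : Type*} (s : Finset A) (g : A → ℕ)
    (hg : ∀ a ∈ s, g a < k) :
    (∑ a ∈ s, ind 0 (g a)) + (∑ a ∈ s, ind 1 (g a)) + (k - 2) * (∑ a ∈ s, ind 2 (g a)) =
      s.card := by
  rw [Finset.mul_sum, ← Finset.sum_add_distrib, ← Finset.sum_add_distrib, Finset.card_eq_sum_ones]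
  refine Finset.sum_congr rfl fun a ha => ?_
  have := hg a ha
  generalize g a = x at this
  rcases hk with rfl | rfl <;> interval_cases x <;> rfl

theorem le_add_one_of_vbal {k n t : ℕ} (hk : k = 2 ∨ k = 3) (ht : t ∈ vbal k (n % k)) {c : ℕ → ℕ}
    (hsum : c 0 + c 1 + (k - 2) * c 2 = n) (h1 : c 1 = n / k + t % 16)
    (h2 : c 2 = (k - 2) * (n / k) + t / 16 % 16) : ∀ i < k, ∀ j < k, c i ≤ c j + 1 := by
  have hr : n % k < k := Nat.mod_lt _ (by omega)
  have hn := Nat.div_add_mod n k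
  generalize n % k = r at *
  generalize n / k = m at *
  subst hn
  intro i hi j hj
  rcases hk with rfl | rfl <;> interval_cases r <;> simp [vbal] at ht <;>
    interval_cases i <;> interval_cases j <;> omega

/-- The numbers of vertices and of edges with given labels pairwise differ by at most 1. -/
theorem exists_labelling_counts {k : ℕ} (hk : k = 2 ∨ k = 3) (hS : Closed T S) :
    ∃ f : V → ℕ, (∀ v, f v < k) ∧ ∀ i < k, ∀ j < k,
      cntV i S f ≤ cntV j S f + 1 ∧ cntE T k i S f ≤ cntE T k j S f + 1 := by
  obtain ⟨t, ht, b, hb, f, h0, h1, h2, h3, h4⟩ := balanced hk _ S hS rfl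
  have ht' : t ≤ 17 := by
    rcases mem_vbal ht with rfl | rfl | ⟨-, rfl | rfl⟩ <;> omega
  have hb' : b ≤ 17 := by
    rcases mem_vbal hb with rfl | rfl | ⟨-, rfl | rfl⟩ <;> omega
  refine ⟨f, h0, fun i hi j hj => ⟨?_, ?_⟩⟩
  · refine le_add_one_of_vbal (c := fun i => cntV i S f) hk ht
      (sum_ind hk S.W f fun v _ => h0 v) ?_ ?_ i hi j hj
    · rw [h1]; congr 1; omega
    · rw [h2]; congr 1; omega
  · refine le_add_one_of_vbal (c := fun i => cntE T k i S f) hk hb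
      (sum_ind hk S.X (lab T k S f) fun e _ => lab_lt (by omega) S f e) ?_ ?_ i hi j hj
    · rw [h3]; congr 1; omega
    · rw [h4]; congr 1; omega

end HypertreeCordial

/-! ### From the incidence tree to a rooting, and from counts to cordiality -/

namespace HypertreeCordial
set_option linter.unusedSectionVars false

theorem exists_adj_dist_add_one {U : Type*} {G : SimpleGraph U} (hG : G.Connected) (r : U)
    {x : U} (hx : x ≠ r) : ∃ y, G.Adj x y ∧ G.dist r y + 1 = G.dist r x := by
  obtain ⟨p, hp⟩ := hG.exists_walk_length_eq_dist x r
  cases p with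
  | nil => exact absurd rfl hx
  | @cons _ y _ h q =>
    refine ⟨y, h, ?_⟩
    have h₁ := SimpleGraph.dist_le q
    have h₂ := hG.dist_triangle (u := r) (v := y) (w := x)
    rw [SimpleGraph.dist_eq_one_iff_adj.2 h.symm] at h₂
    rw [SimpleGraph.dist_comm] at h₁
    rw [SimpleGraph.Walk.length_cons, SimpleGraph.dist_comm] at hp
    omega

/-- Shortest paths to `y` and to `z`, each extended by `x`, are two paths from `r` to `x`. In a tree
they coincide, and so do their penultimate vertices. -/
theorem eq_of_adj_of_dist_add_one {U : Type*} {G : SimpleGraph U} (hG : G.IsTree) (r : U)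
    {x y z : U} (hy : G.Adj x y) (hz : G.Adj x z) (hdy : G.dist r y + 1 = G.dist r x)
    (hdz : G.dist r z + 1 = G.dist r x) : y = z := by
  classical
  obtain ⟨p, hp, hpl⟩ := hG.connected.exists_path_of_dist r y
  obtain ⟨q, hq, hql⟩ := hG.connected.exists_path_of_dist r z
  -- A walk shorter than the distance to `x` cannot pass through `x`.
  have avoid : ∀ {w : U} (s : G.Walk r w), s.length + 1 = G.dist r x → x ∉ s.support := by
    intro w s hs hmem
    have h₁ := SimpleGraph.dist_le (s.takeUntil x hmem)
    have h₂ := s.length_takeUntil_le_length hmem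
    omega
  have hp' := hp.concat (avoid p (by omega)) hy.symm
  have hq' := hq.concat (avoid q (by omega)) hz.symm
  have := Subtype.mk.inj ((hG.isAcyclic.subsingleton_path r x).elim ⟨_, hp'⟩ ⟨_, hq'⟩)
  have h := congrArg SimpleGraph.Walk.penultimate this
  simpa using h

variable {α : Type*}

/-- A rooting of the incidence tree describes membership in the edges. -/
theorem exists_rooting (H : Hypergraph α) (hcard : ∀ e ∈ H.edgeSet, 2 ≤ e.ncard)
    (hH : H.IsHypertree) : ∃ T : Rooting H.vertexSet H.edgeSet, ∀ (v : H.vertexSet)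
      (e : H.edgeSet), ((v : α) ∈ (e : Set α) ↔ v = T.par e ∨ T.up v = some e) ∧
        (v = T.par e → T.up v ≠ some e) := by
  classical
  set G := H.incidenceGraph with hGdef
  have hG : G.IsTree := ⟨hH.1, hH.2⟩
  have hroot : Nonempty H.vertexSet := by
    obtain ⟨v | e⟩ := hH.1.nonempty
    · exact ⟨v⟩
    · have h2 := hcard e e.2
      obtain ⟨x, hx⟩ := Set.nonempty_of_ncard_ne_zero (s := (e : Set α)) (by omega)
      exact ⟨⟨x, H.mem_vertexSet_of_mem_edgeSet e.2 hx⟩⟩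
  obtain ⟨r⟩ := hroot
  set d : H.vertexSet ⊕ H.edgeSet → ℕ := G.dist (Sum.inl r) with hd
  have hpar : ∀ e : H.edgeSet, ∃ v : H.vertexSet,
      (v : α) ∈ (e : Set α) ∧ d (.inl v) + 1 = d (.inr e) := by
    intro e
    obtain ⟨v | e', ha, hde⟩ := exists_adj_dist_add_one hG.connected (Sum.inl r)
      (x := Sum.inr e) (by simp)
    · exact ⟨v, ha, hde⟩
    · exact ha.elim
  have hup : ∀ v : H.vertexSet, v ≠ r → ∃ e : H.edgeSet,
      (v : α) ∈ (e : Set α) ∧ d (.inr e) + 1 = d (.inl v) := by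
    intro v hv
    obtain ⟨v' | e, ha, hde⟩ := exists_adj_dist_add_one hG.connected (Sum.inl r)
      (x := Sum.inl v) (by simpa using hv)
    · exact ha.elim
    · exact ⟨e, ha, hde⟩
  choose par hpar_mem hpar_d using hpar
  choose up hup_mem hup_d using hup
  have hpar_unique : ∀ (v : H.vertexSet) (e : H.edgeSet), (v : α) ∈ (e : Set α) →
      d (.inl v) + 1 = d (.inr e) → v = par e := fun v e hm h ↦
    Sum.inl_injective (eq_of_adj_of_dist_add_one hG (Sum.inl r) (x := Sum.inr e)
      (y := Sum.inl v) (z := Sum.inl (par e)) hm (hpar_mem e) h (hpar_d e))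
  have hup_unique : ∀ (v : H.vertexSet) (e : H.edgeSet) (hv : v ≠ r), (v : α) ∈ (e : Set α) →
      d (.inr e) + 1 = d (.inl v) → up v hv = e := fun v e hv hm h ↦
    Sum.inr_injective (eq_of_adj_of_dist_add_one hG (Sum.inl r) (x := Sum.inl v)
      (y := Sum.inr (up v hv)) (z := Sum.inr e) (hup_mem v hv) hm (hup_d v hv) h)
  have hdr : d (.inl r) = 0 := SimpleGraph.dist_self
  refine ⟨{
    root := r
    par := par
    up := fun v ↦ if hv : v = r then none else some (up v hv)
    -- Edges have odd distance from the root vertex, so the topmost ones, at distance 1, get depth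
    -- 0.
    depth := fun e ↦ d (.inr e) / 2
    up_eq_none := fun v ↦ by by_cases hv : v = r <;> simp [hv]
    depth_root := fun e he ↦ by
      have hr : par e = r := by
        by_contra hv
        simp [hv] at he
      have := hpar_d e
      rw [hr, hdr] at this
      omega
    depth_eq := fun e e' he ↦ by
      by_cases hv : par e = r
      · simp [hv] at he
      · simp only [hv, dite_false, Option.some.injEq] at he
        have h₁ := hpar_d e
        have h₂ := hup_d (par e) hv
        rw [he] at h₂
        omega }, fun v e ↦ ⟨⟨fun hm ↦ ?_, ?_⟩, ?_⟩⟩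
  -- In a tree, distances from the root to adjacent nodes differ by exactly 1; the sign tells
  -- whether `v` is a child or the parent of `e`.
  · obtain h | h : d (.inl v) = d (.inr e) + 1 ∨ d (.inr e) = d (.inl v) + 1 :=
      hG.dist_eq_dist_add_one_of_adj (Sum.inl r) (v := Sum.inl v) (w := Sum.inr e) hm
    · right
      have hv : v ≠ r := by
        rintro rfl
        omega
      simp [hv, hup_unique v e hv hm h.symm]
    · exact .inl (hpar_unique v e hm h.symm)
  · rintro (rfl | h)
    · exact hpar_mem e
    · by_cases hv : v = r
      · simp [hv] at h
      · simp only [hv, dite_false, Option.some.injEq] at h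
        exact h ▸ hup_mem v hv
  · rintro rfl h
    by_cases hv : par e = r
    · simp [hv] at h
    · simp only [hv, dite_false, Option.some.injEq] at h
      have h₁ := hpar_d e
      have h₂ := hup_d (par e) hv
      rw [h] at h₂
      omega

theorem ncard_cast_eq {ι : Type*} [Fintype ι] {k : ℕ} [NeZero k] (g : ι → ℕ)
    (hg : ∀ x, g x < k) (a : ZMod k) :
    {x | (g x : ZMod k) = a}.ncard = ∑ x, ind a.val (g x) := by
  classical
  have : {x | (g x : ZMod k) = a} = ↑(Finset.univ.filter fun x ↦ g x = a.val) := by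
    ext x
    simp only [Set.mem_ofPred_eq, Finset.coe_filter, Finset.mem_univ, true_and]
    constructor
    · rintro rfl
      rw [ZMod.val_natCast_of_lt (hg x)]
    · intro h
      rw [h, ZMod.natCast_zmod_val]
  rw [this, Set.ncard_coe_finset, Finset.card_filter]
  rfl

theorem isCordial (H : Hypergraph α) (hfin : H.vertexSet.Finite)
    (hcard : ∀ e ∈ H.edgeSet, 2 ≤ e.ncard) (hH : H.IsHypertree) {k : ℕ} (hk : k = 2 ∨ k = 3) :
    H.IsCordial k := by
  classical
  have : NeZero k := ⟨by omega⟩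
  have : Fintype H.vertexSet := hfin.fintype
  have : Fintype H.edgeSet :=
    (hfin.powerset.subset H.edgeSet_subset_powerset_vertexSet).fintype
  obtain ⟨T, hT⟩ := exists_rooting H hcard hH
  set S : State H.vertexSet H.edgeSet := ⟨Finset.univ, Finset.univ⟩ with hS
  have hmem : ∀ e : H.edgeSet, (Finset.univ.filter fun v : H.vertexSet ↦ (v : α) ∈ (e : Set α)) =
      insert (T.par e) (ch T S e) := by
    intro e
    ext v
    simp [ch, hS, (hT v e).1]
  have hnotin : ∀ e, T.par e ∉ ch T S e := fun e ↦ by simp [ch, (hT _ e).2 rfl]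
  have hclosed : Closed T S := by
    refine ⟨by simp [hS], by simp [hS], by simp [hS], fun e _ ↦ ?_⟩
    -- This is where edges need two vertices: one different from the parent is a child.
    obtain ⟨x, hx, hne⟩ := Set.exists_ne_of_one_lt_ncard (hcard e e.2) (T.par e : α)
    refine ⟨⟨x, H.mem_vertexSet_of_mem_edgeSet e.2 hx⟩, ?_⟩
    obtain h | h := (hT ⟨x, H.mem_vertexSet_of_mem_edgeSet e.2 hx⟩ e).1.1 hx
    · exact absurd (congrArg Subtype.val h) hne
    · simp [ch, hS, h]
  obtain ⟨f, hf, hcount⟩ := exists_labelling_counts hk hclosed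
  have hlab : ∀ e, H.edgeLabel (fun v ↦ (f v : ZMod k)) e = (lab T k S f e : ℕ) := by
    intro e
    rw [Hypergraph.edgeLabel, finsum_eq_sum_of_fintype]
    simp only [finsum_eq_if]
    rw [← Finset.sum_filter, hmem, Finset.sum_insert (hnotin e), lab, ZMod.natCast_mod]
    push_cast
    rfl
  have hv : ∀ a : ZMod k, H.vertexCount (fun v ↦ (f v : ZMod k)) a = cntV a.val S f := fun a ↦
    ncard_cast_eq f hf a
  have he : ∀ a : ZMod k, H.edgeCount (fun v ↦ (f v : ZMod k)) a = cntE T k a.val S f := by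
    intro a
    simp only [Hypergraph.edgeCount, hlab]
    exact ncard_cast_eq (lab T k S f) (fun e ↦ Nat.mod_lt _ (by omega)) a
  refine ⟨fun v ↦ (f v : ZMod k), fun a b ↦ ?_⟩
  have hab := hcount a.val a.val_lt b.val b.val_lt
  have hba := hcount b.val b.val_lt a.val a.val_lt
  rw [hv, hv, he, he, abs_le, abs_le]
  omega

end HypertreeCordial

theorem theorem1 {α : Type*} (H : Hypergraph α) (hfin : H.vertexSet.Finite)
    (hcard : ∀ e ∈ H.edgeSet, 2 ≤ e.ncard) (hH : H.IsHypertree) (k : ℕ) (hk : k = 2 ∨ k = 3) :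
    H.IsCordial k :=
  HypertreeCordial.isCordial H hfin hcard hH hk
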